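/- **Setting.** Write $\Lambda^{\sigma}=(-\Delta)^{\sigma/2}$ for the Fourier multiplier with symbol $|\xi|^{\sigma}$ on $\mathbb R^3$, and $L^2_\sigma(\mathbb R^3)$ for the fields in $L^2(\mathbb R^3;\mathbb R^3)$ that are divergence free in the sense of distributions. For $\alpha\ge 1$ and $0<T\le\infty$, consider the fractional MHD system on $\mathbb R^3\times(0,T)$ $$u_t+\Lambda^{2\alpha}u+(u\cdot\nabla)u-(B\cdot\nabla)B+\nabla\pi=0,\quad B_t+\Lambda^{2\alpha}B+(u\cdot\nabla)B-(B\cdot\nabla)u=0,\quad \operatorname{div}u=\operatorname{div}B=0,$$ with $u(0)=u_0$, $B(0)=B_0$ in $L^2_\sigma(\mathbb R^3)$. A *Leray–Hopf weak solution* is a pair $u,B\in L^\infty(0,T;L^2_\sigma)\cap L^2(0,T;H^\alpha)$ such that (i) for all test fields $\phi,\psi\in C_0^\infty([0,T);C^\infty_{0,\sigma}(\mathbb R^3))$ (smooth, compactly supported in $[0,T)\times\mathbb R^3$, divergence free in $x$), $$\int_0^T\big[(\phi_\tau+(u\cdot\nabla)\phi,u)-(u,\Lambda^{2\alpha}\phi)-((B\cdot\nabla)\phi,B)\big]d\tau=-(u_0,\phi(0)),$$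 $$\int_0^T\big[(\psi_\tau+(u\cdot\nabla)\psi,B)-(B,\Lambda^{2\alpha}\psi)-((B\cdot\nabla)\psi,u)\big]d\tau=-(B_0,\psi(0));$$ (ii) $\tfrac12\|u(t)\|_{L^2}^2+\tfrac12\|B(t)\|_{L^2}^2+\int_0^t(\|\Lambda^\alpha u\|_{L^2}^2+\|\Lambda^\alpha B\|_{L^2}^2)\,d\tau\le\tfrac12\|u_0\|_{L^2}^2+\tfrac12\|B_0\|_{L^2}^2$ for all $t\in(0,T)$; (iii) $u(t)\to u_0$ and $B(t)\to B_0$ in $L^2$ as $t\to0^+$. For $1<r<\infty$ and $0\le s<3/r$ let $\dot W^{s,r}(\mathbb R^3)$ be the homogeneous Sobolev space of functions $f\in L^{r^*}$, $\frac1{r^*}=\frac1r-\frac s3$, with $\Lambda^s f\in L^r$, normed by $\|\Lambda^s f\|_{L^r}$. For $1\le m<\infty$, the multiplier norm of a function $\varphi$ is $\|\varphi\|_{\mathcal M(\dot W^{s,r}\to L^m)}=\sup_{f\ne0}\|\varphi f\|_{L^m}/\|f\|_{\dot W^{s,r}}$. For a matrix field such as $\nabla u$, the norm in $\mathcal M^3(\dot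 W^{s,r}\to L^m)$ is the square root of the sum of the squares of the multiplier norms of its entries. **Theorem 1.5.** Let $\alpha\ge1$, $\beta\ge0$, $-1\le\theta<0$, $0<T\le\infty$, $u_0,B_0\in L^2_\sigma(\mathbb R^3)$, and let $(u,B)$ be a Leray–Hopf weak solution of the fractional MHD system on $(0,T)$ with initial data $(u_0,B_0)$. Let $2\le p<\infty$ and $\frac1p+\frac1q=\frac12$ (so $2<q\le\infty$), and suppose that $$\nabla u,\ \nabla B\in L^p\Big(0,T;\mathcal M^3\big(\dot W^{\frac{1+\theta}{1+\beta},\frac{6-3\theta}{3-\theta^2}}\to L^{\frac{12-6\theta}{9-5\theta}}\big)\Big),\qquad u,\ B\in L^q\Big(0,T;L^{\frac{12-6\theta}{3-\theta}}\Big).$$ Then, after redefinition on a null set of times, $u$ and $B$ are weakly continuous from $[0,T)$ to $L^2$ with $u(0)=u_0$, $B(0)=B_0$, and for every $0\le t<T$ $$\frac12\|u(t)\|_{L^2}^2+\frac12\|B(t)\|_{L^2}^2+\int_0^t\big(\|\Lambda^\alpha u(\tau)\|_{L^2}^2+\|\Lambda^\alpha B(\tau)\|_{L^2}^2\big)\,d\tau=\frac12\|u_0\|_{L^2}^2+\frac12\|B_0\|_{L^2}^2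 .$$ -/

import Mathlib

open MeasureTheory Filter Topology
open scoped ENNReal ContDiff FourierTransform SchwartzMap RealInnerProductSpace

noncomputable section

namespace FractionalMHD

/-- Physical space `ℝ³` with the Euclidean norm. -/
abbrev E3 : Type := EuclideanSpace ℝ (Fin 3)

/-- `L²(ℝ³; ℝ³)`. -/
abbrev L2 : Type := Lp E3 2 (volume : Measure E3)

/-- The open time interval `(0, T)`, where `T = ⊤` is allowed. -/
def timeIoo (T : EReal) : Set ℝ := {t | 0 < t ∧ (t : EReal) < T}

/-- The time interval `[0, T)`. -/
def timeIco (T : EReal) : Set ℝ := {t | 0 ≤ t ∧ (t : EReal) < T}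

/-- Lebesgue measure on `(0, T)`. -/
def timeMeasure (T : EReal) : Measure ℝ := volume.restrict (timeIoo T)

/-- `Λ^σ φ` for a (rapidly decaying smooth) real function `φ`: the Fourier multiplier with symbol
`|ξ|^σ`. Mathlib's Fourier transform has the kernel `exp (-2πi⟨x, ξ⟩)`, hence the factor `2π`.
The result is real valued because the symbol is even. -/
def Lam (σ : ℝ) (φ : E3 → ℝ) : E3 → ℝ := fun x =>
  (𝓕⁻ (fun ξ : E3 => (((2 * Real.pi * ‖ξ‖) ^ σ : ℝ) : ℂ) * 𝓕 (fun y : E3 => (φ y : ℂ)) ξ) x).re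

/-- `Λ^σ` applied to each component of a vector field. -/
def LamVec (σ : ℝ) (φ : E3 → E3) : E3 → E3 := fun x =>
  WithLp.toLp 2 fun j => Lam σ (fun y => φ y j) x

/-- The `j`-th coordinate as a complex valued continuous `ℝ`-linear map. -/
def coordC (j : Fin 3) : E3 →L[ℝ] ℂ :=
  Complex.ofRealCLM.comp (EuclideanSpace.proj (𝕜 := ℝ) j)

/-- The `j`-th component of an `L²` vector field, as an element of `L²(ℝ³; ℂ)`. -/
def compC (j : Fin 3) (f : L2) : Lp ℂ 2 (volume : Measure E3) := (coordC j).compLp f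

/-- `‖Λ^α f‖²_{L²}` for a vector field `f ∈ L²`, read off from the `L²` Fourier transform;
it is `∞` unless `f ∈ H^α`. -/
def lamSq (α : ℝ) (f : L2) : ℝ≥0∞ :=
  ∑ j : Fin 3, ∫⁻ ξ : E3, ENNReal.ofReal ((2 * Real.pi * ‖ξ‖) ^ (2 * α)) *
    ‖(𝓕 (compC j f) : Lp ℂ 2 (volume : Measure E3)) ξ‖ₑ ^ 2

/-- `f ∈ L²_σ`: the field has divergence zero in the sense of distributions. -/
def IsSolenoidal (f : L2) : Prop :=
  ∀ φ : E3 → ℝ, ContDiff ℝ ∞ φ → HasCompactSupport φ → ∫ x, fderiv ℝ φ x (f x) = 0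

/-- Test fields `ψ ∈ C₀^∞([0,T); C^∞_{0,σ}(ℝ³))`, as restrictions to times `t ≥ 0` of smooth
divergence free fields with compact support in `(-∞, T) × ℝ³`. -/
structure IsTestField (T : EReal) (ψ : ℝ → E3 → E3) : Prop where
  smooth : ContDiff ℝ ∞ (fun z : ℝ × E3 => ψ z.1 z.2)
  compact : HasCompactSupport (fun z : ℝ × E3 => ψ z.1 z.2)
  support : ∀ z ∈ tsupport (fun z : ℝ × E3 => ψ z.1 z.2), (z.1 : EReal) < T
  divFree : ∀ t x, ∑ i : Fin 3, fderiv ℝ (ψ t) x (EuclideanSpace.single i 1) i = 0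

/-- `f ∈ L^∞(0,T; L²_σ) ∩ L²(0,T; H^α)`. -/
structure InEnergyClass (α : ℝ) (T : EReal) (f : ℝ → L2) : Prop where
  bounded : MemLp f ⊤ (timeMeasure T)
  solenoidal : ∀ᵐ t ∂(timeMeasure T), IsSolenoidal (f t)
  dissipation : ∫⁻ t, (‖f t‖ₑ ^ 2 + lamSq α (f t)) ∂(timeMeasure T) < ⊤

/-- `½‖u‖² + ½‖B‖²`. -/
def kinetic (u B : L2) : ℝ≥0∞ := (‖u‖ₑ ^ 2 + ‖B‖ₑ ^ 2) / 2

/-- `½‖u(t)‖² + ½‖B(t)‖² + ∫₀ᵗ (‖Λ^α u‖² + ‖Λ^α B‖²) dτ`. -/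
def totalEnergy (α : ℝ) (u B : ℝ → L2) (t : ℝ) : ℝ≥0∞ :=
  kinetic (u t) (B t) + ∫⁻ τ in Set.Ioo 0 t, (lamSq α (u τ) + lamSq α (B τ))

/-- Leray–Hopf weak solutions of the fractional MHD system
`u_t + Λ^{2α}u + (u·∇)u - (B·∇)B + ∇p = 0`, `B_t + Λ^{2α}B + (u·∇)B - (B·∇)u = 0`,
`div u = div B = 0` on `(0,T)` with initial data `u₀, B₀`.
Here `((v·∇)ψ)(x) = Dψ(x) v(x)`. -/
structure IsLerayHopf (α : ℝ) (T : EReal) (u₀ B₀ : L2) (u B : ℝ → L2) : Prop where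
  class_u : InEnergyClass α T u
  class_B : InEnergyClass α T B
  eq_u : ∀ ψ : ℝ → E3 → E3, IsTestField T ψ →
    ∫ t, (∫ x, (⟪deriv (fun s => ψ s x) t, u t x⟫ + ⟪fderiv ℝ (ψ t) x (u t x), u t x⟫
        - ⟪u t x, LamVec (2 * α) (ψ t) x⟫ - ⟪fderiv ℝ (ψ t) x (B t x), B t x⟫)) ∂(timeMeasure T)
      = - ∫ x, ⟪u₀ x, ψ 0 x⟫
  eq_B : ∀ ψ : ℝ → E3 → E3, IsTestField T ψ →
    ∫ t, (∫ x, (⟪deriv (fun s => ψ s x) t, B t x⟫ + ⟪fderiv ℝ (ψ t) x (u t x), B t x⟫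
        - ⟪B t x, LamVec (2 * α) (ψ t) x⟫ - ⟪fderiv ℝ (ψ t) x (B t x), u t x⟫)) ∂(timeMeasure T)
      = - ∫ x, ⟪B₀ x, ψ 0 x⟫
  energy_le : ∀ t ∈ timeIoo T, totalEnergy α u B t ≤ kinetic u₀ B₀
  initial_u : Tendsto u (𝓝[>] 0) (𝓝 u₀)
  initial_B : Tendsto B (𝓝[>] 0) (𝓝 B₀)

/-- `f ∈ Ẇ^{s,r}(ℝ³)` with `Λ^s f = g ∈ L^r` in the sense of tempered distributions, for
`1 < r < ∞`, `0 ≤ s < 3/r`. The homogeneous space is realized, as usual, as a space of functions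
by means of the Sobolev embedding `Ẇ^{s,r} ⊂ L^{r*}`, `1/r* = 1/r - s/3`; its norm is
`‖f‖ = ‖g‖_{L^r}`. For `s = 0` it is `L^r`. -/
structure IsHomSobolev (s r : ℝ) (f g : E3 → ℝ) : Prop where
  memLp_fun : MemLp f (ENNReal.ofReal (3 * r / (3 - s * r)))
  memLp_lam : MemLp g (ENNReal.ofReal r)
  weak_lam : ∀ φ : 𝓢(E3, ℝ), ∫ x, f x * Lam s φ x = ∫ x, g x * φ x

/-- The norm of `φ` in the multiplier space `𝓜(Ẇ^{s,r} → L^m)`: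
the supremum of `‖φ f‖_{L^m} / ‖f‖_{Ẇ^{s,r}}` over `f ≠ 0`. -/
def multNorm (s r m : ℝ) (φ : E3 → ℝ) : ℝ≥0∞ :=
  ⨆ (f : E3 → ℝ) (g : E3 → ℝ) (_ : IsHomSobolev s r f g) (_ : eLpNorm g (ENNReal.ofReal r) ≠ 0),
    eLpNorm (fun x => φ x * f x) (ENNReal.ofReal m) / eLpNorm g (ENNReal.ofReal r)

/-- The multiplier norm of a matrix field: the square root of the sum of the squares of the
multiplier norms of its entries. -/
def multNormMat (s r m : ℝ) (G : Fin 3 → Fin 3 → E3 → ℝ) : ℝ≥0∞ :=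
  (∑ i, ∑ j, multNorm s r m (G i j) ^ 2) ^ (1 / 2 : ℝ)

/-- `G i j` is the weak partial derivative `∂ᵢ fⱼ`. -/
def IsWeakGrad (f : L2) (G : Fin 3 → Fin 3 → E3 → ℝ) : Prop :=
  ∀ i j, LocallyIntegrable (G i j) ∧
    ∀ φ : E3 → ℝ, ContDiff ℝ ∞ φ → HasCompactSupport φ →
      ∫ x, f x j * fderiv ℝ φ x (EuclideanSpace.single i 1) = - ∫ x, G i j x * φ x

/-- `∇f ∈ L^p(0,T; 𝓜³(Ẇ^{s,r} → L^m))`. -/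
def GradInLpMult (T : EReal) (p : ℝ≥0∞) (s r m : ℝ) (f : ℝ → L2) : Prop :=
  ∃ G : ℝ → Fin 3 → Fin 3 → E3 → ℝ, (∀ᵐ t ∂(timeMeasure T), IsWeakGrad (f t) (G t)) ∧
    MemLp (fun t => multNormMat s r m (G t)) p (timeMeasure T)

/-- `f ∈ L^q(0,T; L^k(ℝ³))`. -/
def InLqLk (T : EReal) (q : ℝ≥0∞) (k : ℝ) (f : ℝ → L2) : Prop :=
  MemLp (fun t => eLpNorm (f t) (ENNReal.ofReal k) volume) q (timeMeasure T)

/-- Weak continuity in `L²` on `[0,T)`. -/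
def WeaklyContinuous (T : EReal) (f : ℝ → L2) : Prop :=
  ∀ h : L2, ContinuousOn (fun t => ⟪h, f t⟫) (timeIco T)

end FractionalMHD

end

set_option linter.unusedSectionVars false

noncomputable section

namespace FractionalMHD

/-! The only obstacle to the energy equality is that the solution is not an admissible test field
for its own equations. With an even mollifier `ρ`, testing with `ρ ⋆ ρ ⋆ u` and `ρ ⋆ ρ ⋆ B` is
legitimate and yields an exact balance for `½‖ρ ⋆ u‖² + ½‖ρ ⋆ B‖²` (`IsLerayHopf.exists_smeared`).
On the Fourier side its dissipative part is the true dissipation weighted by a factor at most one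
that tends to one. What has to be shown is that the nonlinear part disappears in the limit.

Write `η = ρ ⋆ ρ` and `T(c, a, b) = ∫ ⟨(a·∇)c, b⟩`. The nonlinear part is `T(ηu,u,u) - T(ηu,B,B) +
T(ηB,u,B) - T(ηB,B,u)`. Since `u` and `B` are divergence free, the same combination with smeared
last arguments vanishes. Subtracting it leaves last arguments `u - ηu` or `B - ηB`, which are small
(`trilin_eq_residual`).

Each remaining term is a sum of integrals of (smeared derivative of `c`) × (component of `a`) ×
(component `f` of a residual). Hölder with `1/m + 1/k = 1` and the definition of the multiplier norm
bound it by `‖∇c‖_𝓜 ‖a‖_{L^k} ‖f‖_{Ẇ^{s,r}}`. With `σ = 1 + θ < 1` one has `1/r = σ/2 + (1-σ)/k` and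
`s ≤ σ`, so the last norm is controlled by the norms of `f` in `L²` and `L^k` and of `∇f` in `L²`
(`eLpNorm_lamRep_le`, `Exponents.lintegral_mul_smear_le`). The condition `α ≥ 1` makes `∇u` and `∇B`
square integrable. At almost every time the residuals therefore tend to zero, and in time the
product of an `L^q`, an `L^p` and an `L²` factor is an integrable majorant because `1/p + 1/q = 1/2`
(`tendsto_integral_power`).

The interpolation inequality rests on writing `Λ^s`, for `0 < s < 1`, as an integral of differences
`f(x) - f(x + ρy)` against a Lévy measure (`lamConst_mul_Lam`). Hedberg's argument bounds this
integral pointwise by maximal functions of `f` and `∇f`, and the Hardy–Littlewood theorem concludes.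

To have the equality at every time, the smeared solutions are replaced by their continuous
representatives. Their pairings with a fixed vector converge uniformly in time, which defines the
weakly continuous representative of the solution (`exists_weaklyContinuous_repr`). Its averages are
exactly those continuous representatives, so the smeared balance passes to the limit at each `t`. -/

/-- A smooth, compactly supported, even probability density on `ℝ³`. -/
structure IsMollifier (ρ : E3 → ℝ) : Prop where
  smooth : ContDiff ℝ ∞ ρ
  compact : HasCompactSupport ρ
  nonneg : ∀ x, 0 ≤ ρ x
  even : ∀ x, ρ (-x) = ρ x
  integral_eq : ∫ x, ρ x = 1

/-- Convolution of a vector valued function with a scalar kernel. -/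
def smear {F : Type*} [NormedAddCommGroup F] [NormedSpace ℝ F] (ρ : E3 → ℝ) (f : E3 → F) : E3 → F :=
  convolution ρ f (ContinuousLinearMap.lsmul ℝ ℝ) volume

/-- The probability measure with density `ρ`. -/
def kernelMeasure (ρ : E3 → ℝ) : Measure E3 := volume.withDensity fun t => ENNReal.ofReal (ρ t)

/-! ### Mollifiers and averaging -/

section Kernel

variable {F : Type*} [NormedAddCommGroup F] [NormedSpace ℝ F] {ρ : E3 → ℝ}

lemma smear_apply (f : E3 → F) (x : E3) : smear ρ f x = ∫ t, ρ t • f (x - t) := rfl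

lemma IsMollifier.continuous (hρ : IsMollifier ρ) : Continuous ρ := hρ.smooth.continuous

lemma IsMollifier.integrable (hρ : IsMollifier ρ) : Integrable ρ :=
  hρ.continuous.integrable_of_hasCompactSupport hρ.compact

lemma IsMollifier.isProbabilityMeasure (hρ : IsMollifier ρ) :
    IsProbabilityMeasure (kernelMeasure ρ) := by
  constructor
  rw [kernelMeasure, withDensity_apply _ MeasurableSet.univ, Measure.restrict_univ,
    ← ofReal_integral_eq_lintegral_ofReal hρ.integrable (ae_of_all _ hρ.nonneg), hρ.integral_eq,
    ENNReal.ofReal_one]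

instance : SFinite (kernelMeasure ρ) := by unfold kernelMeasure; infer_instance

lemma kernelMeasure_ac : kernelMeasure ρ ≪ volume := withDensity_absolutelyContinuous _ _

lemma IsMollifier.integral_kernelMeasure (hρ : IsMollifier ρ) (f : E3 → F) :
    ∫ t, f t ∂kernelMeasure ρ = ∫ t, ρ t • f t := by
  have hm : Measurable fun t => ENNReal.ofReal (ρ t) := hρ.continuous.measurable.ennreal_ofReal
  rw [kernelMeasure, integral_withDensity_eq_integral_toReal_smul hm
    (ae_of_all _ fun _ => ENNReal.ofReal_lt_top)]
  simp only [ENNReal.toReal_ofReal (hρ.nonneg _)]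

lemma IsMollifier.smear_eq (hρ : IsMollifier ρ) (f : E3 → F) (x : E3) :
    smear ρ f x = ∫ t, f (x - t) ∂kernelMeasure ρ := by
  rw [hρ.integral_kernelMeasure, smear_apply]

lemma IsMollifier.enorm_smear_le (hρ : IsMollifier ρ) (f : E3 → F) (x : E3) :
    ‖smear ρ f x‖ₑ ≤ ∫⁻ t, ‖f (x - t)‖ₑ ∂kernelMeasure ρ := by
  rw [hρ.smear_eq]; exact enorm_integral_le_lintegral_enorm _

/-- Jensen's inequality for averages, integrated in the outer variable. -/
lemma lintegral_average_rpow_le {ν : Measure E3} [IsProbabilityMeasure ν] {p : ℝ} (hp : 1 ≤ p)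
    {H : E3 × E3 → ℝ≥0∞} (hH : AEMeasurable H (volume.prod ν)) {K : E3 → ℝ≥0∞}
    (hK : ∀ᵐ x, K x ≤ ∫⁻ t, H (x, t) ∂ν) :
    ∫⁻ x, K x ^ p ≤ ∫⁻ t, (∫⁻ x, H (x, t) ^ p) ∂ν := by
  rw [← lintegral_lintegral_swap (f := fun x t => H (x, t) ^ p) (hH.pow_const p)]
  refine lintegral_mono_ae ?_
  have h1 : ∀ᵐ x, AEMeasurable (fun t => H (x, t)) ν := by
    filter_upwards [Measure.ae_ae_of_ae_prod hH.ae_eq_mk] with x hx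
    exact ⟨_, hH.measurable_mk.comp measurable_prodMk_left, hx⟩
  filter_upwards [hK, h1] with x hx hm
  refine (ENNReal.rpow_le_rpow hx (by linarith)).trans ?_
  -- The exponent 1 has no finite conjugate and is trivial; for `p > 1` this is Hölder against the
  -- constant 1 on a probability space.
  rcases eq_or_lt_of_le hp with rfl | hp1
  · simp
  · have h := ENNReal.lintegral_mul_le_Lp_mul_Lq ν
      (Real.HolderConjugate.conjExponent hp1) hm (aemeasurable_const (b := (1 : ℝ≥0∞)))
    simp only [Pi.mul_apply, mul_one, ENNReal.one_rpow, lintegral_const, measure_univ] at h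
    calc (∫⁻ t, H (x, t) ∂ν) ^ p ≤ ((∫⁻ t, H (x, t) ^ p ∂ν) ^ (1 / p)) ^ p :=
          ENNReal.rpow_le_rpow h (by linarith)
      _ = _ := by rw [← ENNReal.rpow_mul, one_div_mul_cancel (by linarith), ENNReal.rpow_one]

lemma lintegral_enorm_rpow_le_of_eLpNorm {f : E3 → F} {p : ℝ} (hp : 0 < p) :
    eLpNorm f (ENNReal.ofReal p) ^ p = ∫⁻ x, ‖f x‖ₑ ^ p := by
  rw [eLpNorm_eq_lintegral_rpow_enorm_toReal (by simpa using hp) ENNReal.ofReal_ne_top,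
    ENNReal.toReal_ofReal hp.le, ← ENNReal.rpow_mul, one_div_mul_cancel hp.ne', ENNReal.rpow_one]

/-- Subtraction is quasi-measure-preserving for Lebesgue measure on the product, and the kernel
measure is absolutely continuous. -/
lemma aestronglyMeasurable_sub_prod {f : E3 → F} (hf : AEStronglyMeasurable f) :
    AEStronglyMeasurable (fun z : E3 × E3 => f (z.1 - z.2)) (volume.prod (kernelMeasure ρ)) := by
  have h : AEStronglyMeasurable (fun z : E3 × E3 => f (z.1 - z.2))
      ((volume : Measure E3).prod volume) :=
    hf.comp_quasiMeasurePreserving (quasiMeasurePreserving_sub volume volume)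
  exact h.mono_ac (Measure.AbsolutelyContinuous.rfl.prod kernelMeasure_ac)

/-- Smearing is a contraction of `L^p`, `1 ≤ p < ∞`. -/
lemma IsMollifier.eLpNorm_smear_le (hρ : IsMollifier ρ) {p : ℝ} (hp : 1 ≤ p) {f : E3 → F}
    (hf : AEStronglyMeasurable f) :
    eLpNorm (smear ρ f) (ENNReal.ofReal p) ≤ eLpNorm f (ENNReal.ofReal p) := by
  have hp0 : 0 < p := by linarith
  have := hρ.isProbabilityMeasure
  rw [← ENNReal.rpow_le_rpow_iff hp0, lintegral_enorm_rpow_le_of_eLpNorm hp0,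
    lintegral_enorm_rpow_le_of_eLpNorm hp0]
  refine (lintegral_average_rpow_le hp (ν := kernelMeasure ρ)
    (H := fun z => ‖f (z.1 - z.2)‖ₑ) (aestronglyMeasurable_sub_prod hf).enorm
    (ae_of_all _ fun x => hρ.enorm_smear_le f x)).trans ?_
  simp only [lintegral_sub_right_eq_self (fun x => ‖f x‖ₑ ^ p), lintegral_const, measure_univ,
    mul_one, le_refl]

variable [CompleteSpace F]

lemma IsMollifier.integrable_shift (hρ : IsMollifier ρ) {f : E3 → F} (hf : LocallyIntegrable f)
    (x : E3) : Integrable (fun t => ρ t • f (x - t)) :=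
  hρ.compact.convolutionExists_left (ContinuousLinearMap.lsmul ℝ ℝ) hρ.continuous hf x

lemma IsMollifier.integrable_shift' (hρ : IsMollifier ρ) {f : E3 → F} (hf : LocallyIntegrable f)
    (x : E3) : Integrable (fun t => f (x - t)) (kernelMeasure ρ) := by
  have hm : Measurable fun t => ENNReal.ofReal (ρ t) := hρ.continuous.measurable.ennreal_ofReal
  rw [kernelMeasure, integrable_withDensity_iff_integrable_smul' hm
    (ae_of_all _ fun _ => ENNReal.ofReal_lt_top)]
  simpa only [ENNReal.toReal_ofReal (hρ.nonneg _)] using hρ.integrable_shift hf x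

lemma IsMollifier.contDiff_smear (hρ : IsMollifier ρ) {f : E3 → F} (hf : LocallyIntegrable f) :
    ContDiff ℝ ∞ (smear ρ f) :=
  hρ.compact.contDiff_convolution_left (n := (⊤ : ℕ∞)) _ hρ.smooth hf

lemma IsMollifier.smear_add (hρ : IsMollifier ρ) {f g : E3 → F} (hf : LocallyIntegrable f)
    (hg : LocallyIntegrable g) : smear ρ (f + g) = smear ρ f + smear ρ g := by
  ext1 x
  simp only [smear_apply, Pi.add_apply, smul_add]
  exact integral_add (hρ.integrable_shift hf x) (hρ.integrable_shift hg x)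

lemma smear_smul (c : ℝ) (f : E3 → F) : smear ρ (c • f) = c • smear ρ f := by
  ext1 x
  simp only [smear_apply, Pi.smul_apply]
  rw [← integral_smul]; congr 1; ext1 t; rw [smul_comm]

lemma smear_congr_ae {f g : E3 → F} (h : f =ᵐ[volume] g) : smear ρ f = smear ρ g := by
  ext1 x
  simp only [smear_apply]
  refine integral_congr_ae ?_
  have := (quasiMeasurePreserving_sub_left_of_right_invariant volume x).ae h
  filter_upwards [this] with t ht
  rw [ht]

lemma IsMollifier.smear_sub_self_le (hρ : IsMollifier ρ) {f : E3 → F} (hf : LocallyIntegrable f)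
    (x : E3) : ‖smear ρ f x - f x‖ₑ ≤ ∫⁻ t, ‖f (x - t) - f x‖ₑ ∂kernelMeasure ρ := by
  have := hρ.isProbabilityMeasure
  have h : smear ρ f x - f x = ∫ t, (f (x - t) - f x) ∂kernelMeasure ρ := by
    rw [integral_sub (hρ.integrable_shift' hf x) (integrable_const _), hρ.smear_eq]; simp
  rw [h]; exact enorm_integral_le_lintegral_enorm _

end Kernel

/-! ### Translations and approximate identities in `L^p` -/

section Approx

variable {F : Type*} [NormedAddCommGroup F] [NormedSpace ℝ F] {ρ : E3 → ℝ}

/-- Continuity of translations in `L^p`, `1 ≤ p < ∞`. -/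
lemma tendsto_eLpNorm_translate_sub {p : ℝ≥0∞} (hp : 1 ≤ p) (hp' : p ≠ ⊤) {f : E3 → F}
    (hf : MemLp f p) : Tendsto (fun t : E3 => eLpNorm (fun x => f (x - t) - f x) p volume) (𝓝 0)
      (𝓝 0) := by
  have : Fact (1 ≤ p) := ⟨hp⟩
  let g : E3 → C(E3, E3) := fun t => ⟨fun x => x - t, by fun_prop⟩
  have hg : Continuous g := by
    refine ContinuousMap.continuous_of_continuous_uncurry _ ?_
    simp only [g, Function.uncurry_def]
    exact continuous_snd.sub continuous_fst
  have hm : ∀ t, MeasurePreserving (g t) := fun t => measurePreserving_sub_right volume t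
  have hc := Continuous.compMeasurePreservingLp (continuous_const (y := hf.toLp f)) hg hm hp'
  have h0 := (hc.tendsto 0)
  have h1 := (tendsto_iff_edist_tendsto_0.1 h0)
  refine h1.congr fun t => ?_
  rw [Lp.edist_def]
  refine eLpNorm_congr_ae ?_
  have e1 := Lp.coeFn_compMeasurePreserving (hf.toLp f) (hm t)
  have e2 := Lp.coeFn_compMeasurePreserving (hf.toLp f) (hm 0)
  have e3 := hf.coeFn_toLp
  have e4 := (hm t).quasiMeasurePreserving.ae e3
  have e5 := (hm 0).quasiMeasurePreserving.ae e3
  filter_upwards [e1, e2, e4, e5] with x h1 h2 h4 h5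
  simp only [Pi.sub_apply, h1, h2, Function.comp, h4, h5]
  simp [g]

variable [CompleteSpace F]

/-- Approximation of the identity in `L^p`, `1 ≤ p < ∞`. -/
lemma tendsto_eLpNorm_smear_sub {p : ℝ} (hp : 1 ≤ p) {f : E3 → F}
    (hf : MemLp f (ENNReal.ofReal p)) {ρ : ℕ → E3 → ℝ} (hρ : ∀ n, IsMollifier (ρ n))
    (hs : Tendsto (fun n => Function.support (ρ n)) atTop (𝓝 0).smallSets) :
    Tendsto (fun n => eLpNorm (smear (ρ n) f - f) (ENNReal.ofReal p)) atTop (𝓝 0) := by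
  have hp0 : 0 < p := by linarith
  have hp1 : 1 ≤ ENNReal.ofReal p := by simpa using hp
  have hloc : LocallyIntegrable f := hf.locallyIntegrable hp1
  have ht := tendsto_eLpNorm_translate_sub hp1 ENNReal.ofReal_ne_top hf
  rw [ENNReal.tendsto_nhds_zero] at ht ⊢
  intro ε hε
  have h2 := tendsto_smallSets_iff.1 hs _ (ht ε hε)
  filter_upwards [h2] with n hn
  have := (hρ n).isProbabilityMeasure
  rw [← ENNReal.rpow_le_rpow_iff hp0, lintegral_enorm_rpow_le_of_eLpNorm hp0]
  have hm : AEMeasurable (fun z : E3 × E3 => ‖f (z.1 - z.2) - f z.1‖ₑ)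
      (volume.prod (kernelMeasure (ρ n))) :=
    ((aestronglyMeasurable_sub_prod hf.1).sub hf.1.comp_fst).enorm
  refine (lintegral_average_rpow_le hp (ν := kernelMeasure (ρ n)) hm
    (ae_of_all _ fun x => (hρ n).smear_sub_self_le hloc x)).trans ?_
  -- The kernel measure charges only the support of the kernel, where translates are already
  -- `ε`-close in `L^p`.
  have key : ∀ᵐ t ∂(kernelMeasure (ρ n)), ∫⁻ x, ‖f (x - t) - f x‖ₑ ^ p ≤ ε ^ p := by
    rw [kernelMeasure, ae_withDensity_iff' (by
      exact ((hρ n).continuous.measurable.ennreal_ofReal).aemeasurable)]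
    refine ae_of_all _ fun t h => ?_
    have ht : t ∈ Function.support (ρ n) := by
      intro h0; simp [h0] at h
    have hle : eLpNorm (fun x => f (x - t) - f x) (ENNReal.ofReal p) volume ≤ ε := hn ht
    rw [← lintegral_enorm_rpow_le_of_eLpNorm hp0]
    exact ENNReal.rpow_le_rpow hle hp0.le
  calc ∫⁻ t, (∫⁻ x, ‖f (x - t) - f x‖ₑ ^ p) ∂(kernelMeasure (ρ n))
      ≤ ∫⁻ t, ε ^ p ∂(kernelMeasure (ρ n)) := lintegral_mono_ae key
    _ = ε ^ p := by simp

end Approx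

/-! ### Concrete mollifiers and their self-convolutions -/

section Kernel

variable {F : Type*} [NormedAddCommGroup F] [NormedSpace ℝ F] {ρ : E3 → ℝ}

/-- A sequence of mollifiers shrinking to the origin. -/
def bumpAt (n : ℕ) : ContDiffBump (0 : E3) where
  rIn := 1 / (n + 1)
  rOut := 2 / (n + 1)
  rIn_pos := by positivity
  rIn_lt_rOut := by gcongr; norm_num

lemma tendsto_bumpAt_rOut : Tendsto (fun n => (bumpAt n).rOut) atTop (𝓝 0) := by
  have h := (tendsto_one_div_add_atTop_nhds_zero_nat (𝕜 := ℝ)).const_mul 2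
  rw [mul_zero] at h
  refine h.congr fun n => ?_
  simp only [bumpAt]; ring

/-- The standard mollifiers. -/
def mol (n : ℕ) : E3 → ℝ := (bumpAt n).normed volume

lemma isMollifier_mol (n : ℕ) : IsMollifier (mol n) where
  smooth := (bumpAt n).contDiff_normed
  compact := (bumpAt n).hasCompactSupport_normed
  nonneg := (bumpAt n).nonneg_normed
  even := (bumpAt n).normed_neg
  integral_eq := (bumpAt n).integral_normed

lemma tendsto_support_mol :
    Tendsto (fun n => Function.support (mol n)) atTop (𝓝 0).smallSets :=
  ContDiffBump.tendsto_support_normed_smallSets tendsto_bumpAt_rOut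

/-- Lebesgue differentiation: the fixed ratio 2 between outer and inner radius keeps the kernels
comparable to averages over balls. -/
lemma ae_tendsto_smear_mol [CompleteSpace F] {f : E3 → F} (hf : LocallyIntegrable f) :
    ∀ᵐ x, Tendsto (fun n => smear (mol n) f x) atTop (𝓝 (f x)) :=
  ContDiffBump.ae_convolution_tendsto_right_of_locallyIntegrable (K := 2) tendsto_bumpAt_rOut
    (Eventually.of_forall fun n => by simp only [bumpAt]; rw [mul_one_div]) hf

lemma locallyIntegrable_norm {f : E3 → F} (hf : LocallyIntegrable f) :
    LocallyIntegrable (fun x => ‖f x‖) := fun x => by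
  obtain ⟨s, hs, h⟩ := hf x
  exact ⟨s, hs, h.norm⟩

/-- The double average is the average with respect to the autocorrelation of the kernel. -/
lemma IsMollifier.smear_smear {κ : E3 → ℝ} [CompleteSpace F] (hρ : IsMollifier ρ)
    (hκ : IsMollifier κ) {f : E3 → F}
    (hf : LocallyIntegrable f) : smear (smear ρ κ) f = smear ρ (smear κ f) := by
  ext1 x
  refine convolution_assoc (ContinuousLinearMap.lsmul ℝ ℝ) (ContinuousLinearMap.lsmul ℝ ℝ)
    (ContinuousLinearMap.lsmul ℝ ℝ) (ContinuousLinearMap.lsmul ℝ ℝ) ?_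
    hρ.continuous.aestronglyMeasurable hκ.continuous.aestronglyMeasurable hf.aestronglyMeasurable
    ?_ ?_ ?_
  · intro a b c; simp only [ContinuousLinearMap.lsmul_apply, smul_eq_mul, mul_smul]
  · exact ae_of_all _ fun y => hρ.integrable_shift hκ.continuous.locallyIntegrable y
  · refine ae_of_all _ fun y => ?_
    exact (hκ.compact.norm).convolutionExists_left _ hκ.continuous.norm
      (locallyIntegrable_norm hf) y
  · refine (hρ.compact.norm).convolutionExists_left _ hρ.continuous.norm ?_ x
    refine Continuous.locallyIntegrable ?_
    exact (hκ.compact.norm).continuous_convolution_left _ hκ.continuous.norm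
      (locallyIntegrable_norm hf)

lemma IsMollifier.comp (hρ : IsMollifier ρ) {κ : E3 → ℝ} (hκ : IsMollifier κ) :
    IsMollifier (smear ρ κ) where
  smooth := hρ.contDiff_smear hκ.continuous.locallyIntegrable
  compact := hρ.compact.convolution _ hκ.compact
  nonneg x := integral_nonneg fun t => mul_nonneg (hρ.nonneg _) (hκ.nonneg _)
  even x := by
    rw [smear_apply, ← integral_neg_eq_self, smear_apply]
    congr 1; ext1 t
    rw [hρ.even, ← hκ.even]; congr 2; abel
  integral_eq := by
    have := integral_convolution (ContinuousLinearMap.lsmul ℝ ℝ) (μ := volume) (ν := volume)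
      hρ.integrable hκ.integrable
    rw [hρ.integral_eq, hκ.integral_eq] at this
    exact this.trans (by simp)

/-- The kernel of two successive averages. -/
def mol2 (n : ℕ) : E3 → ℝ := smear (mol n) (mol n)

lemma isMollifier_mol2 (n : ℕ) : IsMollifier (mol2 n) := (isMollifier_mol n).comp (isMollifier_mol n)

lemma tendsto_support_mol2 :
    Tendsto (fun n => Function.support (mol2 n)) atTop (𝓝 0).smallSets := by
  have h1 := tendsto_support_mol
  rw [Metric.nhds_basis_ball.smallSets.tendsto_right_iff] at h1 ⊢
  intro ε hε
  filter_upwards [h1 (ε / 2) (by positivity)] with n hn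
  refine (support_convolution_subset _).trans ?_
  simp only [Set.mem_powerset_iff] at hn
  rintro _ ⟨a, ha, b, hb, rfl⟩
  have ha := hn ha
  have hb := hn hb
  simp only [mem_ball_zero_iff] at *
  calc ‖a + b‖ ≤ ‖a‖ + ‖b‖ := norm_add_le _ _
    _ < ε := by linarith

end Kernel

/-! ### Pointwise bounds and derivatives of averages -/

section Bounds

variable {F : Type*} [NormedAddCommGroup F] [NormedSpace ℝ F] {ρ : E3 → ℝ}

/-- Convolution of two square integrable functions is bounded. -/
lemma norm_smear_le {κ : E3 → ℝ} (hκ : MemLp κ 2) {f : E3 → F} (hf : MemLp f 2) (x : E3) :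
    ‖smear κ f x‖ ≤ (eLpNorm κ 2 volume).toReal * (eLpNorm f 2 volume).toReal := by
  rw [← ENNReal.toReal_mul, ← toReal_enorm]
  refine ENNReal.toReal_mono (ENNReal.mul_ne_top hκ.2.ne hf.2.ne) ?_
  have hm : AEMeasurable (fun t => ‖f (x - t)‖ₑ) :=
    (hf.1.comp_quasiMeasurePreserving
      (quasiMeasurePreserving_sub_left_of_right_invariant volume x)).enorm
  calc ‖smear κ f x‖ₑ ≤ ∫⁻ t, ‖κ t • f (x - t)‖ₑ := enorm_integral_le_lintegral_enorm _
    _ = ∫⁻ t, ((fun t => ‖κ t‖ₑ) * fun t => ‖f (x - t)‖ₑ) t := by simp [enorm_smul]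
    _ ≤ _ := ENNReal.lintegral_mul_le_Lp_mul_Lq volume Real.HolderConjugate.two_two
        hκ.1.enorm hm
    _ = _ := by
      rw [eLpNorm_eq_lintegral_rpow_enorm_toReal two_ne_zero ENNReal.ofNat_ne_top,
        eLpNorm_eq_lintegral_rpow_enorm_toReal two_ne_zero ENNReal.ofNat_ne_top,
        lintegral_sub_left_eq_self (fun t => ‖f t‖ₑ ^ (2 : ℝ))]
      simp

lemma IsMollifier.memLp (hρ : IsMollifier ρ) (p : ℝ≥0∞) : MemLp ρ p :=
  hρ.continuous.memLp_of_hasCompactSupport hρ.compact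

lemma IsMollifier.memLp_fderiv (hρ : IsMollifier ρ) (p : ℝ≥0∞) (v : E3) :
    MemLp (fun x => fderiv ℝ ρ x v) p := by
  refine Continuous.memLp_of_hasCompactSupport ?_ ?_
  · exact (hρ.smooth.continuous_fderiv (by simp)).clm_apply continuous_const
  · exact (hρ.compact.fderiv (𝕜 := ℝ)).mono' (subset_tsupport _ |>.trans' (by
      intro x hx h0; apply hx; simp [h0]))

variable [CompleteSpace F]

/-- The derivative falls on the kernel, so no regularity of `f` is needed. -/
lemma IsMollifier.fderiv_smear_apply (hρ : IsMollifier ρ) {f : E3 → F} (hf : LocallyIntegrable f)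
    (x v : E3) : fderiv ℝ (smear ρ f) x v = smear (fun t => fderiv ℝ ρ t v) f x := by
  have h := hρ.compact.hasFDerivAt_convolution_left (ContinuousLinearMap.lsmul ℝ ℝ : ℝ →L[ℝ] F →L[ℝ] F)
    (hρ.smooth.of_le (by simp)) hf x
  have h2 := h.fderiv
  change fderiv ℝ (smear ρ f) x = _ at h2
  rw [h2]
  have hint := (hρ.compact.fderiv (𝕜 := ℝ)).convolutionExists_left
    ((ContinuousLinearMap.lsmul ℝ ℝ : ℝ →L[ℝ] F →L[ℝ] F).precompL E3)
    (hρ.smooth.continuous_fderiv (by simp)) hf x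
  rw [convolution_def, ContinuousLinearMap.integral_apply hint]
  rfl

/-- Bound on the derivative of a smeared `L²` function. -/
lemma IsMollifier.norm_fderiv_smear_le (hρ : IsMollifier ρ) :
    ∃ C : ℝ, 0 ≤ C ∧ ∀ (f : E3 → F), MemLp f 2 → ∀ x,
      ‖fderiv ℝ (smear ρ f) x‖ ≤ C * (eLpNorm f 2 volume).toReal := by
  refine ⟨∑ i : Fin 3, (eLpNorm (fun t => fderiv ℝ ρ t (EuclideanSpace.single i 1)) 2
    volume).toReal, Finset.sum_nonneg fun i _ => ENNReal.toReal_nonneg, fun f hf x => ?_⟩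
  refine ContinuousLinearMap.opNorm_le_bound _ (by positivity) fun v => ?_
  have hv : v = ∑ i : Fin 3, v i • (EuclideanSpace.single i 1 : E3) := by
    ext j; simp [Finset.sum_apply, Pi.single_apply]
  conv_lhs => rw [hv]
  rw [map_sum, Finset.sum_mul, Finset.sum_mul]
  refine norm_sum_le_of_le _ fun i _ => ?_
  rw [map_smul, norm_smul, mul_comm]
  refine mul_le_mul ?_ (PiLp.norm_apply_le v i) (norm_nonneg _) (by positivity)
  rw [hρ.fderiv_smear_apply (hf.locallyIntegrable one_le_two)]
  exact norm_smear_le (hρ.memLp_fderiv 2 _) hf x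

lemma IsMollifier.memLp_smear (hρ : IsMollifier ρ) {p : ℝ} (hp : 1 ≤ p) {f : E3 → F}
    (hf : MemLp f (ENNReal.ofReal p)) : MemLp (smear ρ f) (ENNReal.ofReal p) :=
  ⟨(hρ.contDiff_smear (hf.locallyIntegrable (by simpa using hp))).continuous.aestronglyMeasurable,
    (hρ.eLpNorm_smear_le hp hf.1).trans_lt hf.2⟩

lemma IsMollifier.memLp_two_smear (hρ : IsMollifier ρ) {f : E3 → F} (hf : MemLp f 2) :
    MemLp (smear ρ f) 2 := by
  have := hρ.memLp_smear one_le_two (f := f) (by simpa using hf)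
  simpa using this

lemma IsMollifier.hasCompactSupport_smear (hρ : IsMollifier ρ) {f : E3 → F}
    (hf : HasCompactSupport f) : HasCompactSupport (smear ρ f) :=
  hρ.compact.convolution _ hf

/-- Smearing commutes with differentiation. -/
lemma IsMollifier.fderiv_smear_comm (hρ : IsMollifier ρ) {f : E3 → F} (hf : ContDiff ℝ 1 f)
    (hfc : HasCompactSupport f) (x v : E3) :
    fderiv ℝ (smear ρ f) x v =
      smear ρ (fun y => fderiv ℝ f y v) x := by
  have h := (hfc.hasFDerivAt_convolution_right (μ := volume)
    (ContinuousLinearMap.lsmul ℝ ℝ : ℝ →L[ℝ] F →L[ℝ] F)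
    hρ.continuous.locallyIntegrable hf x).fderiv
  change fderiv ℝ (smear ρ f) x = _ at h
  rw [h, convolution_precompR_apply _ hρ.continuous.locallyIntegrable (hfc.fderiv (𝕜 := ℝ))
    (hf.continuous_fderiv (by simp))]
  rfl

end Bounds

/-! ### Self-adjointness of averaging -/

section Adjoint

variable {F : Type*} [NormedAddCommGroup F] [InnerProductSpace ℝ F] [CompleteSpace F]
  {ρ : E3 → ℝ}

/-- Smearing with an even kernel is self-adjoint. -/
lemma IsMollifier.integral_inner_smear (hρ : IsMollifier ρ) {f g : E3 → F} (hf : MemLp f 2)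
    (hg : MemLp g 2) :
    ∫ x, ⟪smear ρ f x, g x⟫ = ∫ x, ⟪f x, smear ρ g x⟫ := by
  have hfl := hf.locallyIntegrable one_le_two
  have hgl := hg.locallyIntegrable one_le_two
  have hf2 : Integrable fun x => ‖f x‖ ^ 2 := hf.integrable_norm_pow two_ne_zero
  have hg2 : Integrable fun x => ‖g x‖ ^ 2 := hg.integrable_norm_pow two_ne_zero
  -- Fubini is justified by `|⟨f(x-t), g(x)⟩| ≤ ‖f(x-t)‖² + ‖g(x)‖²`, each term being integrable
  -- against `ρ(t)`.
  have hint : Integrable (fun z : E3 × E3 => ρ z.2 * ⟪f (z.1 - z.2), g z.1⟫)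
      (volume.prod volume) := by
    have h1 := (hρ.integrable.convolution_integrand (ContinuousLinearMap.mul ℝ ℝ) hf2)
    have h2 := (hg2.mul_prod hρ.integrable)
    refine (h1.add h2).mono' ?_ (ae_of_all _ fun z => ?_)
    · refine (hρ.continuous.comp continuous_snd).aestronglyMeasurable.mul ?_
      exact (hf.1.comp_quasiMeasurePreserving
        (quasiMeasurePreserving_sub volume volume)).inner hg.1.comp_fst
    · simp only [Pi.add_apply, ContinuousLinearMap.mul_apply', norm_mul, Real.norm_eq_abs]
      rw [abs_of_nonneg (hρ.nonneg z.2), mul_comm (‖g z.1‖ ^ 2), ← mul_add]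
      refine mul_le_mul_of_nonneg_left ?_ (hρ.nonneg _)
      refine (abs_real_inner_le_norm _ _).trans ?_
      nlinarith [sq_nonneg (‖f (z.1 - z.2)‖ - ‖g z.1‖), sq_nonneg (‖f (z.1 - z.2)‖ + ‖g z.1‖)]
  calc ∫ x, ⟪smear ρ f x, g x⟫
      = ∫ x, ∫ t, ρ t * ⟪f (x - t), g x⟫ := by
        congr 1; ext1 x
        rw [smear_apply, real_inner_comm, ← integral_inner (hρ.integrable_shift hfl x)]
        congr 1; ext1 t
        rw [inner_smul_right, real_inner_comm]
    _ = ∫ t, ∫ x, ρ t * ⟪f (x - t), g x⟫ := integral_integral_swap hint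
    _ = ∫ t, ∫ x, ρ t * ⟪f x, g (x - t)⟫ := by
        -- Reflect `t`, which leaves the even kernel unchanged, and then translate `x` by `t`.
        rw [← integral_neg_eq_self]
        congr 1; ext1 t
        rw [← integral_sub_right_eq_self _ t]
        simp [hρ.even]
    _ = ∫ x, ∫ t, ρ t * ⟪f x, g (x - t)⟫ := by
        refine (integral_integral_swap ?_).symm
        have h1 := (hρ.integrable.convolution_integrand (ContinuousLinearMap.mul ℝ ℝ) hg2)
        have h2 := (hf2.mul_prod hρ.integrable)
        refine (h1.add h2).mono' ?_ (ae_of_all _ fun z => ?_)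
        · refine (hρ.continuous.comp continuous_snd).aestronglyMeasurable.mul ?_
          exact hf.1.comp_fst.inner (hg.1.comp_quasiMeasurePreserving
            (quasiMeasurePreserving_sub volume volume))
        · simp only [Pi.add_apply, ContinuousLinearMap.mul_apply', norm_mul, Real.norm_eq_abs,
            Function.uncurry]
          rw [abs_of_nonneg (hρ.nonneg z.2), mul_comm (‖f z.1‖ ^ 2), ← mul_add]
          refine mul_le_mul_of_nonneg_left ?_ (hρ.nonneg _)
          refine (abs_real_inner_le_norm _ _).trans ?_
          nlinarith [sq_nonneg (‖g (z.1 - z.2)‖ - ‖f z.1‖), sq_nonneg (‖g (z.1 - z.2)‖ + ‖f z.1‖)]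
    _ = _ := by
        congr 1; ext1 x
        rw [smear_apply, ← integral_inner (hρ.integrable_shift hgl x)]
        congr 1; ext1 t
        rw [inner_smul_right]

end Adjoint

/-! ### Weak derivatives -/

section WeakDeriv

variable {ρ : E3 → ℝ}

/-- `g` is the weak derivative of `f` in the direction `v`. -/
structure HasWeakDeriv (v : E3) (f g : E3 → ℝ) : Prop where
  locallyIntegrable : LocallyIntegrable f
  locallyIntegrable_deriv : LocallyIntegrable g
  integral_eq : ∀ φ : E3 → ℝ, ContDiff ℝ ∞ φ → HasCompactSupport φ →
    ∫ x, f x * fderiv ℝ φ x v = - ∫ x, g x * φ x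

/-- The derivative of a smeared function is the smeared weak derivative. -/
lemma HasWeakDeriv.fderiv_smear {v : E3} {f g : E3 → ℝ} (h : HasWeakDeriv v f g)
    (hρ : IsMollifier ρ) (x : E3) : fderiv ℝ (smear ρ f) x v = smear ρ g x := by
  rw [hρ.fderiv_smear_apply h.locallyIntegrable]
  have e : ∀ (κ : E3 → ℝ) (k : E3 → ℝ), smear κ k x = ∫ t, k t * κ (x - t) := fun κ k => by
    rw [smear_apply, ← integral_sub_left_eq_self _ volume x]
    congr 1; ext1 t; simp [mul_comm]
  rw [e, e]
  -- The test function is the reflected kernel `y ↦ ρ(x - y)`; the sign from its chain rule cancels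
  -- the sign in the definition of the weak derivative.
  have hφ : ContDiff ℝ ∞ fun y => ρ (x - y) := hρ.smooth.comp (contDiff_const.sub contDiff_id)
  have hc : HasCompactSupport fun y => ρ (x - y) :=
    hρ.compact.comp_homeomorph (Homeomorph.subLeft x)
  have key := h.integral_eq _ hφ hc
  rw [eq_neg_iff_add_eq_zero, add_comm, ← eq_neg_iff_add_eq_zero] at key
  rw [key, ← integral_neg]
  congr 1; ext1 t
  have hd : HasFDerivAt (fun y => ρ (x - y))
      ((fderiv ℝ ρ (x - t)).comp (-(ContinuousLinearMap.id ℝ E3))) t := by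
    have h1 := ((hρ.smooth.differentiable (by simp)) (x - t)).hasFDerivAt
    have h2 : HasFDerivAt (fun y : E3 => x - y) (-(ContinuousLinearMap.id ℝ E3)) t := by
      simpa using (hasFDerivAt_id t).const_sub x
    exact h1.comp t h2
  rw [hd.fderiv]
  simp

end WeakDeriv

/-! ### The Hardy–Littlewood maximal theorem -/

open Metric

/-- The centred Hardy–Littlewood maximal function. -/
def hlMax (f : E3 → ℝ≥0∞) (x : E3) : ℝ≥0∞ :=
  ⨆ r : {r : ℝ // 0 < r}, (∫⁻ y in ball x r, f y) / volume (ball x (r : ℝ))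

lemma volume_ball_ne {x : E3} {r : ℝ} (hr : 0 < r) :
    volume (ball x r) ≠ 0 ∧ volume (ball x r) ≠ ⊤ :=
  ⟨(measure_ball_pos volume x hr).ne', measure_ball_lt_top.ne⟩

lemma lt_hlMax_iff {f : E3 → ℝ≥0∞} {x : E3} {l : ℝ≥0∞} :
    l < hlMax f x ↔ ∃ r : ℝ, 0 < r ∧ l * volume (ball x r) < ∫⁻ y in ball x r, f y := by
  rw [hlMax, lt_iSup_iff]
  constructor
  · rintro ⟨⟨r, hr⟩, h⟩
    exact ⟨r, hr, (ENNReal.lt_div_iff_mul_lt (Or.inl (volume_ball_ne hr).1)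
      (Or.inl (volume_ball_ne hr).2)).1 h⟩
  · rintro ⟨r, hr, h⟩
    exact ⟨⟨r, hr⟩, (ENNReal.lt_div_iff_mul_lt (Or.inl (volume_ball_ne hr).1)
      (Or.inl (volume_ball_ne hr).2)).2 h⟩

lemma setLIntegral_ball_le_hlMax (f : E3 → ℝ≥0∞) (x : E3) {r : ℝ} (hr : 0 < r) :
    ∫⁻ y in ball x r, f y ≤ volume (ball x r) * hlMax f x := by
  rw [mul_comm]
  refine (ENNReal.div_le_iff (volume_ball_ne hr).1 (volume_ball_ne hr).2).1 ?_
  exact le_iSup (fun r : {r : ℝ // 0 < r} =>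
    (∫⁻ y in ball x r, f y) / volume (ball x (r : ℝ))) ⟨r, hr⟩

/-- Lower semicontinuity: by continuity from below of the measure `f dx`, the strict inequality on
`B(x, r)` survives on `B(x, r - δ)`, which is contained in `B(y, r)` for `y` within `δ` of `x`.
Balls of equal radius have equal volume. No measurability of `f` is required. -/
lemma isOpen_lt_hlMax (f : E3 → ℝ≥0∞) (l : ℝ≥0∞) : IsOpen {x | l < hlMax f x} := by
  rw [Metric.isOpen_iff]
  intro x hx
  obtain ⟨r, hr, h⟩ := lt_hlMax_iff.1 hx
  set ν : Measure E3 := volume.withDensity f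
  have hν : ∀ y s, ∫⁻ z in ball y s, f z = ν (ball y s) := fun y s =>
    (withDensity_apply _ measurableSet_ball).symm
  rw [hν] at h
  have hu : ball x r = ⋃ n : ℕ, ball x (r - 1 / (n + 1)) := by
    ext y
    simp only [Set.mem_iUnion, mem_ball]
    constructor
    · intro hy
      obtain ⟨n, hn⟩ := exists_nat_one_div_lt (sub_pos.2 hy)
      exact ⟨n, by linarith⟩
    · rintro ⟨n, hn⟩
      have : (0 : ℝ) < 1 / (n + 1) := by positivity
      linarith
  have hmono : Monotone fun n : ℕ => ball x (r - 1 / ((n : ℝ) + 1)) := fun a b hab =>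
    ball_subset_ball (by gcongr)
  have ht := tendsto_measure_iUnion_atTop (μ := ν) hmono
  rw [← hu] at ht
  obtain ⟨n, hn⟩ := (ht.eventually (lt_mem_nhds h)).exists
  refine ⟨1 / (n + 1), by positivity, fun y hy => ?_⟩
  simp only [Set.mem_ofPred_eq]
  refine lt_hlMax_iff.2 ⟨r, hr, ?_⟩
  rw [Measure.addHaar_ball_center] at hn ⊢
  rw [hν]
  refine hn.trans_le (measure_mono (ball_subset_ball' ?_))
  rw [dist_comm]
  simp only [mem_ball] at hy
  linarith

lemma measurable_hlMax (f : E3 → ℝ≥0∞) : Measurable (hlMax f) :=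
  measurable_of_Ioi fun l => (isOpen_lt_hlMax f l).measurableSet

/-- The weak type (1,1) inequality. -/
lemma volume_lt_hlMax_le (f : E3 → ℝ≥0∞) {l : ℝ≥0∞} (hl : l ≠ 0) (hl' : l ≠ ⊤) :
    l * volume {x | l < hlMax f x} ≤ 125 * ∫⁻ x, f x := by
  rcases eq_or_ne (∫⁻ x, f x) ⊤ with hI | hI
  · rw [hI, ENNReal.mul_top (by norm_num)]; exact le_top
  set S := {x | l < hlMax f x}
  have hS : ∀ x : S, ∃ r : ℝ, 0 < r ∧ l * volume (ball (x : E3) r) < ∫⁻ y in ball (x : E3) r, f y :=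
    fun x => lt_hlMax_iff.1 x.2
  choose r hr hlt using hS
  set c := volume (ball (0 : E3) 1)
  have hc := volume_ball_ne (x := (0 : E3)) one_pos
  have hvol : ∀ (x : E3) (s : ℝ), 0 < s → volume (ball x s) = ENNReal.ofReal (s ^ 3) * c := by
    intro x s hs
    rw [Measure.addHaar_ball _ _ hs.le, finrank_euclideanSpace_fin]
  set K := (∫⁻ x, f x) / (l * c)
  have hK : K ≠ ⊤ := ENNReal.div_ne_top hI (mul_ne_zero hl hc.1)
  -- Vitali's covering lemma needs bounded radii. The defining inequality gives `r³ ≤ K`, hence `r ≤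
  -- K + 1`.
  have hbound : ∀ x ∈ (Set.univ : Set S), r x ≤ K.toReal + 1 := by
    intro x _
    have h1 : ENNReal.ofReal (r x ^ 3) ≤ K := by
      rw [ENNReal.le_div_iff_mul_le (Or.inl (mul_ne_zero hl hc.1))
        (Or.inl (ENNReal.mul_ne_top hl' hc.2))]
      calc ENNReal.ofReal (r x ^ 3) * (l * c) = l * volume (ball (x : E3) (r x)) := by
            rw [hvol _ _ (hr x)]; ring
        _ ≤ _ := (hlt x).le.trans (setLIntegral_le_lintegral _ _)
    have h2 : r x ^ 3 ≤ K.toReal := (ENNReal.ofReal_le_iff_le_toReal hK).1 h1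
    have h3 := ENNReal.toReal_nonneg (a := K)
    by_contra hlt
    push Not at hlt
    have : r x ≤ r x ^ 3 := le_self_pow₀ (by linarith) (by norm_num)
    linarith
  -- Any enlargement factor above 3 would do; the factor 5 costs `5³ = 125` in volume.
  obtain ⟨u, -, hdisj, hcov⟩ := Vitali.exists_disjoint_subfamily_covering_enlargement_ball
    (Set.univ : Set S) (fun x => (x : E3)) r _ hbound 5 (by norm_num)
  have hcount : u.Countable := hdisj.countable_of_isOpen (fun x _ => isOpen_ball)
    (fun x _ => ⟨x, mem_ball_self (hr x)⟩)
  have hsub : S ⊆ ⋃ b ∈ u, ball (b : E3) (5 * r b) := by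
    intro x hx
    obtain ⟨b, hb, hxb⟩ := hcov ⟨x, hx⟩ (Set.mem_univ _)
    exact Set.mem_biUnion hb (hxb (mem_ball_self (hr _)))
  have : Countable u := hcount
  calc l * volume S ≤ l * ∑' b : u, volume (ball (b : E3) (5 * r b)) := by
        gcongr
        exact (measure_mono hsub).trans (measure_biUnion_le _ hcount _)
    _ = ∑' b : u, 125 * (l * volume (ball (b : E3) (r b))) := by
        rw [← ENNReal.tsum_mul_left]
        refine tsum_congr fun b => ?_
        rw [hvol _ _ (by linarith [hr b]), hvol _ _ (hr b), mul_pow,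
          ENNReal.ofReal_mul (by norm_num)]
        rw [show ENNReal.ofReal (5 ^ 3) = 125 by
          rw [show (5 : ℝ) ^ 3 = (125 : ℕ) by norm_num, ENNReal.ofReal_natCast]; norm_num]
        ring
    _ = 125 * ∑' b : u, (l * volume (ball (b : E3) (r b))) := ENNReal.tsum_mul_left
    _ ≤ 125 * ∑' b : u, ∫⁻ y in ball (b : E3) (r b), f y := by
        gcongr with b
        exact (hlt b).le
    _ = 125 * ∫⁻ y in ⋃ b ∈ u, ball (b : E3) (r b), f y := by
        rw [lintegral_biUnion hcount (fun b _ => measurableSet_ball) hdisj]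
    _ ≤ 125 * ∫⁻ x, f x := mul_le_mul' le_rfl (setLIntegral_le_lintegral _ _)

/-- The layer cake formula for a single number. -/
lemma rpow_eq_lintegral_layer {p : ℝ} (hp : 0 < p) (a : ℝ≥0∞) :
    a ^ p = ∫⁻ t in Set.Ioi (0 : ℝ),
      {t : ℝ | ENNReal.ofReal t < a}.indicator (fun t => ENNReal.ofReal (p * t ^ (p - 1))) t := by
  have fin : ∀ b : ℝ, 0 ≤ b → ENNReal.ofReal b ^ p = ∫⁻ t in Set.Ioi (0 : ℝ),
      {t : ℝ | ENNReal.ofReal t < ENNReal.ofReal b}.indicator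
        (fun t => ENNReal.ofReal (p * t ^ (p - 1))) t := by
    intro b hb
    have hm : MeasurableSet {t : ℝ | ENNReal.ofReal t < ENNReal.ofReal b} :=
      measurableSet_lt ENNReal.measurable_ofReal measurable_const
    rw [setLIntegral_indicator hm]
    have hset : {t : ℝ | ENNReal.ofReal t < ENNReal.ofReal b} ∩ Set.Ioi 0 = Set.Ioo 0 b := by
      ext t
      simp only [Set.mem_inter_iff, Set.mem_ofPred_eq, Set.mem_Ioi, Set.mem_Ioo]
      constructor
      · rintro ⟨h1, h2⟩
        exact ⟨h2, (ENNReal.ofReal_lt_ofReal_iff_of_nonneg h2.le).1 h1⟩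
      · rintro ⟨h1, h2⟩
        exact ⟨(ENNReal.ofReal_lt_ofReal_iff_of_nonneg h1.le).2 h2, h1⟩
    rw [hset]
    have hi : IntervalIntegrable (fun t : ℝ => p * t ^ (p - 1)) volume 0 b :=
      (intervalIntegral.intervalIntegrable_rpow' (by linarith)).const_mul p
    have hio : IntegrableOn (fun t : ℝ => p * t ^ (p - 1)) (Set.Ioo 0 b) :=
      ((intervalIntegrable_iff_integrableOn_Ioo_of_le hb).1 hi)
    rw [← ofReal_integral_eq_lintegral_ofReal hio]
    · rw [← integral_Ioc_eq_integral_Ioo, ← intervalIntegral.integral_of_le hb,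
        intervalIntegral.integral_const_mul, integral_rpow (Or.inl (by linarith)),
        ENNReal.ofReal_rpow_of_nonneg hb hp.le]
      congr 1
      rw [sub_add_cancel, Real.zero_rpow hp.ne', sub_zero]
      field_simp
    · filter_upwards [ae_restrict_mem measurableSet_Ioo] with t ht
      have := ht.1
      simp only [Pi.zero_apply]; positivity
  rcases eq_or_ne a ⊤ with rfl | ha
  · rw [ENNReal.top_rpow_of_pos hp, eq_comm, eq_top_iff]
    refine ENNReal.le_of_forall_nnreal_lt fun x _ => ?_
    obtain ⟨n, hn⟩ : ∃ n : ℝ, 0 ≤ n ∧ (x : ℝ≥0∞) ≤ ENNReal.ofReal n ^ p := by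
      refine ⟨(x : ℝ) ^ (1 / p), by positivity, ?_⟩
      rw [ENNReal.ofReal_rpow_of_nonneg (by positivity) hp.le, ← Real.rpow_mul (NNReal.coe_nonneg x),
        one_div_mul_cancel hp.ne', Real.rpow_one, ENNReal.ofReal_coe_nnreal]
    refine hn.2.trans ?_
    rw [fin n hn.1]
    refine lintegral_mono fun t => ?_
    refine Set.indicator_le_indicator_of_subset (fun t _ => ?_) (fun _ => zero_le) _
    simp
  · have := fin a.toReal ENNReal.toReal_nonneg
    rwa [ENNReal.ofReal_toReal ha] at this

/-- Truncation for Marcinkiewicz interpolation: values of `f` not exceeding `l` add at most `l` to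
any average. -/
lemma hlMax_le_add (f : E3 → ℝ≥0∞) (hf : Measurable f) (l : ℝ≥0∞) (x : E3) :
    hlMax f x ≤ hlMax ({y | l < f y}.indicator f) x + l := by
  refine iSup_le fun ⟨r, hr⟩ => ?_
  refine ENNReal.div_le_of_le_mul ?_
  have hm : MeasurableSet {y | l < f y} := measurableSet_lt measurable_const hf
  calc ∫⁻ y in ball x r, f y ≤ ∫⁻ y in ball x r, ({y | l < f y}.indicator f y + l) := by
        refine lintegral_mono fun y => ?_
        by_cases h : l < f y
        · rw [Set.indicator_of_mem (by exact h)]; exact le_self_add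
        · exact (not_lt.1 h).trans le_add_self
    _ = (∫⁻ y in ball x r, {y | l < f y}.indicator f y) + l * volume (ball x r) := by
        rw [lintegral_add_left (hf.indicator hm), setLIntegral_const]
    _ ≤ _ := by
        rw [add_mul]
        gcongr
        rw [mul_comm]
        exact setLIntegral_ball_le_hlMax _ _ hr

/-- The Hardy–Littlewood maximal theorem. -/
theorem lintegral_hlMax_rpow_le {p : ℝ} (hp : 1 < p) :
    ∃ C : ℝ≥0∞, C ≠ ⊤ ∧ ∀ f : E3 → ℝ≥0∞, Measurable f →
      ∫⁻ x, hlMax f x ^ p ≤ C * ∫⁻ x, f x ^ p := by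
  -- The weak bound is applied at height `t / 2`, which gives `2 · 125 = 250`. Integrating `p
  -- t^(p-2)` up to `2 f(x)` gives `p / (p - 1)` and `2^(p-1)`.
  refine ⟨ENNReal.ofReal (250 * p / (p - 1)) * 2 ^ (p - 1), ENNReal.mul_ne_top
    ENNReal.ofReal_ne_top (ENNReal.rpow_ne_top_of_nonneg (by linarith) (by norm_num)),
    fun f hf => ?_⟩
  have hp0 : 0 < p := by linarith
  have hp1 : 0 < p - 1 := by linarith
  -- Tonelli on the region below the graph of `g`. It is used for the layer cake formula of the
  -- maximal function and, backwards, to resum the truncated integrals of `f`.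
  have swap : ∀ (g : E3 → ℝ≥0∞) (h : E3 → ℝ≥0∞) (k : ℝ → ℝ≥0∞), Measurable g → Measurable h →
      Measurable k →
      ∫⁻ x, h x * ∫⁻ t in Set.Ioi (0 : ℝ), {t : ℝ | ENNReal.ofReal t < g x}.indicator k t
        = ∫⁻ t in Set.Ioi (0 : ℝ), k t * ∫⁻ x, {x | ENNReal.ofReal t < g x}.indicator h x := by
    intro g h k hg hh hk
    have hms : MeasurableSet {z : E3 × ℝ | ENNReal.ofReal z.2 < g z.1} :=
      measurableSet_lt (ENNReal.measurable_ofReal.comp measurable_snd) (hg.comp measurable_fst)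
    have e1 : ∀ x, h x * ∫⁻ t in Set.Ioi (0 : ℝ), {t : ℝ | ENNReal.ofReal t < g x}.indicator k t =
        ∫⁻ t in Set.Ioi (0 : ℝ),
          {z : E3 × ℝ | ENNReal.ofReal z.2 < g z.1}.indicator (fun z => h z.1 * k z.2) (x, t) := by
      intro x
      rw [← lintegral_const_mul]
      · congr 1; ext1 t
        by_cases ht : ENNReal.ofReal t < g x <;> simp [Set.indicator, ht]
      · exact hk.indicator (measurableSet_lt ENNReal.measurable_ofReal measurable_const)
    simp_rw [e1]
    rw [lintegral_lintegral_swap]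
    · congr 1; ext1 t
      rw [← lintegral_const_mul]
      · congr 1; ext1 x
        by_cases ht : ENNReal.ofReal t < g x <;> simp [Set.indicator, ht, mul_comm]
      · exact hh.indicator (measurableSet_lt measurable_const hg)
    · exact (((hh.comp measurable_fst).mul (hk.comp measurable_snd)).indicator hms).aemeasurable
  have hkm : ∀ q c : ℝ, Measurable fun t : ℝ => ENNReal.ofReal (c * t ^ q) := fun q c => by
    fun_prop
  calc ∫⁻ x, hlMax f x ^ p
      = ∫⁻ x, 1 * ∫⁻ t in Set.Ioi (0 : ℝ), {t : ℝ | ENNReal.ofReal t < hlMax f x}.indicator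
          (fun t => ENNReal.ofReal (p * t ^ (p - 1))) t := by
        congr 1; ext1 x; rw [rpow_eq_lintegral_layer hp0, one_mul]
    _ = ∫⁻ t in Set.Ioi (0 : ℝ), ENNReal.ofReal (p * t ^ (p - 1)) *
          ∫⁻ x, {x | ENNReal.ofReal t < hlMax f x}.indicator (fun _ => 1) x :=
        swap _ _ _ (measurable_hlMax f) measurable_const (hkm _ _)
    _ ≤ ∫⁻ t in Set.Ioi (0 : ℝ), ENNReal.ofReal (250 * p / (p - 1)) *
          (ENNReal.ofReal ((p - 1) * t ^ (p - 1 - 1)) *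
          ∫⁻ x, {x | ENNReal.ofReal t < 2 * f x}.indicator f x) := by
        refine lintegral_mono_ae ?_
        filter_upwards [ae_restrict_mem measurableSet_Ioi] with t ht
        have ht : 0 < t := ht
        have hmeas : MeasurableSet {x | ENNReal.ofReal t < hlMax f x} :=
          measurableSet_lt measurable_const (measurable_hlMax f)
        rw [lintegral_indicator hmeas, setLIntegral_const, one_mul]
        set l := ENNReal.ofReal (t / 2)
        have hl0 : l ≠ 0 := by simp [l, ht]
        have hlt : l ≠ ⊤ := ENNReal.ofReal_ne_top
        have htl : ENNReal.ofReal t = l + l := by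
          rw [← ENNReal.ofReal_add (by positivity) (by positivity)]; congr 1; ring
        have h1 : l * volume {x | ENNReal.ofReal t < hlMax f x} ≤
            125 * ∫⁻ x, {x | ENNReal.ofReal t < 2 * f x}.indicator f x := by
          have hsets : {x | ENNReal.ofReal t < 2 * f x} = {y | l < f y} := by
            ext x
            simp only [Set.mem_ofPred_eq, htl, ← two_mul]
            exact ENNReal.mul_lt_mul_iff_right (by norm_num) (by norm_num)
          rw [hsets]
          refine le_trans ?_ (volume_lt_hlMax_le _ hl0 hlt)
          refine mul_le_mul' le_rfl (measure_mono fun x hx => ?_)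
          simp only [Set.mem_ofPred_eq] at hx ⊢
          rw [htl] at hx
          exact (ENNReal.add_lt_add_iff_right hlt).1 (hx.trans_le (hlMax_le_add f hf l x))
        have e : ENNReal.ofReal (p * t ^ (p - 1)) = ENNReal.ofReal (2 * p * t ^ (p - 1 - 1)) * l := by
          rw [← ENNReal.ofReal_mul (by positivity)]
          congr 1
          rw [Real.rpow_sub_one ht.ne' (p - 1)]
          field_simp
        rw [e, mul_assoc, ← mul_assoc (ENNReal.ofReal (250 * p / (p - 1))),
          ← ENNReal.ofReal_mul (by positivity)]
        refine (mul_le_mul_right h1 _).trans (le_of_eq ?_)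
        rw [← mul_assoc]
        congr 1
        rw [show (125 : ℝ≥0∞) = ENNReal.ofReal 125 by
          rw [show (125 : ℝ) = (125 : ℕ) by norm_num, ENNReal.ofReal_natCast]; norm_num,
          ← ENNReal.ofReal_mul (by positivity)]
        congr 1
        field_simp
        ring
    _ = ENNReal.ofReal (250 * p / (p - 1)) * ∫⁻ x, f x * ∫⁻ t in Set.Ioi (0 : ℝ),
          {t : ℝ | ENNReal.ofReal t < 2 * f x}.indicator
            (fun t => ENNReal.ofReal ((p - 1) * t ^ (p - 1 - 1))) t := by
        rw [lintegral_const_mul' _ _ ENNReal.ofReal_ne_top,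
          swap _ _ _ (hf.const_mul 2) hf (hkm _ _)]
    _ = ENNReal.ofReal (250 * p / (p - 1)) * ∫⁻ x, 2 ^ (p - 1) * f x ^ p := by
        congr 2; ext1 x
        rw [← rpow_eq_lintegral_layer hp1, ENNReal.mul_rpow_of_nonneg _ _ hp1.le, mul_left_comm]
        congr 1
        conv_lhs => rw [← ENNReal.rpow_one (f x), ← ENNReal.rpow_mul,
          ← ENNReal.rpow_add_of_nonneg _ _ (by norm_num) (by linarith)]
        congr 1; ring
    _ = _ := by
        rw [lintegral_const_mul' _ _ (ENNReal.rpow_ne_top_of_nonneg hp1.le (by norm_num)), mul_assoc]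

/-! ### The Lévy measure and its interpolation inequality -/

open Metric Set

/-- The measure `ρ^{-1-s} dρ` on `(0, ∞)`. -/
def radialMeasure (s : ℝ) : Measure ℝ :=
  (volume.restrict (Ioi 0)).withDensity fun ρ => ENNReal.ofReal (ρ ^ (-1 - s))

/-- The measure `ρ^{-1-s} dρ dy` on `(0, ∞) × B(0,1)`; its image under `(ρ, y) ↦ ρ y` is a multiple
of the Lévy measure `|z|^{-3-s} dz`. -/
def levy (s : ℝ) : Measure (ℝ × E3) := (radialMeasure s).prod (volume.restrict (ball 0 1))

instance (s : ℝ) : SFinite (radialMeasure s) := by unfold radialMeasure; infer_instance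

instance (s : ℝ) : SFinite (levy s) := by unfold levy; infer_instance

lemma measurable_radialDensity (s : ℝ) :
    Measurable fun ρ : ℝ => ENNReal.ofReal (ρ ^ (-1 - s)) := by fun_prop

lemma lintegral_radialMeasure (s : ℝ) (f : ℝ → ℝ≥0∞) :
    ∫⁻ ρ, f ρ ∂radialMeasure s = ∫⁻ ρ in Ioi 0, ENNReal.ofReal (ρ ^ (-1 - s)) * f ρ := by
  rw [radialMeasure, lintegral_withDensity_eq_lintegral_mul_non_measurable _
    (measurable_radialDensity s) (ae_of_all _ fun _ => ENNReal.ofReal_lt_top)]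
  rfl

/-- Below `R` the linear bound leaves `ρ^(-s)`, integrable at zero as `s < 1`; above `R` the
constant bound leaves `ρ^(-1-s)`, integrable at infinity as `s > 0`. -/
lemma lintegral_radial_min_le {s : ℝ} (hs : 0 < s) (hs1 : s < 1) (a b : ℝ≥0∞) {R : ℝ}
    (hR : 0 < R) :
    ∫⁻ ρ, min a (ENNReal.ofReal ρ * b) ∂radialMeasure s ≤
      b * ENNReal.ofReal (R ^ (1 - s) / (1 - s)) + a * ENNReal.ofReal (R ^ (-s) / s) := by
  rw [lintegral_radialMeasure, ← Ioc_union_Ioi_eq_Ioi hR.le, lintegral_union measurableSet_Ioi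
    (Ioc_disjoint_Ioi le_rfl)]
  gcongr
  · calc ∫⁻ ρ in Ioc 0 R, ENNReal.ofReal (ρ ^ (-1 - s)) * min a (ENNReal.ofReal ρ * b)
        ≤ ∫⁻ ρ in Ioc 0 R, b * ENNReal.ofReal (ρ ^ (-s)) := by
          refine lintegral_mono_ae ?_
          filter_upwards [ae_restrict_mem measurableSet_Ioc] with ρ hρ
          have hρ0 : 0 < ρ := hρ.1
          refine (mul_le_mul' le_rfl (min_le_right _ _)).trans (le_of_eq ?_)
          rw [← mul_assoc, ← ENNReal.ofReal_mul (by positivity), mul_comm]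
          congr 2
          rw [← Real.rpow_add_one hρ0.ne']; congr 1; ring
      _ = b * ENNReal.ofReal (R ^ (1 - s) / (1 - s)) := by
          rw [lintegral_const_mul _ (by fun_prop)]
          congr 1
          have hi : IntervalIntegrable (fun t : ℝ => t ^ (-s)) volume 0 R :=
            intervalIntegral.intervalIntegrable_rpow' (by linarith)
          rw [← ofReal_integral_eq_lintegral_ofReal
            ((intervalIntegrable_iff_integrableOn_Ioc_of_le hR.le).1 hi)]
          · rw [← intervalIntegral.integral_of_le hR.le, integral_rpow (Or.inl (by linarith)),
              Real.zero_rpow (by linarith), sub_zero]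
            rw [show -s + 1 = 1 - s by ring]
          · filter_upwards [ae_restrict_mem measurableSet_Ioc] with t ht
            have := ht.1
            simp only [Pi.zero_apply]; positivity
  · calc ∫⁻ ρ in Ioi R, ENNReal.ofReal (ρ ^ (-1 - s)) * min a (ENNReal.ofReal ρ * b)
        ≤ ∫⁻ ρ in Ioi R, a * ENNReal.ofReal (ρ ^ (-1 - s)) := by
          refine lintegral_mono fun ρ => ?_
          rw [mul_comm a]
          exact mul_le_mul' le_rfl (min_le_left _ _)
      _ = a * ENNReal.ofReal (R ^ (-s) / s) := by
          rw [lintegral_const_mul _ (measurable_radialDensity s)]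
          congr 1
          rw [← ofReal_integral_eq_lintegral_ofReal (integrableOn_Ioi_rpow_of_lt (by linarith) hR)]
          · rw [integral_Ioi_rpow_of_lt (by linarith) hR]
            congr 1
            rw [show -1 - s + 1 = -s by ring, neg_div_neg_eq]
          · filter_upwards [ae_restrict_mem measurableSet_Ioi] with t ht
            have : 0 < t := hR.trans ht
            simp only [Pi.zero_apply]; positivity

/-- The interpolation inequality behind Hedberg's argument. -/
lemma lintegral_radial_min_le_rpow {s : ℝ} (hs : 0 < s) (hs1 : s < 1) (a b : ℝ≥0∞) :
    ∫⁻ ρ, min a (ENNReal.ofReal ρ * b) ∂radialMeasure s ≤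
      ENNReal.ofReal (1 / (1 - s) + 1 / s) * (a ^ (1 - s) * b ^ s) := by
  have h1s : 0 < 1 - s := by linarith
  rcases eq_or_ne a 0 with rfl | ha
  · simp
  rcases eq_or_ne b 0 with rfl | hb
  · simp
  have hc : ENNReal.ofReal (1 / (1 - s) + 1 / s) ≠ 0 := by
    simp only [ne_eq, ENNReal.ofReal_eq_zero, not_le]; positivity
  have ha' : a ^ (1 - s) ≠ 0 := by simp [ENNReal.rpow_eq_zero_iff, ha, h1s.not_gt]
  have hb' : b ^ s ≠ 0 := by simp [ENNReal.rpow_eq_zero_iff, hb, hs.not_gt]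
  rcases eq_or_ne a ⊤ with rfl | hat
  · rw [ENNReal.top_rpow_of_pos h1s, ENNReal.top_mul hb', ENNReal.mul_top hc]; exact le_top
  rcases eq_or_ne b ⊤ with rfl | hbt
  · rw [ENNReal.top_rpow_of_pos hs, ENNReal.mul_top ha', ENNReal.mul_top hc]; exact le_top
  lift a to NNReal using hat
  lift b to NNReal using hbt
  have ha0 : 0 < (a : ℝ) := by simpa [pos_iff_ne_zero] using ha
  have hb0 : 0 < (b : ℝ) := by simpa [pos_iff_ne_zero] using hb
  -- The radius `a / b`, where the two bounds inside the minimum coincide, makes both contributions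
  -- multiples of `a^(1-s) b^s`.
  refine (lintegral_radial_min_le hs hs1 a b (R := a / b) (by positivity)).trans (le_of_eq ?_)
  rw [← ENNReal.ofReal_coe_nnreal (p := a), ← ENNReal.ofReal_coe_nnreal (p := b),
    ENNReal.ofReal_rpow_of_pos ha0, ENNReal.ofReal_rpow_of_pos hb0, ← ENNReal.ofReal_mul hb0.le,
    ← ENNReal.ofReal_mul ha0.le, ← ENNReal.ofReal_add (by positivity) (by positivity),
    ← ENNReal.ofReal_mul (by positivity), ← ENNReal.ofReal_mul (by positivity)]
  congr 1
  rw [Real.div_rpow ha0.le hb0.le, Real.div_rpow ha0.le hb0.le, Real.rpow_sub ha0, Real.rpow_sub hb0,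
    Real.rpow_neg ha0.le, Real.rpow_neg hb0.le, Real.rpow_one, Real.rpow_one]
  field_simp

lemma lintegral_levy_le {s : ℝ} (F : ℝ × E3 → ℝ≥0∞) (a b : ℝ≥0∞)
    (h : ∀ ρ, 0 < ρ → ∫⁻ y in ball (0 : E3) 1, F (ρ, y) ≤ min a (ENNReal.ofReal ρ * b)) :
    ∫⁻ z, F z ∂levy s ≤ ∫⁻ ρ, min a (ENNReal.ofReal ρ * b) ∂radialMeasure s := by
  refine (lintegral_prod_le _).trans ?_
  rw [lintegral_radialMeasure, lintegral_radialMeasure]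
  refine lintegral_mono_ae ?_
  filter_upwards [ae_restrict_mem measurableSet_Ioi] with ρ hρ
  exact mul_le_mul' le_rfl (h ρ hρ)

/-- Pointwise version for functions bounded by `min A (ρ B)`. -/
lemma lintegral_levy_enorm_le {s : ℝ} {F : Type*} [NormedAddCommGroup F] {H : ℝ × E3 → F} {A B : ℝ}
    (h : ∀ ρ y, 0 < ρ → ‖y‖ < 1 → ‖H (ρ, y)‖ ≤ A ∧ ‖H (ρ, y)‖ ≤ ρ * B) :
    ∫⁻ z, ‖H z‖ₑ ∂levy s ≤ ∫⁻ ρ, min (ENNReal.ofReal A * volume (ball (0 : E3) 1))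
      (ENNReal.ofReal ρ * (ENNReal.ofReal B * volume (ball (0 : E3) 1))) ∂radialMeasure s := by
  refine lintegral_levy_le _ _ _ fun ρ hρ => ?_
  rw [← setLIntegral_const, ← mul_assoc, ← setLIntegral_const]
  refine le_min ?_ ?_
  · refine lintegral_mono_ae ?_
    filter_upwards [ae_restrict_mem measurableSet_ball] with y hy
    rw [← ofReal_norm]
    exact ENNReal.ofReal_le_ofReal (h ρ y hρ (by simpa using hy)).1
  · refine lintegral_mono_ae ?_
    filter_upwards [ae_restrict_mem measurableSet_ball] with y hy
    rw [← ofReal_norm, ← ENNReal.ofReal_mul hρ.le]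
    exact ENNReal.ofReal_le_ofReal (h ρ y hρ (by simpa using hy)).2

/-- The constant in the integrability bound with respect to the Lévy measure. -/
def levyConst (s : ℝ) : ℝ :=
  (volume (ball (0 : E3) 1)).toReal * (1 / (1 - s) + 1 / s)

/-- Cutting at radius 1 is not optimal, but the bound is linear in `A` and `B`, which is convenient
for the integrability checks behind Fubini. -/
lemma lintegral_levy_enorm_le' {s : ℝ} (hs : 0 < s) (hs1 : s < 1) {F : Type*}
    [NormedAddCommGroup F] {H : ℝ × E3 → F} {A B : ℝ} (hA : 0 ≤ A) (hB : 0 ≤ B)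
    (h : ∀ ρ y, 0 < ρ → ‖y‖ < 1 → ‖H (ρ, y)‖ ≤ A ∧ ‖H (ρ, y)‖ ≤ ρ * B) :
    ∫⁻ z, ‖H z‖ₑ ∂levy s ≤ ENNReal.ofReal (levyConst s * (A + B)) := by
  have h1s : 0 < 1 - s := by linarith
  refine (lintegral_levy_enorm_le h).trans
    ((lintegral_radial_min_le hs hs1 _ _ one_pos).trans ?_)
  have hv : volume (ball (0 : E3) 1) = ENNReal.ofReal (volume (ball (0 : E3) 1)).toReal :=
    (ENNReal.ofReal_toReal measure_ball_lt_top.ne).symm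
  rw [hv, ← ENNReal.ofReal_mul hA, ← ENNReal.ofReal_mul hB, ← ENNReal.ofReal_mul (by positivity),
    ← ENNReal.ofReal_mul (by positivity), ← ENNReal.ofReal_add (by positivity) (by positivity)]
  refine ENNReal.ofReal_le_ofReal ?_
  rw [levyConst, Real.one_rpow, Real.one_rpow]
  have hV : 0 ≤ (volume (ball (0 : E3) 1)).toReal := ENNReal.toReal_nonneg
  generalize (volume (ball (0 : E3) 1)).toReal = V at *
  have e1 : 0 ≤ V * A * (1 / (1 - s)) := by positivity
  have e2 : 0 ≤ V * B * (1 / s) := by positivity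
  nlinarith

lemma integrable_levy {s : ℝ} (hs : 0 < s) (hs1 : s < 1) {F : Type*} [NormedAddCommGroup F]
    {H : ℝ × E3 → F} {A B : ℝ} (hA : 0 ≤ A) (hB : 0 ≤ B)
    (hm : AEStronglyMeasurable H (levy s))
    (h : ∀ ρ y, 0 < ρ → ‖y‖ < 1 → ‖H (ρ, y)‖ ≤ A ∧ ‖H (ρ, y)‖ ≤ ρ * B) :
    Integrable H (levy s) :=
  ⟨hm, (lintegral_levy_enorm_le' hs hs1 hA hB h).trans_lt ENNReal.ofReal_lt_top⟩

/-! ### The symbol of the difference operator -/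

section Symbol

/-- The symbol of `f ↦ ∫_{B(0,1)} (f(x) - f(x - y)) dy`. -/
def ballSymbol (ξ : E3) : ℂ :=
  ∫ y in ball (0 : E3) 1, (1 - Complex.exp ((-2 * Real.pi * ⟪y, ξ⟫ : ℝ) * Complex.I))

lemma norm_one_sub_exp_le (t : ℝ) : ‖1 - Complex.exp ((t : ℂ) * Complex.I)‖ ≤ 2 ∧
    ‖1 - Complex.exp ((t : ℂ) * Complex.I)‖ ≤ |t| := by
  constructor
  · refine (norm_sub_le _ _).trans ?_
    rw [Complex.norm_exp_ofReal_mul_I, norm_one]; norm_num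
  · rw [norm_sub_rev, mul_comm]
    exact Real.norm_exp_I_mul_ofReal_sub_one_le

lemma norm_one_sub_exp_inner_le (ρ : ℝ) (y ξ : E3) (hρ : 0 < ρ) (hy : ‖y‖ < 1) :
    ‖1 - Complex.exp ((-2 * Real.pi * ⟪ρ • y, ξ⟫ : ℝ) * Complex.I)‖ ≤ 2 ∧
    ‖1 - Complex.exp ((-2 * Real.pi * ⟪ρ • y, ξ⟫ : ℝ) * Complex.I)‖ ≤
      ρ * (2 * Real.pi * ‖ξ‖) := by
  refine ⟨(norm_one_sub_exp_le _).1, (norm_one_sub_exp_le _).2.trans ?_⟩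
  rw [abs_mul, abs_mul, abs_neg, abs_of_pos Real.pi_pos, abs_two]
  have h1 : |⟪ρ • y, ξ⟫| ≤ ρ * ‖ξ‖ := by
    refine (abs_real_inner_le_norm _ _).trans ?_
    rw [norm_smul, Real.norm_of_nonneg hρ.le]
    have : ρ * ‖y‖ ≤ ρ * 1 := by gcongr
    nlinarith [norm_nonneg ξ]
  have := Real.pi_pos
  nlinarith

lemma ballSymbol_comp (A : E3 ≃ₗᵢ[ℝ] E3) (ξ : E3) : ballSymbol (A ξ) = ballSymbol ξ := by
  unfold ballSymbol
  have h := A.measurePreserving.setIntegral_preimage_emb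
    A.toHomeomorph.measurableEmbedding
    (fun y => (1 - Complex.exp ((-2 * Real.pi * ⟪y, A ξ⟫ : ℝ) * Complex.I))) (ball 0 1)
  rw [← h, show A ⁻¹' ball 0 1 = ball 0 1 by
    ext y; simp]
  simp only [LinearIsometryEquiv.inner_map_map]

/-- The reflection in the hyperplane orthogonal to `ξ - η` exchanges two vectors of equal length,
and the unit ball is invariant under it. -/
lemma ballSymbol_eq_of_norm_eq {ξ η : E3} (h : ‖ξ‖ = ‖η‖) : ballSymbol ξ = ballSymbol η := by
  rw [← Submodule.reflection_sub h, ballSymbol_comp]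

/-- Conjugation amounts to `ξ ↦ -ξ`, which preserves the norm; hence the symbol is real. -/
lemma conj_ballSymbol (ξ : E3) : (starRingEnd ℂ) (ballSymbol ξ) = ballSymbol ξ := by
  conv_rhs => rw [← ballSymbol_eq_of_norm_eq (norm_neg ξ)]
  unfold ballSymbol
  rw [← integral_conj]
  congr 1; ext1 y
  rw [map_sub, map_one, ← Complex.exp_conj, map_mul, Complex.conj_I, Complex.conj_ofReal,
    inner_neg_right]
  push_cast
  ring_nf

lemma integrableOn_ballSymbol (ξ : E3) : IntegrableOn
    (fun y : E3 => 1 - Complex.exp ((-2 * Real.pi * ⟪y, ξ⟫ : ℝ) * Complex.I)) (ball 0 1) := by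
  refine Measure.integrableOn_of_bounded (M := 2) measure_ball_lt_top.ne ?_ ?_
  · exact Continuous.aestronglyMeasurable (by fun_prop)
  · exact ae_of_all _ fun y => (norm_one_sub_exp_le _).1

lemma ballSymbol_re_nonneg (ξ : E3) : 0 ≤ (ballSymbol ξ).re := by
  rw [ballSymbol, ← RCLike.re_eq_complex_re, ← integral_re (integrableOn_ballSymbol ξ)]
  refine integral_nonneg fun y => ?_
  simp only [Pi.zero_apply, RCLike.re_eq_complex_re, Complex.sub_re, Complex.one_re,
    Complex.exp_ofReal_mul_I_re]
  linarith [Real.cos_le_one (-2 * Real.pi * ⟪y, ξ⟫)]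

/-- The integrand `1 - cos` is continuous and nonnegative, and it is positive at `y = e / 2`, where
the phase is `πρ` in absolute value, strictly between 0 and `π`. -/
lemma ballSymbol_re_pos {e : E3} (he : ‖e‖ = 1) {ρ : ℝ} (hρ : ρ ∈ Ioo (0 : ℝ) 1) :
    0 < (ballSymbol (ρ • e)).re := by
  have hc : ∀ y : E3, RCLike.re (1 - Complex.exp ((-2 * Real.pi * ⟪y, ρ • e⟫ : ℝ) * Complex.I)) =
      1 - Real.cos (-2 * Real.pi * ⟪y, ρ • e⟫) := fun y => by
    simp only [RCLike.re_eq_complex_re, Complex.sub_re, Complex.one_re,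
      Complex.exp_ofReal_mul_I_re]
  rw [ballSymbol, ← RCLike.re_eq_complex_re, ← integral_re (integrableOn_ballSymbol _)]
  simp_rw [hc]
  rw [setIntegral_pos_iff_support_of_nonneg_ae]
  · refine IsOpen.measure_pos _ ?_ ⟨(1 / 2 : ℝ) • e, ?_, ?_⟩
    · refine IsOpen.inter ?_ isOpen_ball
      exact (isOpen_compl_singleton (x := (0 : ℝ))).preimage (by fun_prop)
    · simp only [Function.mem_support, inner_smul_left, inner_smul_right,
        real_inner_self_eq_norm_sq, he]
      rw [sub_ne_zero, ne_comm]
      have : Real.cos (-2 * Real.pi * (ρ * ((starRingEnd ℝ) (1 / 2) * 1 ^ 2))) =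
          Real.cos (Real.pi * ρ) := by
        rw [← Real.cos_neg]; congr 1
        simp only [conj_trivial]; ring
      rw [this]
      have h2 : Real.cos (Real.pi * ρ) < Real.cos 0 := by
        refine Real.cos_lt_cos_of_nonneg_of_le_pi le_rfl ?_ ?_
        · nlinarith [Real.pi_pos, hρ.2]
        · have := Real.pi_pos; have := hρ.1; positivity
      rw [Real.cos_zero] at h2
      exact h2.ne
    · simp [norm_smul, he]; norm_num
  · refine ae_of_all _ fun y => ?_
    simp only [Pi.zero_apply]
    linarith [Real.cos_le_one (-2 * Real.pi * ⟪y, ρ • e⟫)]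
  · have := (integrableOn_ballSymbol (ρ • e)).re
    simp only [hc] at this
    exact this

/-- The symbol of `f ↦ ∫ (f(x) - f(x - ρ y)) dλ(ρ, y)`. -/
def levySymbol (s : ℝ) (ξ : E3) : ℂ :=
  ∫ z, (1 - Complex.exp ((-2 * Real.pi * ⟪z.1 • z.2, ξ⟫ : ℝ) * Complex.I)) ∂levy s

lemma integrable_levySymbol {s : ℝ} (hs : 0 < s) (hs1 : s < 1) (ξ : E3) : Integrable
    (fun z : ℝ × E3 => 1 - Complex.exp ((-2 * Real.pi * ⟪z.1 • z.2, ξ⟫ : ℝ) * Complex.I))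
    (levy s) := by
  have := Real.pi_pos
  refine integrable_levy hs hs1 (A := 2) (B := 2 * Real.pi * ‖ξ‖) (by norm_num) (by positivity)
    (Continuous.aestronglyMeasurable (by fun_prop)) fun ρ y hρ hy =>
      norm_one_sub_exp_inner_le ρ y ξ hρ hy

lemma integral_radialMeasure {F : Type*} [NormedAddCommGroup F] [NormedSpace ℝ F] (s : ℝ)
    (f : ℝ → F) : ∫ ρ, f ρ ∂radialMeasure s = ∫ ρ in Ioi 0, ρ ^ (-1 - s) • f ρ := by
  rw [radialMeasure, integral_withDensity_eq_integral_toReal_smul (measurable_radialDensity s)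
    (ae_of_all _ fun _ => ENNReal.ofReal_lt_top)]
  refine setIntegral_congr_fun measurableSet_Ioi fun ρ hρ => ?_
  have : 0 < ρ := hρ
  simp only [ENNReal.toReal_ofReal (Real.rpow_nonneg this.le _)]

lemma levySymbol_eq {s : ℝ} (hs : 0 < s) (hs1 : s < 1) (ξ : E3) :
    levySymbol s ξ = ∫ ρ in Ioi (0 : ℝ), ρ ^ (-1 - s) • ballSymbol (ρ • ξ) := by
  rw [levySymbol, levy, integral_prod _ (integrable_levySymbol hs hs1 ξ), integral_radialMeasure]
  simp only [inner_smul_left, ballSymbol, inner_smul_right, conj_trivial]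

/-- A fixed unit vector. -/
def unitVec : E3 := EuclideanSpace.single 0 1

lemma norm_unitVec : ‖unitVec‖ = 1 := by simp [unitVec]

/-- The value of the symbol at a unit vector. -/
def symConst (s : ℝ) : ℝ := (levySymbol s unitVec).re

/-- The radial substitution `ρ ↦ ‖ξ‖ρ` extracts the factor `‖ξ‖^s`, and rotation invariance replaces
the direction of `ξ` by a fixed one. -/
lemma levySymbol_eq_const {s : ℝ} (hs : 0 < s) (hs1 : s < 1) (ξ : E3) :
    levySymbol s ξ = ((‖ξ‖ ^ s * symConst s : ℝ) : ℂ) := by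
  have hreal : ((symConst s : ℝ) : ℂ) = levySymbol s unitVec := by
    rw [symConst]
    refine Complex.conj_eq_iff_re.1 ?_
    rw [levySymbol_eq hs hs1, ← integral_conj]
    congr 1; ext1 ρ
    rw [Complex.real_smul, map_mul, Complex.conj_ofReal, conj_ballSymbol]
  rcases eq_or_ne ξ 0 with rfl | hξ
  · simp [levySymbol, Real.zero_rpow hs.ne']
  have hn : 0 < ‖ξ‖ := norm_pos_iff.2 hξ
  rw [Complex.ofReal_mul, hreal, levySymbol_eq hs hs1, levySymbol_eq hs hs1]
  have h := integral_comp_mul_left_Ioi (fun ρ : ℝ => ρ ^ (-1 - s) • ballSymbol (ρ • unitVec)) 0 hn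
  rw [mul_zero] at h
  have h2 : ∫ ρ in Ioi (0 : ℝ), ρ ^ (-1 - s) • ballSymbol (ρ • ξ) =
      (‖ξ‖ ^ (1 + s)) • ∫ ρ in Ioi (0 : ℝ),
        (‖ξ‖ * ρ) ^ (-1 - s) • ballSymbol ((‖ξ‖ * ρ) • unitVec) := by
    rw [← integral_smul]
    refine setIntegral_congr_fun measurableSet_Ioi fun ρ hρ => ?_
    have hρ : 0 < ρ := hρ
    rw [ballSymbol_eq_of_norm_eq (ξ := ρ • ξ) (η := (‖ξ‖ * ρ) • unitVec), smul_smul]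
    · congr 1
      rw [Real.mul_rpow hn.le hρ.le, ← mul_assoc, ← Real.rpow_add hn]
      rw [show 1 + s + (-1 - s) = 0 by ring, Real.rpow_zero, one_mul]
    · rw [norm_smul, norm_smul, norm_mul, norm_norm, norm_unitVec]; ring
  rw [h2, h, smul_smul, Complex.real_smul]
  congr 2
  rw [Real.rpow_add hn, Real.rpow_one]
  field_simp

/-- The radial integrand is nonnegative and strictly positive for `0 < ρ < 1`. Positivity permits
dividing by the constant to recover `Λ^s`. -/
lemma symConst_pos {s : ℝ} (hs : 0 < s) (hs1 : s < 1) : 0 < symConst s := by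
  have hi := (integrable_levySymbol hs hs1 unitVec).integral_prod_left
  have hi2 : IntegrableOn (fun ρ : ℝ => ρ ^ (-1 - s) • ballSymbol (ρ • unitVec)) (Ioi 0) := by
    rw [radialMeasure, integrable_withDensity_iff_integrable_smul' (measurable_radialDensity s)
      (ae_of_all _ fun _ => ENNReal.ofReal_lt_top)] at hi
    refine hi.congr ?_
    filter_upwards [ae_restrict_mem measurableSet_Ioi] with ρ hρ
    have hρ : 0 < ρ := hρ
    simp only [ENNReal.toReal_ofReal (Real.rpow_nonneg hρ.le _), inner_smul_left, ballSymbol,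
      inner_smul_right, conj_trivial]
  rw [symConst, levySymbol_eq hs hs1, ← RCLike.re_eq_complex_re, ← integral_re hi2]
  have e : ∀ ρ : ℝ, RCLike.re (ρ ^ (-1 - s) • ballSymbol (ρ • unitVec)) =
      ρ ^ (-1 - s) * (ballSymbol (ρ • unitVec)).re := fun ρ => by
    rw [RCLike.re_eq_complex_re, Complex.real_smul, Complex.re_ofReal_mul]
  simp_rw [e]
  rw [setIntegral_pos_iff_support_of_nonneg_ae]
  · have hsub : Ioo (0 : ℝ) 1 ⊆
        (Function.support fun ρ : ℝ => ρ ^ (-1 - s) * (ballSymbol (ρ • unitVec)).re) ∩ Ioi 0 := by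
      intro ρ hρ
      refine ⟨?_, hρ.1⟩
      have h1 := ballSymbol_re_pos norm_unitVec hρ
      have h2 := Real.rpow_pos_of_pos hρ.1 (-1 - s)
      exact (mul_pos h2 h1).ne'
    refine lt_of_lt_of_le ?_ (measure_mono hsub)
    simp
  · filter_upwards [ae_restrict_mem measurableSet_Ioi] with ρ hρ
    have hρ : 0 < ρ := hρ
    exact mul_nonneg (by positivity) (ballSymbol_re_nonneg _)
  · have := hi2.re
    simp only [e] at this
    exact this

end Symbol

/-! ### `Λ^s` as an integral of differences, and Hedberg's inequality -/

open Metric Set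

/-- A real Schwartz function regarded as a complex one. -/
def toComplex (φ : 𝓢(E3, ℝ)) : 𝓢(E3, ℂ) := SchwartzMap.postcompCLM Complex.ofRealCLM φ

@[simp] lemma toComplex_apply (φ : 𝓢(E3, ℝ)) (x : E3) : toComplex φ x = (φ x : ℂ) := rfl

lemma fourier_ofReal (φ : 𝓢(E3, ℝ)) :
    𝓕 (fun y : E3 => (φ y : ℂ)) = (𝓕 (toComplex φ) : 𝓢(E3, ℂ)) := by
  rw [SchwartzMap.fourier_coe]; rfl

/-- The constant relating the difference operator to `Λ^s`. -/
def lamConst (s : ℝ) : ℝ := symConst s * (2 * Real.pi) ^ (-s)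

lemma lamConst_pos {s : ℝ} (hs : 0 < s) (hs1 : s < 1) : 0 < lamConst s :=
  mul_pos (symConst_pos hs hs1) (Real.rpow_pos_of_pos (by positivity) _)

/-- `Λ^s` as an integral of differences. -/
lemma lamConst_mul_Lam {s : ℝ} (hs : 0 < s) (hs1 : s < 1) (φ : 𝓢(E3, ℝ)) (x : E3) :
    lamConst s * Lam s φ x = ∫ z, (φ x - φ (x - z.1 • z.2)) ∂levy s := by
  set ψ : 𝓢(E3, ℂ) := 𝓕 (toComplex φ) with hψ
  set e : E3 → E3 → ℂ := fun ξ y => Complex.exp ((2 * Real.pi * ⟪ξ, y⟫ : ℝ) * Complex.I) with he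
  have he1 : ∀ ξ y, ‖e ξ y‖ = 1 := fun ξ y => Complex.norm_exp_ofReal_mul_I _
  have hec : Continuous fun p : E3 × E3 => e p.1 p.2 := by fun_prop
  have hint : ∀ y, Integrable fun ξ => e ξ y * ψ ξ := fun y => by
    refine ψ.integrable.mono ?_ (ae_of_all _ fun ξ => by rw [norm_mul, he1, one_mul])
    exact ((hec.comp (by fun_prop : Continuous fun ξ : E3 => (ξ, y))).mul
      ψ.continuous).aestronglyMeasurable
  have hinv : ∀ y, (φ y : ℂ) = ∫ ξ, e ξ y * ψ ξ := by
    intro y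
    have h1 : (𝓕⁻ ψ : 𝓢(E3, ℂ)) y = (φ y : ℂ) := by
      rw [hψ, FourierTransform.fourierInv_fourier_eq]; rfl
    rw [← h1, SchwartzMap.fourierInv_coe, Real.fourierInv_eq']
    rfl
  set m : ℝ × E3 → E3 → ℂ := fun z ξ =>
    1 - Complex.exp ((-2 * Real.pi * ⟪z.1 • z.2, ξ⟫ : ℝ) * Complex.I) with hm
  have hmc : Continuous fun p : (ℝ × E3) × E3 => m p.1 p.2 := by fun_prop
  -- By Fourier inversion a difference in `x` is multiplication by `1 - exp(-2πi⟨z, ξ⟩)` in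
  -- frequency; integrating this factor over the Lévy measure produces its symbol.
  have hdiff : ∀ z : ℝ × E3, ((φ x - φ (x - z.1 • z.2) : ℝ) : ℂ) = ∫ ξ, e ξ x * m z ξ * ψ ξ := by
    intro z
    rw [Complex.ofReal_sub, hinv, hinv, ← integral_sub (hint _) (hint _)]
    congr 1; ext1 ξ
    rw [← sub_mul]
    congr 1
    simp only [he, hm, mul_sub, mul_one]
    rw [← Complex.exp_add]
    congr 2
    rw [inner_sub_right, real_inner_comm (z.1 • z.2) ξ]
    push_cast; ring
  have hprod : Integrable (Function.uncurry fun (z : ℝ × E3) ξ => e ξ x * m z ξ * ψ ξ)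
      ((levy s).prod volume) := by
    have hcont : Continuous (Function.uncurry fun (z : ℝ × E3) ξ => e ξ x * m z ξ * ψ ξ) := by
      refine Continuous.mul (Continuous.mul ?_ hmc) (ψ.continuous.comp continuous_snd)
      exact hec.comp (by fun_prop : Continuous fun p : (ℝ × E3) × E3 => (p.2, x))
    -- At fixed frequency the Lévy integral grows at most like `1 + ‖ξ‖`, which the decay of `ψ`
    -- absorbs.
    refine (integrable_prod_iff' hcont.aestronglyMeasurable).2 ⟨ae_of_all _ fun ξ => ?_, ?_⟩
    · have := ((integrable_levySymbol hs hs1 ξ).const_mul (e ξ x)).mul_const (ψ ξ)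
      exact this
    · have hb : Integrable fun ξ : E3 => levyConst s * (2 * ‖ψ ξ‖ + 2 * Real.pi *
          (‖ξ‖ ^ 1 * ‖ψ ξ‖)) :=
        ((ψ.integrable.norm.const_mul 2).add
          ((ψ.integrable_pow_mul volume 1).const_mul (2 * Real.pi))).const_mul _
      refine hb.mono' ?_ (ae_of_all _ fun ξ => ?_)
      · exact (hcont.norm.aestronglyMeasurable.prod_swap).integral_prod_right'
      · have hpi := Real.pi_pos
        rw [Real.norm_of_nonneg (integral_nonneg fun _ => norm_nonneg _)]
        simp only [Function.uncurry, norm_mul, he1, one_mul]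
        rw [integral_mul_const]
        have h1 : ∫ z, ‖m z ξ‖ ∂levy s ≤ levyConst s * (2 + 2 * Real.pi * ‖ξ‖) := by
          rw [integral_norm_eq_lintegral_enorm (integrable_levySymbol hs hs1 ξ).1]
          have h1s : 0 < 1 - s := by linarith
          refine ENNReal.toReal_le_of_le_ofReal ?_ (lintegral_levy_enorm_le' hs hs1 (by norm_num)
            (by positivity) fun ρ y hρ hy => norm_one_sub_exp_inner_le ρ y ξ hρ hy)
          unfold levyConst
          positivity
        calc _ ≤ levyConst s * (2 + 2 * Real.pi * ‖ξ‖) * ‖ψ ξ‖ := by gcongr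
          _ = _ := by ring
  have key : ((∫ z, (φ x - φ (x - z.1 • z.2)) ∂levy s : ℝ) : ℂ) =
      (lamConst s : ℂ) * 𝓕⁻ (fun ξ : E3 => (((2 * Real.pi * ‖ξ‖) ^ s : ℝ) : ℂ) * ψ ξ) x := by
    rw [← integral_complex_ofReal]
    simp_rw [hdiff]
    rw [integral_integral_swap hprod, Real.fourierInv_eq', ← integral_const_mul]
    congr 1; ext1 ξ
    have h2 : ∫ z, e ξ x * m z ξ * ψ ξ ∂levy s = e ξ x * levySymbol s ξ * ψ ξ := by
      rw [integral_mul_const, integral_const_mul]; rfl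
    rw [h2, levySymbol_eq_const hs hs1, smul_eq_mul, lamConst,
      Real.mul_rpow (by positivity) (norm_nonneg _), Real.rpow_neg (by positivity)]
    have h3 : ((2 * Real.pi : ℝ) ^ s : ℝ) ≠ 0 := (Real.rpow_pos_of_pos (by positivity) _).ne'
    have h3' : (((2 * Real.pi : ℝ) ^ s : ℝ) : ℂ) ≠ 0 := by exact_mod_cast h3
    simp only [Complex.ofReal_mul ((2 * Real.pi) ^ s), Complex.ofReal_mul (‖ξ‖ ^ s),
      Complex.ofReal_mul (symConst s), Complex.ofReal_inv]
    field_simp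
    simp only [he]
    ring
  have := congrArg Complex.re key
  rw [Complex.ofReal_re, Complex.re_ofReal_mul] at this
  rw [this, Lam, fourier_ofReal]

/-- The difference operator, a multiple of `Λ^s`. -/
def fracDiff (s : ℝ) (f : E3 → ℝ) (x : E3) : ℝ := ∫ z, (f x - f (x + z.1 • z.2)) ∂levy s

/-- The mean value inequality in integrated form. -/
lemma enorm_sub_le_lintegral_fderiv {f : E3 → ℝ} (hf : ContDiff ℝ 1 f) (x z : E3) :
    ‖f x - f (x + z)‖ₑ ≤ ∫⁻ τ in Ioc (0 : ℝ) 1, ‖z‖ₑ * ‖fderiv ℝ f (x + τ • z)‖ₑ := by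
  have hd : ∀ τ : ℝ, HasDerivAt (fun τ : ℝ => f (x + τ • z)) (fderiv ℝ f (x + τ • z) z) τ := by
    intro τ
    have h1 := (hf.differentiable (by simp) (x + τ • z)).hasFDerivAt
    have h2 : HasDerivAt (fun τ : ℝ => x + τ • z) z τ := by
      simpa using ((hasDerivAt_id τ).smul_const z).const_add x
    exact h1.comp_hasDerivAt τ h2
  have hc : Continuous fun τ : ℝ => fderiv ℝ f (x + τ • z) z :=
    ((hf.continuous_fderiv (by simp)).comp (by fun_prop)).clm_apply continuous_const
  have h := intervalIntegral.integral_eq_sub_of_hasDerivAt (fun τ _ => hd τ)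
    (hc.intervalIntegrable 0 1)
  simp only [one_smul, zero_smul, add_zero] at h
  rw [← enorm_neg, neg_sub, ← h, intervalIntegral.integral_of_le zero_le_one]
  refine (enorm_integral_le_lintegral_enorm _).trans (lintegral_mono fun τ => ?_)
  rw [mul_comm]
  exact ContinuousLinearMap.le_opENorm _ _

/-- Averages over balls are controlled by the maximal function. -/
lemma lintegral_ball_comp_smul_le (g : E3 → ℝ≥0∞) (x : E3) {ρ : ℝ} (hρ : 0 < ρ) :
    ∫⁻ y in ball (0 : E3) 1, g (x + ρ • y) ≤ volume (ball (0 : E3) 1) * hlMax g x := by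
  have hρ3 : ENNReal.ofReal (ρ ^ 3) ≠ 0 := by simp only [ne_eq, ENNReal.ofReal_eq_zero, not_le]; positivity
  have hmap : Measure.map (fun y : E3 => x + ρ • y) volume =
      ENNReal.ofReal ((ρ ^ 3)⁻¹) • (volume : Measure E3) := by
    have h1 := Measure.map_addHaar_smul (volume : Measure E3) hρ.ne'
    rw [finrank_euclideanSpace_fin, abs_of_pos (by positivity)] at h1
    have h2 : (fun y : E3 => x + ρ • y) = (fun y => x + y) ∘ (fun y => ρ • y) := rfl
    rw [h2, ← Measure.map_map (by fun_prop) (by fun_prop), h1, Measure.map_smul,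
      map_add_left_eq_self]
  let T : E3 ≃ₜ E3 := (Homeomorph.smulOfNeZero ρ hρ.ne').trans (Homeomorph.addLeft x)
  have hT : ∀ y, T y = x + ρ • y := fun y => rfl
  have hpre : T ⁻¹' (ball x ρ) = ball 0 1 := by
    ext y
    simp only [mem_preimage, hT, mem_ball, dist_self_add_left, dist_zero_right, norm_smul,
      Real.norm_of_nonneg hρ.le]
    constructor <;> intro h <;> nlinarith
  have h1 : ∫⁻ y in ball (0 : E3) 1, g (x + ρ • y) =
      ENNReal.ofReal ((ρ ^ 3)⁻¹) * ∫⁻ y in ball x ρ, g y := by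
    have h3 := T.measurableEmbedding.lintegral_map (μ := volume.restrict (T ⁻¹' (ball x ρ))) g
    rw [← T.measurableEmbedding.restrict_map, show Measure.map T volume = _ from hmap,
      Measure.restrict_smul, lintegral_smul_measure, hpre] at h3
    exact h3.symm
  rw [h1]
  refine (mul_le_mul' le_rfl (setLIntegral_ball_le_hlMax g x hρ)).trans (le_of_eq ?_)
  rw [Measure.addHaar_ball _ _ hρ.le, finrank_euclideanSpace_fin, ← mul_assoc, ← mul_assoc,
    ← ENNReal.ofReal_mul (by positivity), inv_mul_cancel₀ (by positivity), ENNReal.ofReal_one, one_mul]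

/-- Hedberg's pointwise inequality for the difference operator. -/
lemma enorm_fracDiff_le {s : ℝ} (hs : 0 < s) (hs1 : s < 1) {f : E3 → ℝ} (hf : ContDiff ℝ 1 f)
    (x : E3) :
    ‖fracDiff s f x‖ₑ ≤ ENNReal.ofReal (1 / (1 - s) + 1 / s) * volume (ball (0 : E3) 1) *
      ((‖f x‖ₑ + hlMax (fun y => ‖f y‖ₑ) x) ^ (1 - s) *
        hlMax (fun y => ‖fderiv ℝ f y‖ₑ) x ^ s) := by
  set V := volume (ball (0 : E3) 1)
  set a := ‖f x‖ₑ + hlMax (fun y => ‖f y‖ₑ) x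
  set b := hlMax (fun y => ‖fderiv ℝ f y‖ₑ) x
  have hfd : Continuous fun y => ‖fderiv ℝ f y‖ₑ := (hf.continuous_fderiv (by simp)).enorm
  -- For each radius `ρ`, the ball average of the differences has two bounds: the triangle
  -- inequality gives `V * a`, and the mean value formula along segments gives `ρ * (V * b)`. The
  -- value `‖f x‖ₑ` is kept in `a` beside the maximal function, which avoids comparing the two at a
  -- point.
  have hmain : ∫⁻ z, ‖f x - f (x + z.1 • z.2)‖ₑ ∂levy s ≤
      ∫⁻ ρ, min (V * a) (ENNReal.ofReal ρ * (V * b)) ∂radialMeasure s := by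
    refine lintegral_levy_le _ _ _ fun ρ hρ => le_min ?_ ?_
    · calc ∫⁻ y in ball (0 : E3) 1, ‖f x - f (x + ρ • y)‖ₑ
          ≤ ∫⁻ y in ball (0 : E3) 1, (‖f x‖ₑ + ‖f (x + ρ • y)‖ₑ) :=
            lintegral_mono fun y => enorm_sub_le
        _ = V * ‖f x‖ₑ + ∫⁻ y in ball (0 : E3) 1, ‖f (x + ρ • y)‖ₑ := by
            rw [lintegral_add_left measurable_const, setLIntegral_const, mul_comm]
        _ ≤ V * ‖f x‖ₑ + V * hlMax (fun y => ‖f y‖ₑ) x := by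
            gcongr
            exact lintegral_ball_comp_smul_le (fun y => ‖f y‖ₑ) x hρ
        _ = V * a := (mul_add _ _ _).symm
    · calc ∫⁻ y in ball (0 : E3) 1, ‖f x - f (x + ρ • y)‖ₑ
          ≤ ∫⁻ y in ball (0 : E3) 1, ∫⁻ τ in Ioc (0 : ℝ) 1,
              ENNReal.ofReal ρ * ‖fderiv ℝ f (x + (τ * ρ) • y)‖ₑ := by
            refine lintegral_mono_ae ?_
            filter_upwards [ae_restrict_mem measurableSet_ball] with y hy
            refine (enorm_sub_le_lintegral_fderiv hf x (ρ • y)).trans (lintegral_mono fun τ => ?_)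
            rw [smul_smul]
            gcongr
            rw [← ofReal_norm, norm_smul, Real.norm_of_nonneg hρ.le]
            refine ENNReal.ofReal_le_ofReal ?_
            have : ‖y‖ < 1 := by simpa using hy
            nlinarith
        _ = ∫⁻ τ in Ioc (0 : ℝ) 1, ∫⁻ y in ball (0 : E3) 1,
              ENNReal.ofReal ρ * ‖fderiv ℝ f (x + (τ * ρ) • y)‖ₑ := by
            refine lintegral_lintegral_swap ?_
            refine Measurable.aemeasurable ?_
            refine Measurable.const_mul ?_ _
            refine Continuous.measurable ?_
            exact hfd.comp (by fun_prop)
        _ ≤ ∫⁻ τ in Ioc (0 : ℝ) 1, ENNReal.ofReal ρ * (V * b) := by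
            refine lintegral_mono_ae ?_
            filter_upwards [ae_restrict_mem measurableSet_Ioc] with τ hτ
            rw [lintegral_const_mul' _ _ ENNReal.ofReal_ne_top]
            gcongr
            exact lintegral_ball_comp_smul_le (fun y => ‖fderiv ℝ f y‖ₑ) x (mul_pos hτ.1 hρ)
        _ = ENNReal.ofReal ρ * (V * b) := by simp
  refine (enorm_integral_le_lintegral_enorm _).trans (hmain.trans
    ((lintegral_radial_min_le_rpow hs hs1 _ _).trans (le_of_eq ?_)))
  have hV : V ^ (1 - s) * V ^ s = V := by
    rw [← ENNReal.rpow_add_of_nonneg _ _ (by linarith) hs.le, sub_add_cancel, ENNReal.rpow_one]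
  rw [ENNReal.mul_rpow_of_nonneg _ _ (by linarith : (0 : ℝ) ≤ 1 - s),
    ENNReal.mul_rpow_of_nonneg _ _ hs.le]
  conv_rhs => rw [← hV]
  ring

/-! ### Duality between differences and `Λ^s` -/

open Metric Set

lemma lintegral_enorm_sub_le {φ : E3 → ℝ} (hφ : ContDiff ℝ 1 φ) (w : E3) :
    ∫⁻ x, ‖φ x - φ (x + w)‖ₑ ≤ ‖w‖ₑ * ∫⁻ x, ‖fderiv ℝ φ x‖ₑ := by
  have hfd : Continuous fun y => ‖fderiv ℝ φ y‖ₑ := (hφ.continuous_fderiv (by simp)).enorm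
  calc ∫⁻ x, ‖φ x - φ (x + w)‖ₑ
      ≤ ∫⁻ x, ∫⁻ τ in Ioc (0 : ℝ) 1, ‖w‖ₑ * ‖fderiv ℝ φ (x + τ • w)‖ₑ :=
        lintegral_mono fun x => enorm_sub_le_lintegral_fderiv hφ x w
    _ = ∫⁻ τ in Ioc (0 : ℝ) 1, ∫⁻ x, ‖w‖ₑ * ‖fderiv ℝ φ (x + τ • w)‖ₑ := by
        refine lintegral_lintegral_swap (Measurable.aemeasurable ?_)
        refine Measurable.const_mul (Continuous.measurable ?_) _
        exact hfd.comp (by fun_prop)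
    _ = ∫⁻ τ in Ioc (0 : ℝ) 1, ‖w‖ₑ * ∫⁻ x, ‖fderiv ℝ φ x‖ₑ := by
        congr 1; ext1 τ
        rw [lintegral_const_mul' _ _ enorm_ne_top,
          lintegral_add_right_eq_self (fun x => ‖fderiv ℝ φ x‖ₑ)]
    _ = _ := by simp

/-- The first bound serves large increments and the second small ones; together they have the form
required by `integrable_levy`. -/
lemma integral_norm_sub_le (φ : 𝓢(E3, ℝ)) (w : E3) :
    ∫ x, ‖φ x - φ (x - w)‖ ≤ 2 * ∫ x, ‖φ x‖ ∧
    ∫ x, ‖φ x - φ (x - w)‖ ≤ ‖w‖ * ∫ x, ‖fderiv ℝ φ x‖ := by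
  have hi := φ.integrable (μ := volume)
  have hi2 : Integrable fun x => φ (x - w) := hi.comp_sub_right w
  have hd : Integrable fun x => fderiv ℝ φ x :=
    (SchwartzMap.fderivCLM ℝ E3 ℝ φ).integrable (μ := volume)
  constructor
  · calc ∫ x, ‖φ x - φ (x - w)‖ ≤ ∫ x, (‖φ x‖ + ‖φ (x - w)‖) :=
          integral_mono (hi.sub hi2).norm (hi.norm.add hi2.norm) fun x => norm_sub_le _ _
      _ = _ := by
          rw [integral_add hi.norm hi2.norm, integral_sub_right_eq_self (fun x => ‖φ x‖), two_mul]
  · have hs : Integrable fun x => φ x - φ (x - w) := hi.sub hi2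
    rw [integral_norm_eq_lintegral_enorm hs.1, integral_norm_eq_lintegral_enorm hd.1,
      ← toReal_enorm, ← ENNReal.toReal_mul]
    refine ENNReal.toReal_mono (ENNReal.mul_ne_top enorm_ne_top hd.2.ne) ?_
    have := lintegral_enorm_sub_le (φ.smooth 1) (-w)
    rw [enorm_neg] at this
    simpa only [sub_eq_add_neg] using this

section Weak

variable {s : ℝ} {f : E3 → ℝ} {A B : ℝ}

lemma norm_sub_le_of_fderiv_le (hf : ContDiff ℝ 1 f) (hB : ∀ x, ‖fderiv ℝ f x‖ ≤ B) (x w : E3) :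
    ‖f x - f (x + w)‖ ≤ B * ‖w‖ := by
  have := Convex.norm_image_sub_le_of_norm_fderiv_le (𝕜 := ℝ) (s := univ) (x := x + w) (y := x)
    (fun y _ => hf.differentiable (by simp) y) (fun y _ => hB y) convex_univ (mem_univ _) (mem_univ _)
  simpa using this

lemma norm_diff_le (hf : ContDiff ℝ 1 f) (hA : ∀ x, ‖f x‖ ≤ A) (hB : ∀ x, ‖fderiv ℝ f x‖ ≤ B)
    (x : E3) (ρ : ℝ) (y : E3) (hρ : 0 < ρ) (hy : ‖y‖ < 1) :
    ‖f x - f (x + ρ • y)‖ ≤ 2 * A ∧ ‖f x - f (x + ρ • y)‖ ≤ ρ * B := by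
  have hB0 : 0 ≤ B := (norm_nonneg _).trans (hB 0)
  refine ⟨(norm_sub_le _ _).trans (by linarith [hA x, hA (x + ρ • y)]),
    (norm_sub_le_of_fderiv_le hf hB x _).trans ?_⟩
  rw [norm_smul, Real.norm_of_nonneg hρ.le, mul_comm]
  have : ρ * ‖y‖ ≤ ρ * 1 := by gcongr
  nlinarith

lemma stronglyMeasurable_fracDiff (hf : Continuous f) : StronglyMeasurable (fracDiff s f) := by
  have : Continuous fun p : E3 × (ℝ × E3) => f p.1 - f (p.1 + p.2.1 • p.2.2) := by fun_prop
  exact this.stronglyMeasurable.integral_prod_right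

/-- The difference operator is the distributional `Λ^s` up to the constant. -/
lemma integral_mul_Lam (hs : 0 < s) (hs1 : s < 1) (hf : ContDiff ℝ 1 f) (hA : ∀ x, ‖f x‖ ≤ A)
    (hB : ∀ x, ‖fderiv ℝ f x‖ ≤ B) (φ : 𝓢(E3, ℝ)) :
    lamConst s * ∫ x, f x * Lam s φ x = ∫ x, fracDiff s f x * φ x := by
  have hA0 : 0 ≤ A := (norm_nonneg _).trans (hA 0)
  have hB0 : 0 ≤ B := (norm_nonneg _).trans (hB 0)
  have hfc := hf.continuous
  have hφc := φ.continuous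
  have hi := φ.integrable (μ := volume)
  have hint1 : Integrable (Function.uncurry fun (x : E3) (z : ℝ × E3) =>
      f x * (φ x - φ (x - z.1 • z.2))) (volume.prod (levy s)) := by
    have hcont : Continuous (Function.uncurry fun (x : E3) (z : ℝ × E3) =>
        f x * (φ x - φ (x - z.1 • z.2))) := by
      simp only [Function.uncurry_def]; fun_prop
    have hx : ∀ z : ℝ × E3, Integrable fun x => f x * (φ x - φ (x - z.1 • z.2)) := fun z =>
      (hi.sub (hi.comp_sub_right _)).bdd_mul hfc.aestronglyMeasurable (ae_of_all _ hA)
    refine (integrable_prod_iff' hcont.aestronglyMeasurable).2 ⟨ae_of_all _ hx, ?_⟩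
    refine integrable_levy hs hs1 (A := A * (2 * ∫ x, ‖φ x‖)) (B := A * ∫ x, ‖fderiv ℝ φ x‖)
      (by positivity) (by positivity)
      (hcont.norm.aestronglyMeasurable.prod_swap).integral_prod_right' fun ρ y hρ hy => ?_
    have hle : ‖∫ x, ‖f x * (φ x - φ (x - ρ • y))‖‖ ≤ A * ∫ x, ‖φ x - φ (x - ρ • y)‖ := by
      rw [Real.norm_of_nonneg (integral_nonneg fun _ => norm_nonneg _), ← integral_const_mul]
      refine integral_mono (hx (ρ, y)).norm ((hi.sub (hi.comp_sub_right _)).norm.const_mul A)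
        fun x => ?_
      simp only [norm_mul]
      gcongr
      exact hA x
    have hb := integral_norm_sub_le φ (ρ • y)
    refine ⟨hle.trans (by gcongr; exact hb.1), hle.trans ?_⟩
    rw [mul_left_comm]
    gcongr
    refine hb.2.trans ?_
    gcongr
    rw [norm_smul, Real.norm_of_nonneg hρ.le]
    nlinarith
  have hint2 : Integrable (Function.uncurry fun (x : E3) (z : ℝ × E3) =>
      (f x - f (x + z.1 • z.2)) * φ x) (volume.prod (levy s)) := by
    have hcont : Continuous (Function.uncurry fun (x : E3) (z : ℝ × E3) =>
        (f x - f (x + z.1 • z.2)) * φ x) := by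
      simp only [Function.uncurry_def]; fun_prop
    have hd := norm_diff_le hf hA hB
    have hx : ∀ z : ℝ × E3, Integrable fun x => (f x - f (x + z.1 • z.2)) * φ x := fun z => by
      refine hi.bdd_mul (c := 2 * A) (by fun_prop) (ae_of_all _ fun x => ?_)
      exact (norm_sub_le _ _).trans (by linarith [hA x, hA (x + z.1 • z.2)])
    refine (integrable_prod_iff' hcont.aestronglyMeasurable).2 ⟨ae_of_all _ hx, ?_⟩
    refine integrable_levy hs hs1 (A := 2 * A * ∫ x, ‖φ x‖) (B := B * ∫ x, ‖φ x‖)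
      (by positivity) (by positivity)
      (hcont.norm.aestronglyMeasurable.prod_swap).integral_prod_right' fun ρ y hρ hy => ?_
    rw [Real.norm_of_nonneg (integral_nonneg fun _ => norm_nonneg _), ← integral_const_mul,
      ← mul_assoc, ← integral_const_mul]
    constructor
    · refine integral_mono (hx (ρ, y)).norm (hi.norm.const_mul _) fun x => ?_
      simp only [Function.uncurry, norm_mul]
      gcongr
      exact (hd x ρ y hρ hy).1
    · refine integral_mono (hx (ρ, y)).norm (hi.norm.const_mul _) fun x => ?_
      simp only [Function.uncurry, norm_mul]
      gcongr
      exact (hd x ρ y hρ hy).2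
  calc lamConst s * ∫ x, f x * Lam s φ x
      = ∫ x, ∫ z, f x * (φ x - φ (x - z.1 • z.2)) ∂levy s := by
        rw [← integral_const_mul]
        congr 1; ext1 x
        rw [mul_left_comm, lamConst_mul_Lam hs hs1, integral_const_mul]
    _ = ∫ z, (∫ x, f x * (φ x - φ (x - z.1 • z.2))) ∂levy s := integral_integral_swap hint1
    -- For a fixed increment, translation invariance moves the difference from `φ` to `f`.
    _ = ∫ z, (∫ x, (f x - f (x + z.1 • z.2)) * φ x) ∂levy s := by
        congr 1; ext1 z
        set w := z.1 • z.2
        have h1 : Integrable fun x => f x * φ x :=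
          hi.bdd_mul hfc.aestronglyMeasurable (ae_of_all _ hA)
        have h2 : Integrable fun x => f x * φ (x - w) :=
          (hi.comp_sub_right w).bdd_mul hfc.aestronglyMeasurable (ae_of_all _ hA)
        have h3 : Integrable fun x => f (x + w) * φ x := by
          simpa using h2.comp_add_right w
        simp only [mul_sub, sub_mul]
        rw [integral_sub h1 h2, integral_sub h1 h3]
        congr 1
        rw [← integral_add_right_eq_self _ w]
        simp
    _ = ∫ x, ∫ z, (f x - f (x + z.1 • z.2)) * φ x ∂levy s := (integral_integral_swap hint2).symm
    _ = _ := by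
        congr 1; ext1 x
        rw [integral_mul_const]; rfl

end Weak

/-! ### Plancherel theory for `Λ^σ` -/

/-- The inclusion of test functions into complex Schwartz functions. -/
def testC (g : E3 → ℝ) (h1 : ContDiff ℝ ∞ g) (h2 : HasCompactSupport g) : 𝓢(E3, ℂ) :=
  toComplex (h2.toSchwartzMap h1)

@[simp] lemma testC_apply (g : E3 → ℝ) (h1 : ContDiff ℝ ∞ g) (h2 : HasCompactSupport g) (x : E3) :
    testC g h1 h2 x = (g x : ℂ) := rfl

/-- Locally integrable functions are determined by their pairings with Schwartz functions. -/
lemma ae_eq_of_integral_schwartz {u v : E3 → ℂ} (hu : LocallyIntegrable u)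
    (hv : LocallyIntegrable v) (h : ∀ ψ : 𝓢(E3, ℂ), ∫ x, ψ x * u x = ∫ x, ψ x * v x) :
    u =ᵐ[volume] v := by
  refine ae_eq_of_integral_contDiff_smul_eq hu hv fun g h1 h2 => ?_
  have := h (testC g h1 h2)
  simpa using this

lemma integral_fourierInv_mul (f : Lp ℂ 2 (volume : Measure E3)) (ψ : 𝓢(E3, ℂ)) :
    ∫ ξ, ψ ξ * (𝓕⁻ f : Lp ℂ 2 (volume : Measure E3)) ξ = ∫ x, (𝓕⁻ ψ) x * f x := by
  have h := congrArg (fun T => T ψ) (Lp.fourierInv_toTemperedDistribution_eq f)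
  simp only [TemperedDistribution.fourierInv_apply, Lp.toTemperedDistribution_apply,
    smul_eq_mul] at h
  exact h.symm

lemma locallyIntegrable_Lp (f : Lp ℂ 2 (volume : Measure E3)) : LocallyIntegrable f :=
  (Lp.memLp f).locallyIntegrable one_le_two

/-- The `L²` inverse Fourier transform agrees with the integral on `L¹ ∩ L²`. -/
lemma fourierInv_toLp_ae {h : E3 → ℂ} (h1 : Integrable h) (h2 : MemLp h 2) :
    (𝓕⁻ (h2.toLp h) : Lp ℂ 2 (volume : Measure E3)) =ᵐ[volume] 𝓕⁻ h := by
  have hcont : Continuous (𝓕⁻ h) := by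
    have : 𝓕⁻ h = fun x => 𝓕 h (-x) := by ext x; rw [Real.fourierInv_eq_fourier_neg]
    rw [this]
    exact (VectorFourier.fourierIntegral_continuous Real.continuous_fourierChar
      (by exact (continuous_inner : Continuous fun p : E3 × E3 => ⟪p.1, p.2⟫)) h1).comp continuous_neg
  refine ae_eq_of_integral_schwartz (locallyIntegrable_Lp _) hcont.locallyIntegrable fun ψ => ?_
  rw [integral_fourierInv_mul]
  have e1 : ∫ x, (𝓕⁻ ψ) x * (h2.toLp h) x = ∫ x, (𝓕⁻ ψ) x * h x :=
    integral_congr_ae (by filter_upwards [h2.coeFn_toLp] with x hx; rw [hx])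
  rw [e1]
  -- The multiplication formula `∫ ψ̂ h = ∫ ψ ĥ`, taken with the form `-⟨x, ξ⟩` so that it concerns
  -- inverse transforms.
  have key := VectorFourier.integral_fourierIntegral_smul_eq_flip (μ := volume) (ν := volume)
    (L := -(innerₗ E3)) (f := (ψ : E3 → ℂ)) (g := h)
    Real.continuous_fourierChar (by
      simp only [LinearMap.neg_apply]
      exact (continuous_inner.neg : Continuous fun p : E3 × E3 => -(⟪p.1, p.2⟫)))
    ψ.integrable h1
  have hA : ∀ x, (𝓕⁻ ψ) x = VectorFourier.fourierIntegral Real.fourierChar volume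
      (-(innerₗ E3)) (ψ : E3 → ℂ) x := by
    intro x
    rw [SchwartzMap.fourierInv_coe]; rfl
  have hB : ∀ x, (𝓕⁻ h) x = VectorFourier.fourierIntegral Real.fourierChar volume
      (-(innerₗ E3)).flip h x := by
    intro x
    rw [Real.fourierInv_eq, VectorFourier.fourierIntegral]
    congr 1; ext1 y
    simp [real_inner_comm]
  simp_rw [hA, hB]
  simpa only [smul_eq_mul] using key

/-- A real square integrable function as an element of `L²(ℝ³; ℂ)`. -/
def cplx (f : E3 → ℝ) (hf : MemLp f 2) : Lp ℂ 2 (volume : Measure E3) :=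
  (hf.ofReal (K := ℂ)).toLp

lemma coeFn_cplx {f : E3 → ℝ} (hf : MemLp f 2) : cplx f hf =ᵐ[volume] fun x => (f x : ℂ) :=
  (hf.ofReal (K := ℂ)).coeFn_toLp

/-- The `L²` Fourier transform of a real square integrable function. -/
def hatL2 (f : E3 → ℝ) (hf : MemLp f 2) : Lp ℂ 2 (volume : Measure E3) := 𝓕 (cplx f hf)

lemma toComplex_toLp (φ : 𝓢(E3, ℝ)) : (toComplex φ).toLp 2 = cplx φ (φ.memLp 2 volume) := by
  refine Lp.ext ?_
  filter_upwards [(toComplex φ).coeFn_toLp 2 volume, coeFn_cplx (φ.memLp 2 volume)] with x h1 h2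
  rw [h1, h2]; rfl

lemma hatL2_schwartz (φ : 𝓢(E3, ℝ)) :
    hatL2 φ (φ.memLp 2 volume) =ᵐ[volume] (𝓕 (toComplex φ) : 𝓢(E3, ℂ)) := by
  rw [hatL2, ← toComplex_toLp, SchwartzMap.toLp_fourier_eq]
  exact (𝓕 (toComplex φ)).coeFn_toLp 2 volume

/-- The symbol `(2π|ξ|)^σ`. -/
def sym (σ : ℝ) (ξ : E3) : ℝ := (2 * Real.pi * ‖ξ‖) ^ σ

lemma sym_nonneg (σ : ℝ) (ξ : E3) : 0 ≤ sym σ ξ := by unfold sym; positivity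

lemma measurable_sym (σ : ℝ) : Measurable (sym σ) := by unfold sym; fun_prop

/-- A real power of the frequency is dominated by a polynomial, which Schwartz decay can absorb. -/
lemma sym_le {σ : ℝ} (hσ : 0 ≤ σ) {N : ℕ} (hN : σ ≤ N) (ξ : E3) :
    sym σ ξ ≤ 1 + (2 * Real.pi * ‖ξ‖) ^ N := by
  have h0 : 0 ≤ 2 * Real.pi * ‖ξ‖ := by positivity
  unfold sym
  rcases le_total (2 * Real.pi * ‖ξ‖) 1 with h | h
  · have := Real.rpow_le_one h0 h hσ
    have : (0 : ℝ) ≤ (2 * Real.pi * ‖ξ‖) ^ N := by positivity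
    linarith
  · have := Real.rpow_le_rpow_of_exponent_le h hN
    rw [Real.rpow_natCast] at this
    linarith

lemma norm_sym (σ : ℝ) (ξ : E3) : ‖((sym σ ξ : ℝ) : ℂ)‖ = sym σ ξ := by
  rw [Complex.norm_real, Real.norm_of_nonneg (sym_nonneg _ _)]

lemma bounded_sym_mul_schwartz {σ : ℝ} (hσ : 0 ≤ σ) (ψ : 𝓢(E3, ℂ)) :
    ∃ C, 0 ≤ C ∧ ∀ ξ, sym σ ξ * ‖ψ ξ‖ ≤ C := by
  obtain ⟨N, hN⟩ := exists_nat_ge σ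
  obtain ⟨C0, hC0, h0⟩ := ψ.decay 0 0
  obtain ⟨C1, hC1, h1⟩ := ψ.decay N 0
  refine ⟨C0 + (2 * Real.pi) ^ N * C1, by positivity, fun ξ => ?_⟩
  have h0 := h0 ξ
  have h1 := h1 ξ
  simp only [pow_zero, one_mul, norm_iteratedFDeriv_zero] at h0 h1
  calc sym σ ξ * ‖ψ ξ‖ ≤ (1 + (2 * Real.pi * ‖ξ‖) ^ N) * ‖ψ ξ‖ := by
        gcongr; exact sym_le hσ hN ξ
    _ = ‖ψ ξ‖ + (2 * Real.pi) ^ N * (‖ξ‖ ^ N * ‖ψ ξ‖) := by rw [mul_pow]; ring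
    _ ≤ _ := by gcongr

lemma aestronglyMeasurable_sym_mul (σ : ℝ) {ψ : E3 → ℂ} (hψ : AEStronglyMeasurable ψ) :
    AEStronglyMeasurable (fun ξ => ((sym σ ξ : ℝ) : ℂ) * ψ ξ) :=
  ((Complex.measurable_ofReal.comp (measurable_sym σ)).aestronglyMeasurable).mul hψ

lemma integrable_sym_mul {σ : ℝ} (hσ : 0 ≤ σ) (ψ : 𝓢(E3, ℂ)) :
    Integrable (fun ξ => ((sym σ ξ : ℝ) : ℂ) * ψ ξ) := by
  obtain ⟨N, hN⟩ := exists_nat_ge σ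
  refine ((ψ.integrable.norm (μ := volume)).add ((ψ.integrable_pow_mul volume N).const_mul
    ((2 * Real.pi) ^ N))).mono' (aestronglyMeasurable_sym_mul σ ψ.continuous.aestronglyMeasurable)
    (ae_of_all _ fun ξ => ?_)
  rw [norm_mul, norm_sym]
  calc sym σ ξ * ‖ψ ξ‖ ≤ (1 + (2 * Real.pi * ‖ξ‖) ^ N) * ‖ψ ξ‖ := by
        gcongr; exact sym_le hσ hN ξ
    _ = ‖ψ ξ‖ + (2 * Real.pi) ^ N * (‖ξ‖ ^ N * ‖ψ ξ‖) := by rw [mul_pow]; ring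

lemma memLp_two_sym_mul {σ : ℝ} (hσ : 0 ≤ σ) (ψ : 𝓢(E3, ℂ)) :
    MemLp (fun ξ => ((sym σ ξ : ℝ) : ℂ) * ψ ξ) 2 := by
  obtain ⟨C, hC, hb⟩ := bounded_sym_mul_schwartz hσ ψ
  rw [memLp_two_iff_integrable_sq_norm
    (aestronglyMeasurable_sym_mul σ ψ.continuous.aestronglyMeasurable)]
  refine ((integrable_sym_mul hσ ψ).norm.const_mul C).mono'
    ((aestronglyMeasurable_sym_mul σ ψ.continuous.aestronglyMeasurable).norm.pow 2)
    (ae_of_all _ fun ξ => ?_)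
  rw [Real.norm_of_nonneg (by positivity), sq]
  gcongr
  rw [norm_mul, norm_sym]
  exact hb ξ

/-- Plancherel's formula for `Λ^σ`. -/
lemma integral_mul_Lam_eq {σ : ℝ} (hσ : 0 ≤ σ) {f : E3 → ℝ} (hf : MemLp f 2) (φ : 𝓢(E3, ℝ)) :
    ∫ x, f x * Lam σ φ x = (∫ ξ, (starRingEnd ℂ) (hatL2 f hf ξ) *
      (((sym σ ξ : ℝ) : ℂ) * (𝓕 (toComplex φ) : 𝓢(E3, ℂ)) ξ)).re := by
  set ψ : 𝓢(E3, ℂ) := 𝓕 (toComplex φ)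
  set h : E3 → ℂ := fun ξ => ((sym σ ξ : ℝ) : ℂ) * ψ ξ
  have h1 : Integrable h := integrable_sym_mul hσ ψ
  have h2 : MemLp h 2 := memLp_two_sym_mul hσ ψ
  -- Since `h` is both integrable and square integrable, its `L²` inverse transform agrees almost
  -- everywhere with the integral defining `Lam`.
  have hin := Lp.inner_fourier_eq (cplx f hf) (𝓕⁻ (h2.toLp h))
  rw [FourierTransform.fourier_fourierInv_eq, L2.inner_def, L2.inner_def] at hin
  have e1 : ∫ ξ, (starRingEnd ℂ) (hatL2 f hf ξ) * h ξ =
      ∫ ξ, inner ℂ ((𝓕 (cplx f hf) : Lp ℂ 2 (volume : Measure E3)) ξ) ((h2.toLp h) ξ) := by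
    refine integral_congr_ae ?_
    filter_upwards [h2.coeFn_toLp] with ξ hξ
    rw [hξ, RCLike.inner_apply, mul_comm]; rfl
  have e2 : ∫ x, inner ℂ (cplx f hf x) ((𝓕⁻ (h2.toLp h) : Lp ℂ 2 (volume : Measure E3)) x) =
      ∫ x, (f x : ℂ) * 𝓕⁻ h x := by
    refine integral_congr_ae ?_
    filter_upwards [coeFn_cplx hf, fourierInv_toLp_ae h1 h2] with x hx hx2
    rw [hx, hx2, RCLike.inner_apply, mul_comm, Complex.conj_ofReal]
  rw [e1, hin, e2]
  have hint : Integrable fun x => (f x : ℂ) * 𝓕⁻ h x := by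
    have := L2.integrable_inner (𝕜 := ℂ) (cplx f hf) (𝓕⁻ (h2.toLp h))
    refine this.congr ?_
    filter_upwards [coeFn_cplx hf, fourierInv_toLp_ae h1 h2] with x hx hx2
    rw [hx, hx2, RCLike.inner_apply, mul_comm, Complex.conj_ofReal]
  rw [← RCLike.re_eq_complex_re, ← integral_re hint]
  congr 1; ext1 x
  rw [RCLike.re_eq_complex_re, Complex.re_ofReal_mul, Lam, fourier_ofReal]
  rfl

/-! ### Averaging as an operator on `L²` -/

section SmearL

variable {F : Type*} [NormedAddCommGroup F] [NormedSpace ℝ F] [CompleteSpace F]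
  {ρ : E3 → ℝ}

/-- Smearing as a linear map on `L²`. -/
def IsMollifier.smearₗ (hρ : IsMollifier ρ) :
    Lp F 2 (volume : Measure E3) →ₗ[ℝ] Lp F 2 (volume : Measure E3) where
  toFun f := (hρ.memLp_two_smear (Lp.memLp f)).toLp
  map_add' f g := by
    refine Lp.ext ?_
    filter_upwards [(hρ.memLp_two_smear (Lp.memLp (f + g))).coeFn_toLp,
      (hρ.memLp_two_smear (Lp.memLp f)).coeFn_toLp,
      (hρ.memLp_two_smear (Lp.memLp g)).coeFn_toLp,
      Lp.coeFn_add (hρ.memLp_two_smear (Lp.memLp f)).toLp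
        (hρ.memLp_two_smear (Lp.memLp g)).toLp] with x h1 h2 h3 h4
    rw [h1, h4, Pi.add_apply, h2, h3, smear_congr_ae (Lp.coeFn_add f g),
      hρ.smear_add ((Lp.memLp f).locallyIntegrable one_le_two)
        ((Lp.memLp g).locallyIntegrable one_le_two)]
    rfl
  map_smul' c f := by
    refine Lp.ext ?_
    filter_upwards [(hρ.memLp_two_smear (Lp.memLp (c • f))).coeFn_toLp,
      (hρ.memLp_two_smear (Lp.memLp f)).coeFn_toLp,
      Lp.coeFn_smul c (hρ.memLp_two_smear (Lp.memLp f)).toLp] with x h1 h2 h4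
    rw [h1, RingHom.id_apply, h4, Pi.smul_apply, h2, smear_congr_ae (Lp.coeFn_smul c f),
      smear_smul]
    rfl

lemma IsMollifier.coeFn_smearₗ (hρ : IsMollifier ρ) (f : Lp F 2 (volume : Measure E3)) :
    hρ.smearₗ f =ᵐ[volume] smear ρ f :=
  (hρ.memLp_two_smear (Lp.memLp f)).coeFn_toLp

lemma IsMollifier.norm_smearₗ_le (hρ : IsMollifier ρ) (f : Lp F 2 (volume : Measure E3)) :
    ‖hρ.smearₗ f‖ ≤ 1 * ‖f‖ := by
  rw [one_mul, Lp.norm_def, Lp.norm_def]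
  refine ENNReal.toReal_mono (Lp.memLp f).2.ne ?_
  rw [eLpNorm_congr_ae (hρ.coeFn_smearₗ f)]
  simpa using hρ.eLpNorm_smear_le one_le_two (Lp.memLp f).1

/-- Smearing as a bounded operator on `L²`. -/
def IsMollifier.smearL (hρ : IsMollifier ρ) :
    Lp F 2 (volume : Measure E3) →L[ℝ] Lp F 2 (volume : Measure E3) :=
  hρ.smearₗ.mkContinuous 1 hρ.norm_smearₗ_le

lemma IsMollifier.coeFn_smearL (hρ : IsMollifier ρ) (f : Lp F 2 (volume : Measure E3)) :
    hρ.smearL f =ᵐ[volume] smear ρ f :=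
  hρ.coeFn_smearₗ f

lemma IsMollifier.smearL_toLp (hρ : IsMollifier ρ) {f : E3 → F} (hf : MemLp f 2) :
    hρ.smearL (hf.toLp f) = (hρ.memLp_two_smear hf).toLp (smear ρ f) := by
  refine Lp.ext ?_
  filter_upwards [hρ.coeFn_smearL (hf.toLp f), (hρ.memLp_two_smear hf).coeFn_toLp] with x h1 h2
  rw [h1, h2, smear_congr_ae hf.coeFn_toLp]

lemma IsMollifier.smearL_compLp {G : Type*} [NormedAddCommGroup G] [NormedSpace ℝ G]
    [CompleteSpace G]
    (hρ : IsMollifier ρ) (L : F →L[ℝ] G) (f : Lp F 2 (volume : Measure E3)) :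
    L.compLp (hρ.smearL f) = hρ.smearL (L.compLp f) := by
  refine Lp.ext ?_
  filter_upwards [hρ.coeFn_smearL f, hρ.coeFn_smearL (L.compLp f),
    L.coeFn_compLp (hρ.smearL f)] with x h1 h2 h3
  rw [h3, h1, h2, smear_congr_ae (L.coeFn_compLp' f), smear_apply, smear_apply,
    ← ContinuousLinearMap.integral_comp_comm _
      (hρ.integrable_shift ((Lp.memLp f).locallyIntegrable one_le_two) x)]
  simp

lemma tendsto_smearL_mol (f : Lp F 2 (volume : Measure E3)) :
    Tendsto (fun n => (isMollifier_mol n).smearL f) atTop (𝓝 f) := by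
  rw [Lp.tendsto_Lp_iff_tendsto_eLpNorm']
  have h := tendsto_eLpNorm_smear_sub one_le_two (f := f) (by simpa using Lp.memLp f)
    isMollifier_mol tendsto_support_mol
  refine h.congr fun n => ?_
  rw [ENNReal.ofReal_ofNat]
  refine eLpNorm_congr_ae ?_
  filter_upwards [(isMollifier_mol n).coeFn_smearL f] with x h1
  rw [Pi.sub_apply, ← h1]; rfl

end SmearL

lemma IsMollifier.inner_smearL {F : Type*} [NormedAddCommGroup F] [InnerProductSpace ℝ F]
    [CompleteSpace F] {ρ : E3 → ℝ} (hρ : IsMollifier ρ) (f g : Lp F 2 (volume : Measure E3)) :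
    ⟪hρ.smearL f, g⟫ = ⟪f, hρ.smearL g⟫ := by
  rw [L2.inner_def, L2.inner_def]
  have e1 : ∫ x, ⟪hρ.smearL f x, g x⟫ = ∫ x, ⟪smear ρ f x, g x⟫ :=
    integral_congr_ae (by filter_upwards [hρ.coeFn_smearL f] with x h; rw [h])
  have e2 : ∫ x, ⟪f x, hρ.smearL g x⟫ = ∫ x, ⟪f x, smear ρ g x⟫ :=
    integral_congr_ae (by filter_upwards [hρ.coeFn_smearL g] with x h; rw [h])
  rw [e1, e2, hρ.integral_inner_smear (Lp.memLp f) (Lp.memLp g)]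

/-! ### Averaging on the Fourier side -/

section KernelTransform

variable {ρ : E3 → ℝ}

/-- A mollifier as a Schwartz function. -/
def IsMollifier.schwartz (hρ : IsMollifier ρ) : 𝓢(E3, ℝ) := hρ.compact.toSchwartzMap hρ.smooth

/-- The (real valued) Fourier transform of an even kernel. -/
def kerHat (ρ : E3 → ℝ) (ξ : E3) : ℝ := smear ρ (fun t => Real.cos (2 * Real.pi * ⟪t, ξ⟫)) 0

lemma kerHat_eq (ρ : E3 → ℝ) (ξ : E3) :
    kerHat ρ ξ = ∫ t, ρ t * Real.cos (2 * Real.pi * ⟪t, ξ⟫) := by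
  simp [kerHat, smear_apply]

/-- The sine part is the integral of an odd function and vanishes. -/
lemma IsMollifier.fourier_schwartz (hρ : IsMollifier ρ) (ξ : E3) :
    (𝓕 (toComplex hρ.schwartz) : 𝓢(E3, ℂ)) ξ = (kerHat ρ ξ : ℂ) := by
  have hi : Integrable fun v : E3 => Real.fourierChar (-⟪v, ξ⟫) • ((ρ v : ℝ) : ℂ) := by
    have := (Real.fourierIntegral_convergent_iff (V := E3) (μ := volume)
      (f := fun v => ((ρ v : ℝ) : ℂ)) ξ).2 hρ.integrable.ofReal
    exact this
  have e : (𝓕 (toComplex hρ.schwartz) : 𝓢(E3, ℂ)) ξ =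
      ∫ v : E3, Real.fourierChar (-⟪v, ξ⟫) • ((ρ v : ℝ) : ℂ) := by
    rw [SchwartzMap.fourier_coe, Real.fourier_eq]; rfl
  have hpt : ∀ v : E3, Real.fourierChar (-⟪v, ξ⟫) • ((ρ v : ℝ) : ℂ) =
      ⟨ρ v * Real.cos (2 * Real.pi * ⟪v, ξ⟫), - (ρ v * Real.sin (2 * Real.pi * ⟪v, ξ⟫))⟩ := by
    intro v
    rw [Circle.smul_def, Real.fourierChar_apply, smul_eq_mul]
    have : (((2 * Real.pi * -⟪v, ξ⟫ : ℝ) : ℂ)) * Complex.I =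
      ((-(2 * Real.pi * ⟪v, ξ⟫) : ℝ) : ℂ) * Complex.I := by push_cast; ring
    rw [this]
    apply Complex.ext
    · rw [Complex.re_mul_ofReal, Complex.exp_ofReal_mul_I_re, Real.cos_neg]; ring
    · rw [Complex.im_mul_ofReal, Complex.exp_ofReal_mul_I_im, Real.sin_neg]; ring
  rw [e]
  apply Complex.ext
  · rw [← RCLike.re_eq_complex_re, ← integral_re hi, kerHat_eq]
    simp_rw [hpt]; simp
  · rw [← RCLike.im_eq_complex_im, ← integral_im hi]
    simp_rw [hpt]
    simp only [RCLike.im_eq_complex_im, Complex.ofReal_im]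
    have h := integral_neg_eq_self (fun v : E3 => -(ρ v * Real.sin (2 * Real.pi * ⟪v, ξ⟫))) volume
    simp only [hρ.even, inner_neg_left, mul_neg, Real.sin_neg, neg_neg] at h
    rw [integral_neg] at h ⊢
    linarith

lemma IsMollifier.abs_kerHat_le (hρ : IsMollifier ρ) (ξ : E3) : |kerHat ρ ξ| ≤ 1 := by
  rw [kerHat_eq, ← hρ.integral_eq, ← Real.norm_eq_abs]
  refine norm_integral_le_of_norm_le hρ.integrable (ae_of_all _ fun t => ?_)
  rw [norm_mul, Real.norm_of_nonneg (hρ.nonneg t), Real.norm_eq_abs]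
  exact mul_le_of_le_one_right (hρ.nonneg t) (Real.abs_cos_le_one _)

lemma IsMollifier.continuous_kerHat (hρ : IsMollifier ρ) : Continuous (kerHat ρ) := by
  have : kerHat ρ = fun ξ => ((𝓕 (toComplex hρ.schwartz) : 𝓢(E3, ℂ)) ξ).re := by
    ext ξ; rw [hρ.fourier_schwartz]; simp
  rw [this]
  exact Complex.continuous_re.comp (SchwartzMap.continuous _)

/-- The transform at `ξ` is an average of a cosine at the origin, where the cosine equals 1; the
definition of `kerHat` through `smear` is chosen for this. -/
lemma tendsto_kerHat_mol (ξ : E3) : Tendsto (fun n => kerHat (mol n) ξ) atTop (𝓝 1) := by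
  have h := ContDiffBump.convolution_tendsto_right (μ := volume) (φ := bumpAt) (l := atTop)
    (g := fun _ t => Real.cos (2 * Real.pi * ⟪t, ξ⟫)) (k := fun _ : ℕ => (0 : E3)) (x₀ := 0)
    (z₀ := 1) tendsto_bumpAt_rOut
    (Eventually.of_forall fun n => (by fun_prop : Continuous fun t : E3 =>
      Real.cos (2 * Real.pi * ⟪t, ξ⟫)).aestronglyMeasurable)
    (by
      have : Continuous fun t : E3 => Real.cos (2 * Real.pi * ⟪t, ξ⟫) := by fun_prop
      have h2 := this.tendsto 0
      simp only [inner_zero_left, mul_zero, Real.cos_zero] at h2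
      exact h2.comp tendsto_snd)
    tendsto_const_nhds
  exact h

/-- Multiplication by a bounded function on `L²`. -/
def mulOp (m : E3 → ℂ) (hm : MemLp m ⊤) :
    Lp ℂ 2 (volume : Measure E3) →L[ℂ] Lp ℂ 2 (volume : Measure E3) :=
  (ContinuousLinearMap.mul ℂ ℂ).holderL volume ⊤ 2 2 (hm.toLp m)

lemma coeFn_mulOp {m : E3 → ℂ} (hm : MemLp m ⊤) (f : Lp ℂ 2 (volume : Measure E3)) :
    mulOp m hm f =ᵐ[volume] fun ξ => m ξ * f ξ := by
  have h := (ContinuousLinearMap.mul ℂ ℂ).coeFn_holder (r := 2) (hm.toLp m) f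
  filter_upwards [h, hm.coeFn_toLp] with x h1 h2
  rw [← h2]; exact h1

lemma IsMollifier.memLp_kerHat (hρ : IsMollifier ρ) :
    MemLp (fun ξ => (kerHat ρ ξ : ℂ)) ⊤ (volume : Measure E3) := by
  refine memLp_top_of_bound (Complex.continuous_ofReal.comp
    hρ.continuous_kerHat).aestronglyMeasurable 1 (ae_of_all _ fun ξ => ?_)
  rw [Complex.norm_real]; exact hρ.abs_kerHat_le ξ

lemma IsMollifier.smear_schwartz (hρ : IsMollifier ρ) (Φ : 𝓢(E3, ℂ)) (x : E3) :
    smear ρ Φ x = SchwartzMap.convolution (ContinuousLinearMap.mul ℂ ℂ)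
      (toComplex hρ.schwartz) Φ x := by
  rw [SchwartzMap.convolution_apply, smear_apply]
  simp only [convolution, ContinuousLinearMap.mul_apply', toComplex_apply, Complex.real_smul]
  rfl

/-- Smearing is multiplication by `kerHat ρ` on the Fourier side. -/
lemma IsMollifier.fourier_smearL (hρ : IsMollifier ρ) (f : Lp ℂ 2 (volume : Measure E3)) :
    𝓕 (hρ.smearL f) = mulOp _ hρ.memLp_kerHat (𝓕 f) := by
  -- Both sides are continuous in `f`, so Schwartz functions suffice, and for them this is the
  -- convolution theorem.
  refine DenseRange.induction_on (p := fun f : Lp ℂ 2 (volume : Measure E3) =>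
    𝓕 (hρ.smearL f) = mulOp _ hρ.memLp_kerHat (𝓕 f))
    (SchwartzMap.denseRange_toLpCLM (F := ℂ) (E := E3) (p := 2) (μ := volume)
      ENNReal.ofNat_ne_top) f ?_ fun Φ => ?_
  · exact isClosed_eq ((FourierTransform.continuous_fourier).comp hρ.smearL.continuous)
      ((mulOp _ hρ.memLp_kerHat).continuous.comp FourierTransform.continuous_fourier)
  · change 𝓕 (hρ.smearL (Φ.toLp 2)) = mulOp _ hρ.memLp_kerHat (𝓕 (Φ.toLp 2))
    set Ψ := SchwartzMap.convolution (ContinuousLinearMap.mul ℂ ℂ) (toComplex hρ.schwartz) Φ with hΨ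
    have e : hρ.smearL (Φ.toLp 2) = Ψ.toLp 2 := by
      refine Lp.ext ?_
      filter_upwards [hρ.coeFn_smearL (Φ.toLp 2), Ψ.coeFn_toLp 2 volume] with x h1 h2
      rw [h1, h2, smear_congr_ae (Φ.coeFn_toLp 2 volume), hρ.smear_schwartz]
    rw [e, SchwartzMap.toLp_fourier_eq, SchwartzMap.toLp_fourier_eq]
    refine Lp.ext ?_
    filter_upwards [(𝓕 Ψ).coeFn_toLp 2 volume, (𝓕 Φ).coeFn_toLp 2 volume,
      coeFn_mulOp hρ.memLp_kerHat ((𝓕 Φ).toLp 2)] with x h1 h2 h3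
    rw [h1, h3, h2, hΨ, SchwartzMap.fourier_convolution, ← hρ.fourier_schwartz]
    rfl

end KernelTransform

/-- The `L²` Fourier transform of the `j`-th component, as a real linear map. -/
def hatL (j : Fin 3) : L2 →L[ℝ] Lp ℂ 2 (volume : Measure E3) :=
  ((FourierTransform.fourierCLM ℂ (Lp ℂ 2 (volume : Measure E3))).restrictScalars ℝ) ∘L
    (coordC j).compLpL 2 volume

lemma hatL_apply (j : Fin 3) (f : L2) : hatL j f = 𝓕 (compC j f) := rfl

lemma compC_smearL {ρ : E3 → ℝ} (hρ : IsMollifier ρ) (j : Fin 3) (f : L2) :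
    compC j (hρ.smearL f) = hρ.smearL (compC j f) := hρ.smearL_compLp (coordC j) f

lemma hatL_smearL {ρ : E3 → ℝ} (hρ : IsMollifier ρ) (j : Fin 3) (f : L2) :
    hatL j (hρ.smearL f) =ᵐ[volume] fun ξ => (kerHat ρ ξ : ℂ) * hatL j f ξ := by
  rw [hatL_apply, compC_smearL, hρ.fourier_smearL]
  exact coeFn_mulOp hρ.memLp_kerHat _

/-- The component transforms act between real Hilbert spaces, so pairings use the real part of the
Hermitian product. -/
lemma real_inner_Lp_complex (f g : Lp ℂ 2 (volume : Measure E3)) :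
    ⟪f, g⟫ = (∫ ξ, (starRingEnd ℂ) (f ξ) * g ξ).re := by
  have h := L2.integrable_inner (𝕜 := ℂ) f g
  simp only [RCLike.inner_apply'] at h
  rw [L2.inner_def, ← RCLike.re_eq_complex_re, ← integral_re h]
  exact integral_congr_ae (ae_of_all _ fun ξ =>
    (Complex.inner _ _).trans (by rw [mul_comm]; rfl))

lemma real_inner_fourier (f g : Lp ℂ 2 (volume : Measure E3)) : ⟪𝓕 f, 𝓕 g⟫ = ⟪f, g⟫ := by
  have h := Lp.inner_fourier_eq f g
  rw [L2.inner_def, L2.inner_def] at h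
  simp only [RCLike.inner_apply'] at h
  rw [real_inner_Lp_complex, real_inner_Lp_complex, h]

/-! ### The regularized operators `ρ ⋆ Λ^σ` -/

section DiffOp

variable {ρ : E3 → ℝ}

/-- The transform of a test function decays faster than any power. Hence the regularized symbol is
bounded, and `ρ ⋆ Λ^σ` is a bounded operator on all of `L²`. -/
lemma IsMollifier.memLp_sym_kerHat (hρ : IsMollifier ρ) {σ : ℝ} (hσ : 0 ≤ σ) :
    MemLp (fun ξ => ((sym σ ξ : ℝ) : ℂ) * (kerHat ρ ξ : ℂ)) ⊤ (volume : Measure E3) := by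
  obtain ⟨C, hC, hb⟩ := bounded_sym_mul_schwartz hσ (𝓕 (toComplex hρ.schwartz) : 𝓢(E3, ℂ))
  refine memLp_top_of_bound (aestronglyMeasurable_sym_mul σ (Complex.continuous_ofReal.comp
    hρ.continuous_kerHat).aestronglyMeasurable) C (ae_of_all _ fun ξ => ?_)
  rw [norm_mul, norm_sym, ← hρ.fourier_schwartz]; exact hb ξ

/-- The regularized operator `ρ ⋆ Λ^σ` on vector fields. -/
def IsMollifier.diffOp (hρ : IsMollifier ρ) {σ : ℝ} (hσ : 0 ≤ σ) : L2 →L[ℝ] L2 :=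
  ∑ j : Fin 3, (ContinuousLinearMap.adjoint (hatL j)) ∘L
    ((mulOp _ (hρ.memLp_sym_kerHat hσ)).restrictScalars ℝ) ∘L hatL j

lemma IsMollifier.inner_diffOp (hρ : IsMollifier ρ) {σ : ℝ} (hσ : 0 ≤ σ) (f g : L2) :
    ⟪hρ.diffOp hσ f, g⟫ =
      ∑ j : Fin 3, ⟪mulOp _ (hρ.memLp_sym_kerHat hσ) (hatL j f), hatL j g⟫ := by
  simp [diffOp, sum_inner, ContinuousLinearMap.adjoint_inner_left]

lemma coe_compC (j : Fin 3) (f : L2) : compC j f =ᵐ[volume] fun x => ((f x j : ℝ) : ℂ) :=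
  (coordC j).coeFn_compLp' f

lemma memLp_coord {f : E3 → E3} {p : ℝ≥0∞} (hf : MemLp f p) (j : Fin 3) :
    MemLp (fun x => f x j) p := (EuclideanSpace.proj (𝕜 := ℝ) j).comp_memLp' hf

lemma compC_eq_cplx (j : Fin 3) (f : L2) :
    compC j f = cplx (fun x => f x j) (memLp_coord (Lp.memLp f) j) := by
  refine Lp.ext ?_
  filter_upwards [coe_compC j f, coeFn_cplx (memLp_coord (Lp.memLp f) j)] with x h1 h2
  rw [h1, h2]

lemma Lam_ae {σ : ℝ} (hσ : 0 ≤ σ) (φ : 𝓢(E3, ℝ)) :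
    Lam σ φ =ᵐ[volume] fun x => ((𝓕⁻ ((memLp_two_sym_mul hσ (𝓕 (toComplex φ))).toLp _) :
      Lp ℂ 2 (volume : Measure E3)) x).re := by
  filter_upwards [fourierInv_toLp_ae (integrable_sym_mul hσ (𝓕 (toComplex φ)))
    (memLp_two_sym_mul hσ (𝓕 (toComplex φ)))] with x hx
  rw [hx, Lam, fourier_ofReal]
  rfl

lemma memLp_Lam {σ : ℝ} (hσ : 0 ≤ σ) (φ : 𝓢(E3, ℝ)) : MemLp (Lam σ φ) 2 :=
  MemLp.ae_eq (Lam_ae hσ φ).symm (Complex.reCLM.comp_memLp' (Lp.memLp _))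

/-- A test function as a Schwartz function. -/
abbrev testS (g : E3 → ℝ) (h1 : ContDiff ℝ ∞ g) (h2 : HasCompactSupport g) : 𝓢(E3, ℝ) :=
  h2.toSchwartzMap h1

lemma contDiff_coord {φ : E3 → E3} (h1 : ContDiff ℝ ∞ φ) (j : Fin 3) :
    ContDiff ℝ ∞ fun x => φ x j := (EuclideanSpace.proj (𝕜 := ℝ) j).contDiff.comp h1

lemma hasCompactSupport_coord {φ : E3 → E3} (h2 : HasCompactSupport φ) (j : Fin 3) :
    HasCompactSupport fun x => φ x j :=
  h2.comp_left (g := fun v : E3 => v j) rfl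

lemma integrable_mul_Lam {σ : ℝ} (hσ : 0 ≤ σ) {f : E3 → ℝ} (hf : MemLp f 2) (φ : 𝓢(E3, ℝ)) :
    Integrable fun x => f x * Lam σ φ x := hf.integrable_mul (memLp_Lam hσ φ)

lemma inner_LamVec (σ : ℝ) (φ : E3 → E3) (v x : E3) :
    ⟪v, LamVec σ φ x⟫ = ∑ j, v j * Lam σ (fun y => φ y j) x := by
  simp [LamVec, PiLp.inner_apply, mul_comm]

lemma integrable_inner_LamVec {σ : ℝ} (hσ : 0 ≤ σ) (f : L2) {φ : E3 → E3}
    (h1 : ContDiff ℝ ∞ φ) (h2 : HasCompactSupport φ) :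
    Integrable fun x => ⟪f x, LamVec σ φ x⟫ := by
  simp_rw [inner_LamVec]
  exact integrable_finsetSum _ fun j _ => integrable_mul_Lam hσ (memLp_coord (Lp.memLp f) j)
    (testS _ (contDiff_coord h1 j) (hasCompactSupport_coord h2 j))

lemma integral_inner_LamVec {σ : ℝ} (hσ : 0 ≤ σ) (f : L2) {φ : E3 → E3}
    (h1 : ContDiff ℝ ∞ φ) (h2 : HasCompactSupport φ) :
    ∫ x, ⟪f x, LamVec σ φ x⟫ = ∑ j, (∫ ξ, (starRingEnd ℂ) (hatL j f ξ) *
      (((sym σ ξ : ℝ) : ℂ) * (𝓕 (toComplex (testS _ (contDiff_coord h1 j)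
        (hasCompactSupport_coord h2 j))) : 𝓢(E3, ℂ)) ξ)).re := by
  simp_rw [inner_LamVec]
  have hi : ∀ j, Integrable fun x => f x j * Lam σ (fun y => φ y j) x := fun j =>
    integrable_mul_Lam hσ (memLp_coord (Lp.memLp f) j)
      (testS _ (contDiff_coord h1 j) (hasCompactSupport_coord h2 j))
  rw [integral_finsetSum _ fun j _ => hi j]
  refine Finset.sum_congr rfl fun j _ => ?_
  have := integral_mul_Lam_eq hσ (memLp_coord (Lp.memLp f) j)
    (testS _ (contDiff_coord h1 j) (hasCompactSupport_coord h2 j))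
  rw [hatL_apply, compC_eq_cplx]
  exact this

lemma memLp_test {F : Type*} [NormedAddCommGroup F] [NormedSpace ℝ F] {φ : E3 → F}
    (h1 : ContDiff ℝ ∞ φ) (h2 : HasCompactSupport φ) (p : ℝ≥0∞) : MemLp φ p :=
  h1.continuous.memLp_of_hasCompactSupport h2

lemma hatL_test {φ : E3 → E3} (h1 : ContDiff ℝ ∞ φ) (h2 : HasCompactSupport φ) (j : Fin 3) :
    hatL j ((memLp_test h1 h2 2).toLp φ) =ᵐ[volume] (𝓕 (toComplex (testS _ (contDiff_coord h1 j)
        (hasCompactSupport_coord h2 j))) : 𝓢(E3, ℂ)) := by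
  have := hatL2_schwartz (testS _ (contDiff_coord h1 j) (hasCompactSupport_coord h2 j))
  refine EventuallyEq.trans (EventuallyEq.of_eq ?_) this
  rw [hatL_apply, hatL2]
  congr 2

/-- `ρ ⋆ Λ^σ` in the weak sense. -/
lemma IsMollifier.inner_diffOp_test (hρ : IsMollifier ρ) {σ : ℝ} (hσ : 0 ≤ σ) (f : L2)
    {φ : E3 → E3} (h1 : ContDiff ℝ ∞ φ) (h2 : HasCompactSupport φ) :
    ⟪hρ.diffOp hσ f, (memLp_test h1 h2 2).toLp φ⟫ = ∫ x, ⟪f x, LamVec σ (smear ρ φ) x⟫ := by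
  have k1 : ContDiff ℝ ∞ (smear ρ φ) := hρ.contDiff_smear h1.continuous.locallyIntegrable
  have k2 : HasCompactSupport (smear ρ φ) := hρ.hasCompactSupport_smear h2
  rw [integral_inner_LamVec hσ f k1 k2, hρ.inner_diffOp]
  refine Finset.sum_congr rfl fun j _ => ?_
  rw [real_inner_Lp_complex]
  congr 1
  refine integral_congr_ae ?_
  have e : hatL j ((memLp_test k1 k2 2).toLp (smear ρ φ)) =ᵐ[volume]
      fun ξ => (kerHat ρ ξ : ℂ) * hatL j ((memLp_test h1 h2 2).toLp φ) ξ := by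
    have := hatL_smearL hρ j ((memLp_test h1 h2 2).toLp φ)
    rwa [hρ.smearL_toLp] at this
  filter_upwards [e, hatL_test k1 k2 j, coeFn_mulOp (hρ.memLp_sym_kerHat hσ) (hatL j f)]
    with ξ a1 a2 a3
  rw [a3, ← a2, a1]
  simp only [map_mul, Complex.conj_ofReal]
  ring

lemma integrable_sq_hatL (j : Fin 3) (f : L2) : Integrable fun ξ => ‖hatL j f ξ‖ ^ 2 :=
  (Lp.memLp (hatL j f)).integrable_norm_pow two_ne_zero

/-- Pairing with the smeared field yields the square of the kernel transform. As a weight it lies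
between 0 and 1, so the form is nonnegative and never exceeds the true dissipation. -/
lemma IsMollifier.inner_diffOp_smearL (hρ : IsMollifier ρ) {σ : ℝ} (hσ : 0 ≤ σ) (f : L2) :
    ⟪hρ.diffOp hσ f, hρ.smearL f⟫ =
      ∑ j, ∫ ξ, kerHat ρ ξ ^ 2 * (sym σ ξ * ‖hatL j f ξ‖ ^ 2) := by
  rw [hρ.inner_diffOp]
  refine Finset.sum_congr rfl fun j _ => ?_
  rw [real_inner_Lp_complex, ← Complex.ofReal_re (∫ ξ, _), ← integral_complex_ofReal]
  congr 1
  refine integral_congr_ae ?_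
  filter_upwards [hatL_smearL hρ j f, coeFn_mulOp (hρ.memLp_sym_kerHat hσ) (hatL j f)]
    with ξ a1 a2
  rw [a1, a2]
  simp only [map_mul, Complex.conj_ofReal]
  push_cast
  rw [← Complex.conj_mul']
  ring

/-- Vector test functions are dense. -/
lemma eq_zero_of_inner_test {f : L2} (h : ∀ (φ : E3 → E3) (h1 : ContDiff ℝ ∞ φ)
    (h2 : HasCompactSupport φ), ⟪f, (memLp_test h1 h2 2).toLp φ⟫ = 0) : f = 0 := by
  have hd := Lp.dense_hasCompactSupport_contDiff (E := E3) (F := E3)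
    (μ := (volume : Measure E3)) (p := 2) ENNReal.ofNat_ne_top
  refine hd.eq_zero_of_inner_left (𝕜 := ℝ) ?_
  rintro g ⟨φ, hgφ, h2, h1⟩
  have e : (memLp_test h1 h2 2).toLp φ = g := by
    refine Lp.ext ?_
    filter_upwards [(memLp_test h1 h2 2).coeFn_toLp, hgφ] with x a b
    rw [a, b]
  rw [← e]; exact h φ h1 h2

/-- `Λ^σ` is injective on `L²`. -/
lemma eq_zero_of_LamVec {σ : ℝ} (hσ : 0 ≤ σ) {f : L2}
    (h : ∀ φ : E3 → E3, ContDiff ℝ ∞ φ → HasCompactSupport φ →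
      ∫ x, ⟪f x, LamVec σ φ x⟫ = 0) : f = 0 := by
  -- Smearing keeps test fields admissible, so every regularized operator kills `f`. The associated
  -- quadratic forms then vanish. At almost every frequency some kernel transform and the symbol are
  -- both nonzero, which forces the transform of `f` to vanish.
  have hz : ∀ n, (isMollifier_mol n).diffOp hσ f = 0 := fun n =>
    eq_zero_of_inner_test fun φ h1 h2 => by
      rw [IsMollifier.inner_diffOp_test _ _ _ h1 h2]
      exact h _ ((isMollifier_mol n).contDiff_smear h1.continuous.locallyIntegrable)
        ((isMollifier_mol n).hasCompactSupport_smear h2)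
  have hnn : ∀ n j ξ, 0 ≤ kerHat (mol n) ξ ^ 2 * (sym σ ξ * ‖hatL j f ξ‖ ^ 2) := fun n j ξ =>
    mul_nonneg (sq_nonneg _) (mul_nonneg (sym_nonneg _ _) (sq_nonneg _))
  have hint : ∀ n j, Integrable fun ξ => kerHat (mol n) ξ ^ 2 * (sym σ ξ * ‖hatL j f ξ‖ ^ 2) := by
    intro n j
    have hρ := isMollifier_mol n
    obtain ⟨C, hC, hb⟩ := bounded_sym_mul_schwartz hσ (𝓕 (toComplex hρ.schwartz) : 𝓢(E3, ℂ))
    refine ((integrable_sq_hatL j f).const_mul C).mono'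
      (((hρ.continuous_kerHat.pow 2).aestronglyMeasurable).mul
        ((measurable_sym σ).aestronglyMeasurable.mul
          ((Lp.aestronglyMeasurable _).norm.pow 2))) (ae_of_all _ fun ξ => ?_)
    rw [Real.norm_of_nonneg (hnn n j ξ), ← mul_assoc]
    gcongr
    have h1 := hb ξ
    rw [hρ.fourier_schwartz, Complex.norm_real, Real.norm_eq_abs] at h1
    have h2 := hρ.abs_kerHat_le ξ
    have h3 : 0 ≤ sym σ ξ := sym_nonneg _ _
    calc kerHat (mol n) ξ ^ 2 * sym σ ξ
        = |kerHat (mol n) ξ| * (sym σ ξ * |kerHat (mol n) ξ|) := by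
          rw [← sq_abs]; ring
      _ ≤ 1 * C := by gcongr
      _ = C := one_mul C
  have hae : ∀ j n, ∀ᵐ ξ : E3, kerHat (mol n) ξ ^ 2 * (sym σ ξ * ‖hatL j f ξ‖ ^ 2) = 0 := by
    intro j n
    have h1 := (isMollifier_mol n).inner_diffOp_smearL hσ f
    rw [hz n, inner_zero_left, eq_comm,
      Finset.sum_eq_zero_iff_of_nonneg fun j _ => integral_nonneg (hnn n j)] at h1
    exact (integral_eq_zero_iff_of_nonneg (hnn n j) (hint n j)).1 (h1 j (Finset.mem_univ j))
  have h0 : ∀ j, hatL j f = 0 := by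
    intro j
    refine Lp.ext ?_
    have hne : ∀ᵐ ξ : E3, ξ ≠ 0 := by
      simp [ae_iff]
    filter_upwards [ae_all_iff.2 (hae j), hne, Lp.coeFn_zero ℂ 2 (volume : Measure E3)]
      with ξ hξ hξ0 hz0
    rw [hz0]
    have h2 : ∃ n, kerHat (mol n) ξ ≠ 0 :=
      ((tendsto_kerHat_mol ξ).eventually_ne one_ne_zero).exists
    obtain ⟨n, hn⟩ := h2
    have h3 : sym σ ξ ≠ 0 := by
      have : 0 < ‖ξ‖ := norm_pos_iff.2 hξ0
      exact (Real.rpow_pos_of_pos (by positivity) _).ne'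
    have h4 := hξ n
    simpa [hn, h3] using h4
  have hc : ∀ j, compC j f = 0 := by
    intro j
    have := h0 j
    rw [hatL_apply] at this
    rw [← norm_eq_zero, ← Lp.norm_fourier_eq, this, norm_zero]
  refine Lp.ext ?_
  filter_upwards [coe_compC 0 f, coe_compC 1 f, coe_compC 2 f,
    Lp.coeFn_zero ℂ 2 (volume : Measure E3), Lp.coeFn_zero E3 2 (volume : Measure E3)]
    with x a0 a1 a2 az az'
  rw [az']
  rw [hc, az] at a0 a1 a2
  ext j
  fin_cases j
  · simpa using a0.symm
  · simpa using a1.symm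
  · simpa using a2.symm

/-- `Λ^σ` is injective on scalar square integrable functions. -/
lemma ae_eq_zero_of_Lam {σ : ℝ} (hσ : 0 ≤ σ) {f : E3 → ℝ} (hf : MemLp f 2)
    (h : ∀ φ : E3 → ℝ, ContDiff ℝ ∞ φ → HasCompactSupport φ → ∫ x, f x * Lam σ φ x = 0) :
    f =ᵐ[volume] 0 := by
  have hF : MemLp (fun x => EuclideanSpace.single (0 : Fin 3) (f x)) 2 := by
    have := (ContinuousLinearMap.toSpanSingleton ℝ
      (EuclideanSpace.single (0 : Fin 3) (1 : ℝ))).comp_memLp' hf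
    refine this.ae_eq (ae_of_all _ fun x => ?_)
    ext i; simp
  have hz := eq_zero_of_LamVec hσ (f := hF.toLp _) fun φ h1 h2 => by
    rw [← h _ (contDiff_coord h1 0) (hasCompactSupport_coord h2 0)]
    refine integral_congr_ae ?_
    filter_upwards [hF.coeFn_toLp] with x hx
    rw [inner_LamVec, hx, Fin.sum_univ_three]
    simp
  filter_upwards [hF.coeFn_toLp, Lp.coeFn_zero E3 2 (volume : Measure E3)] with x a b
  rw [hz, b] at a
  have := congrArg (fun v : E3 => v 0) a
  simpa using this.symm

end DiffOp

/-! ### Dissipation -/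

lemma lamSq_eq (α : ℝ) (f : L2) :
    lamSq α f = ∑ j, ∫⁻ ξ, ENNReal.ofReal (sym (2 * α) ξ * ‖hatL j f ξ‖ ^ 2) := by
  unfold lamSq
  refine Finset.sum_congr rfl fun j _ => lintegral_congr fun ξ => ?_
  rw [ENNReal.ofReal_mul (sym_nonneg _ _), ENNReal.ofReal_pow (norm_nonneg _), ofReal_norm]
  rfl

lemma aestronglyMeasurable_sym_sq (σ : ℝ) (f : L2) (j : Fin 3) :
    AEStronglyMeasurable (fun ξ => sym σ ξ * ‖hatL j f ξ‖ ^ 2) :=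
  (measurable_sym σ).aestronglyMeasurable.mul ((Lp.aestronglyMeasurable _).norm.pow 2)

lemma integrable_sym_sq {α : ℝ} {f : L2} (h : lamSq α f ≠ ⊤) (j : Fin 3) :
    Integrable fun ξ => sym (2 * α) ξ * ‖hatL j f ξ‖ ^ 2 := by
  rw [lamSq_eq, ENNReal.sum_ne_top] at h
  refine ⟨aestronglyMeasurable_sym_sq _ f j, ?_⟩
  rw [hasFiniteIntegral_iff_ofReal (ae_of_all _ fun ξ =>
    mul_nonneg (sym_nonneg _ _) (sq_nonneg _))]
  exact (h j (Finset.mem_univ j)).lt_top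

lemma toReal_lamSq {α : ℝ} {f : L2} (h : lamSq α f ≠ ⊤) :
    (lamSq α f).toReal = ∑ j, ∫ ξ, sym (2 * α) ξ * ‖hatL j f ξ‖ ^ 2 := by
  have h' := h
  rw [lamSq_eq, ENNReal.sum_ne_top] at h'
  rw [lamSq_eq, ENNReal.toReal_sum h']
  refine Finset.sum_congr rfl fun j _ => ?_
  rw [integral_eq_lintegral_of_nonneg_ae (ae_of_all _ fun ξ =>
    mul_nonneg (sym_nonneg _ _) (sq_nonneg _)) (aestronglyMeasurable_sym_sq _ f j)]

lemma IsMollifier.inner_diffOp_nonneg {ρ : E3 → ℝ} (hρ : IsMollifier ρ) {σ : ℝ} (hσ : 0 ≤ σ)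
    (f : L2) : 0 ≤ ⟪hρ.diffOp hσ f, hρ.smearL f⟫ := by
  rw [hρ.inner_diffOp_smearL]
  exact Finset.sum_nonneg fun j _ => integral_nonneg fun ξ =>
    mul_nonneg (sq_nonneg _) (mul_nonneg (sym_nonneg _ _) (sq_nonneg _))

lemma IsMollifier.kerHat_sq_le {ρ : E3 → ℝ} (hρ : IsMollifier ρ) (ξ : E3) :
    kerHat ρ ξ ^ 2 ≤ 1 := by
  rw [← sq_abs]; exact pow_le_one₀ (abs_nonneg _) (hρ.abs_kerHat_le ξ)

lemma IsMollifier.inner_diffOp_le {ρ : E3 → ℝ} (hρ : IsMollifier ρ) {α : ℝ} (hα : 0 ≤ 2 * α)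
    {f : L2} (h : lamSq α f ≠ ⊤) : ⟪hρ.diffOp hα f, hρ.smearL f⟫ ≤ (lamSq α f).toReal := by
  rw [hρ.inner_diffOp_smearL, toReal_lamSq h]
  refine Finset.sum_le_sum fun j _ => integral_mono_of_nonneg
    (ae_of_all _ fun ξ => mul_nonneg (sq_nonneg _) (mul_nonneg (sym_nonneg _ _) (sq_nonneg _)))
    (integrable_sym_sq h j) (ae_of_all _ fun ξ => ?_)
  exact mul_le_of_le_one_left (mul_nonneg (sym_nonneg _ _) (sq_nonneg _)) (hρ.kerHat_sq_le ξ)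

/-- Dominated convergence in frequency, the squared kernel transforms being at most one and tending
to one. -/
lemma tendsto_inner_diffOp {α : ℝ} (hα : 0 ≤ 2 * α) {f : L2} (h : lamSq α f ≠ ⊤) :
    Tendsto (fun n => ⟪(isMollifier_mol n).diffOp hα f, (isMollifier_mol n).smearL f⟫) atTop
      (𝓝 (lamSq α f).toReal) := by
  simp_rw [IsMollifier.inner_diffOp_smearL]
  rw [toReal_lamSq h]
  refine tendsto_finsetSum _ fun j _ => ?_
  refine tendsto_integral_of_dominated_convergence _ (fun n =>
    ((isMollifier_mol n).continuous_kerHat.pow 2).aestronglyMeasurable.mul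
      (aestronglyMeasurable_sym_sq _ f j)) (integrable_sym_sq h j)
    (fun n => ae_of_all _ fun ξ => ?_) (ae_of_all _ fun ξ => ?_)
  · have h0 : 0 ≤ sym (2 * α) ξ * ‖hatL j f ξ‖ ^ 2 := mul_nonneg (sym_nonneg _ _) (sq_nonneg _)
    rw [Real.norm_of_nonneg (mul_nonneg (sq_nonneg _) h0)]
    exact mul_le_of_le_one_left h0 ((isMollifier_mol n).kerHat_sq_le ξ)
  · simpa using ((tendsto_kerHat_mol ξ).pow 2).mul_const (sym (2 * α) ξ * ‖hatL j f ξ‖ ^ 2)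

/-! ### Derivatives -/

lemma lineDeriv_testC (g : E3 → ℝ) (h1 : ContDiff ℝ ∞ g) (h2 : HasCompactSupport g) (v x : E3) :
    (LineDeriv.lineDerivOp v (testC g h1 h2) : 𝓢(E3, ℂ)) x = (fderiv ℝ g x v : ℂ) := by
  rw [SchwartzMap.lineDerivOp_apply_eq_fderiv]
  have h : HasFDerivAt (testC g h1 h2 : E3 → ℂ) (Complex.ofRealCLM.comp (fderiv ℝ g x)) x :=
    Complex.ofRealCLM.hasFDerivAt.comp x
      ((h1.differentiable (by simp)) x).hasFDerivAt
  rw [h.fderiv]; rfl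

lemma fourier_lineDeriv (Φ : 𝓢(E3, ℂ)) (v ξ : E3) :
    (𝓕 (LineDeriv.lineDerivOp v Φ : 𝓢(E3, ℂ)) : 𝓢(E3, ℂ)) ξ =
      (2 * Real.pi * Complex.I * (⟪ξ, v⟫ : ℝ)) * (𝓕 Φ : 𝓢(E3, ℂ)) ξ := by
  rw [SchwartzMap.fourier_lineDerivOp_eq]
  have : (inner ℝ · v : E3 → ℝ).HasTemperateGrowth := by fun_prop
  simp only [_root_.smul_apply, SchwartzMap.smulLeftCLM_apply_apply this, smul_eq_mul,
    Complex.real_smul]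
  ring

lemma contDiff_fderiv_apply {g : E3 → ℝ} (h1 : ContDiff ℝ ∞ g) (v : E3) :
    ContDiff ℝ ∞ fun x => fderiv ℝ g x v :=
  (h1.fderiv_right (m := ∞) (by simp)).clm_apply contDiff_const

lemma hasCompactSupport_fderiv_apply {g : E3 → ℝ} (h2 : HasCompactSupport g) (v : E3) :
    HasCompactSupport fun x => fderiv ℝ g x v :=
  (h2.fderiv (𝕜 := ℝ)).comp_left (g := fun L : E3 →L[ℝ] ℝ => L v) rfl

/-- A weak derivative of a field of `H^α`, `α ≥ 1`, is square integrable. -/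
lemma lintegral_sq_weakDeriv_le {α : ℝ} (hα : 1 ≤ α) {f : L2} (hf : lamSq α f ≠ ⊤) {i j : Fin 3}
    {G : E3 → ℝ} (hG : HasWeakDeriv (EuclideanSpace.single i 1) (fun x => f x j) G) :
    ∫⁻ x, ‖G x‖ₑ ^ 2 ≤ ‖f‖ₑ ^ 2 + lamSq α f := by
  set e : E3 := EuclideanSpace.single i 1 with he
  set m : E3 → ℂ := fun ξ => 2 * Real.pi * Complex.I * (⟪ξ, e⟫ : ℝ) with hm
  -- The condition `α ≥ 1` enters here: `(2π‖ξ‖)²` is at most 1 at low frequencies and at most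
  -- `(2π‖ξ‖)^(2α)` at high ones.
  have hmn : ∀ ξ, ‖m ξ‖ ^ 2 ≤ 1 + sym (2 * α) ξ := by
    intro ξ
    have h0 : 0 ≤ 2 * Real.pi * ‖ξ‖ := by positivity
    have h1 : ‖m ξ‖ ≤ 2 * Real.pi * ‖ξ‖ := by
      simp only [hm, norm_mul, Complex.norm_real, Complex.norm_I, Complex.norm_ofNat, mul_one]
      rw [Real.norm_of_nonneg Real.pi_pos.le, Real.norm_eq_abs]
      gcongr
      simpa [he] using abs_real_inner_le_norm ξ e
    have h2 : ‖m ξ‖ ^ 2 ≤ (2 * Real.pi * ‖ξ‖) ^ (2 : ℝ) := by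
      rw [Real.rpow_two]; gcongr
    refine h2.trans ?_
    rcases le_total (2 * Real.pi * ‖ξ‖) 1 with h | h
    · have := Real.rpow_le_one h0 h (zero_le_two)
      have := sym_nonneg (2 * α) ξ
      linarith
    · have : (2 * Real.pi * ‖ξ‖) ^ (2 : ℝ) ≤ sym (2 * α) ξ :=
        Real.rpow_le_rpow_of_exponent_le h (by linarith)
      linarith
  have hmc : Continuous m := by fun_prop
  have hfin : ∫⁻ ξ, ‖m ξ * hatL j f ξ‖ₑ ^ 2 ≤ ‖f‖ₑ ^ 2 + lamSq α f := by
    have h1 : ∀ ξ, ‖m ξ * hatL j f ξ‖ₑ ^ 2 ≤ ‖hatL j f ξ‖ₑ ^ 2 +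
        ENNReal.ofReal (sym (2 * α) ξ * ‖hatL j f ξ‖ ^ 2) := by
      intro ξ
      rw [← ofReal_norm, ← ofReal_norm, ← ENNReal.ofReal_pow (norm_nonneg _),
        ← ENNReal.ofReal_pow (norm_nonneg _), ← ENNReal.ofReal_add (by positivity)
          (mul_nonneg (sym_nonneg _ _) (sq_nonneg _))]
      refine ENNReal.ofReal_le_ofReal ?_
      rw [norm_mul, mul_pow]
      nlinarith [hmn ξ, sq_nonneg ‖hatL j f ξ‖]
    refine (lintegral_mono h1).trans ?_
    rw [lintegral_add_right' _ (aestronglyMeasurable_sym_sq _ f j).aemeasurable.ennreal_ofReal]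
    refine add_le_add ?_ ?_
    · have h2 : ∫⁻ ξ, ‖hatL j f ξ‖ₑ ^ 2 = ‖hatL j f‖ₑ ^ 2 := by
        rw [Lp.enorm_def]
        have := lintegral_enorm_rpow_le_of_eLpNorm (f := hatL j f) zero_lt_two
        simp only [ENNReal.ofReal_ofNat, ENNReal.rpow_two] at this
        exact this.symm
      rw [h2]
      gcongr
      rw [hatL_apply, ← ofReal_norm, ← ofReal_norm, Lp.norm_fourier_eq]
      refine ENNReal.ofReal_le_ofReal ?_
      refine ((coordC j).norm_compLp_le f).trans ?_
      have : ‖coordC j‖ ≤ 1 := ContinuousLinearMap.opNorm_le_bound _ zero_le_one fun v => by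
        simp only [coordC, ContinuousLinearMap.comp_apply, one_mul, Complex.ofRealCLM_apply,
          Complex.norm_real]
        exact PiLp.norm_apply_le v j
      exact mul_le_of_le_one_left (norm_nonneg _) this
    · rw [lamSq_eq]
      exact Finset.single_le_sum (f := fun j => ∫⁻ ξ, ENNReal.ofReal (sym (2 * α) ξ *
        ‖hatL j f ξ‖ ^ 2)) (fun _ _ => zero_le) (Finset.mem_univ j)
  have hmeas : AEStronglyMeasurable (fun ξ => m ξ * hatL j f ξ) :=
    hmc.aestronglyMeasurable.mul (Lp.aestronglyMeasurable _)
  have hsq : ∀ {u : E3 → ℂ}, ∫⁻ ξ, ‖u ξ‖ₑ ^ 2 = eLpNorm u 2 volume ^ 2 := by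
    intro u
    have := lintegral_enorm_rpow_le_of_eLpNorm (f := u) zero_lt_two
    simp only [ENNReal.ofReal_ofNat, ENNReal.rpow_two] at this
    exact this.symm
  have hsum : ‖f‖ₑ ^ 2 + lamSq α f ≠ ⊤ := ENNReal.add_ne_top.2 ⟨by simp, hf⟩
  have hh : MemLp (fun ξ => m ξ * hatL j f ξ) 2 := by
    refine ⟨hmeas, ?_⟩
    rw [hsq] at hfin
    have := hfin.trans_lt hsum.lt_top
    by_contra hc
    rw [not_lt, top_le_iff] at hc
    rw [hc] at this; simp at this
  set H : Lp ℂ 2 (volume : Measure E3) := 𝓕⁻ (hh.toLp _) with hH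
  have hHint : LocallyIntegrable fun x => (H x).re := by
    have : MemLp (fun x => (H x).re) 2 := Complex.reCLM.comp_memLp' (Lp.memLp H)
    exact this.locallyIntegrable one_le_two
  -- The weak derivative is identified by Plancherel against test functions; conjugating the
  -- imaginary multiplier supplies the minus sign of integration by parts. Real test functions see
  -- only the real part of `H`.
  have hae : G =ᵐ[volume] fun x => (H x).re := by
    refine ae_eq_of_integral_contDiff_smul_eq hG.locallyIntegrable_deriv hHint
      fun φ h1 h2 => ?_
    have key := hG.integral_eq φ h1 h2
    set Φ := testC φ h1 h2
    have e1 : ∫ x, f x j * fderiv ℝ φ x e =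
        ⟪compC j f, (LineDeriv.lineDerivOp e Φ : 𝓢(E3, ℂ)).toLp 2⟫ := by
      rw [L2.inner_def]
      refine integral_congr_ae ?_
      filter_upwards [coe_compC j f, (LineDeriv.lineDerivOp e Φ : 𝓢(E3, ℂ)).coeFn_toLp 2 volume]
        with x a b
      rw [a, b, lineDeriv_testC, Complex.inner, Complex.conj_ofReal, ← Complex.ofReal_mul,
        Complex.ofReal_re, mul_comm]
    have e2 : ∫ x, (H x).re * φ x = ⟪H, Φ.toLp 2⟫ := by
      rw [L2.inner_def]
      refine integral_congr_ae ?_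
      filter_upwards [Φ.coeFn_toLp 2 volume] with x b
      rw [b, testC_apply, Complex.inner, Complex.re_ofReal_mul, Complex.conj_re, mul_comm]
    have e3 : ⟪compC j f, (LineDeriv.lineDerivOp e Φ : 𝓢(E3, ℂ)).toLp 2⟫ = - ⟪H, Φ.toLp 2⟫ := by
      rw [← real_inner_fourier, ← real_inner_fourier H, hH,
        FourierTransform.fourier_fourierInv_eq, SchwartzMap.toLp_fourier_eq,
        SchwartzMap.toLp_fourier_eq, real_inner_Lp_complex, real_inner_Lp_complex, ← Complex.neg_re,
        ← integral_neg]
      congr 1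
      refine integral_congr_ae ?_
      filter_upwards [hh.coeFn_toLp, (𝓕 Φ).coeFn_toLp 2 volume,
        (𝓕 (LineDeriv.lineDerivOp e Φ : 𝓢(E3, ℂ)) : 𝓢(E3, ℂ)).coeFn_toLp 2 volume] with ξ a b c
      rw [a, b, c, fourier_lineDeriv, ← hatL_apply]
      simp only [hm, map_mul, Complex.conj_ofReal, Complex.conj_I, map_ofNat]
      ring
    simp only [smul_eq_mul]
    have e4 : ∫ x, φ x * (H x).re = ∫ x, (H x).re * φ x := by
      congr 1; ext x; ring
    have e5 : ∫ x, φ x * G x = ∫ x, G x * φ x := by congr 1; ext x; ring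
    rw [e4, e2, e5]; linarith
  have hle : ∫⁻ x, ‖G x‖ₑ ^ 2 ≤ ∫⁻ x, ‖H x‖ₑ ^ 2 := by
    refine lintegral_mono_ae ?_
    filter_upwards [hae] with x hx
    rw [hx]
    gcongr
    rw [← ofReal_norm, ← ofReal_norm]
    exact ENNReal.ofReal_le_ofReal (Complex.abs_re_le_norm _)
  refine hle.trans ?_
  rw [hsq, ← Lp.enorm_def, hH]
  have h9 : ‖(𝓕⁻ (hh.toLp _) : Lp ℂ 2 (volume : Measure E3))‖ₑ = ‖hh.toLp _‖ₑ := by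
    rw [← ofReal_norm, ← ofReal_norm, ← Lp.norm_fourier_eq,
      FourierTransform.fourier_fourierInv_eq]
  rw [h9, Lp.enorm_toLp, ← hsq]
  exact hfin

/-- `Λ² = -Δ` on test functions. -/
lemma Lam_two (g : E3 → ℝ) (h1 : ContDiff ℝ ∞ g) (h2 : HasCompactSupport g) (x : E3) :
    Lam 2 g x = - ∑ i : Fin 3, fderiv ℝ (fun y => fderiv ℝ g y (EuclideanSpace.single i 1)) x
      (EuclideanSpace.single i 1) := by
  set D : Fin 3 → 𝓢(E3, ℂ) := fun i => LineDeriv.lineDerivOp (EuclideanSpace.single i (1 : ℝ))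
    (testC _ (contDiff_fderiv_apply h1 (EuclideanSpace.single i 1))
      (hasCompactSupport_fderiv_apply h2 (EuclideanSpace.single i 1))) with hD
  have hF : ∀ ξ, (((2 * Real.pi * ‖ξ‖) ^ (2 : ℝ) : ℝ) : ℂ) * (𝓕 (testC g h1 h2) : 𝓢(E3, ℂ)) ξ =
      (𝓕 (-∑ i, D i) : 𝓢(E3, ℂ)) ξ := by
    intro ξ
    have hDi : ∀ i, (𝓕 (D i) : 𝓢(E3, ℂ)) ξ =
        (2 * Real.pi * Complex.I * (ξ i : ℝ)) ^ 2 * (𝓕 (testC g h1 h2) : 𝓢(E3, ℂ)) ξ := by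
      intro i
      have e : testC _ (contDiff_fderiv_apply h1 (EuclideanSpace.single i 1))
        (hasCompactSupport_fderiv_apply h2 (EuclideanSpace.single i 1)) =
        LineDeriv.lineDerivOp (EuclideanSpace.single i (1 : ℝ)) (testC g h1 h2) := by
        ext y; rw [lineDeriv_testC, testC_apply]
      simp only [hD]
      rw [e, fourier_lineDeriv, fourier_lineDeriv, EuclideanSpace.inner_single_right]
      simp only [one_mul, conj_trivial]
      ring
    rw [FourierTransform.fourier_neg, FourierTransform.fourier_sum]
    simp only [_root_.neg_apply, _root_.sum_apply, hDi]
    rw [Fin.sum_univ_three, Real.rpow_two, mul_pow, EuclideanSpace.norm_sq_eq, Fin.sum_univ_three]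
    simp only [Real.norm_eq_abs, sq_abs]
    push_cast
    simp only [mul_pow, Complex.I_sq]
    ring
  have h3 : Lam 2 g x = (𝓕⁻ (fun ξ : E3 => (𝓕 (-∑ i, D i) : 𝓢(E3, ℂ)) ξ) x).re := by
    have := fourier_ofReal (testS g h1 h2)
    unfold Lam
    refine congrArg (fun h : E3 → ℂ => (𝓕⁻ h x).re) (funext fun ξ => ?_)
    rw [← hF]
    exact congrArg _ (congrFun this ξ)
  rw [h3]
  have h4 := SchwartzMap.fourierInv_coe (𝓕 (-∑ i, D i) : 𝓢(E3, ℂ))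
  rw [FourierTransform.fourierInv_fourier_eq] at h4
  have h5 : 𝓕⁻ (fun ξ : E3 => (𝓕 (-∑ i, D i) : 𝓢(E3, ℂ)) ξ) x = (-∑ i, D i : 𝓢(E3, ℂ)) x :=
    (congrFun h4 x).symm
  rw [h5]
  simp only [_root_.neg_apply, _root_.sum_apply, hD, lineDeriv_testC, Complex.neg_re,
    Complex.re_sum, Complex.ofReal_re]

/-! ### Divergence-free fields and density of test fields -/

/-- The gradient of a scalar function. -/
def gradVec (φ : E3 → ℝ) (x : E3) : E3 :=
  WithLp.toLp 2 fun i => fderiv ℝ φ x (EuclideanSpace.single i 1)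

@[simp] lemma gradVec_apply (φ : E3 → ℝ) (x : E3) (i : Fin 3) :
    gradVec φ x i = fderiv ℝ φ x (EuclideanSpace.single i 1) := rfl

lemma sum_single (v : E3) : v = ∑ i, v i • (EuclideanSpace.single i (1 : ℝ) : E3) := by
  ext j
  simp [Fin.sum_univ_three]
  fin_cases j <;> simp

lemma inner_gradVec (φ : E3 → ℝ) (x v : E3) : ⟪gradVec φ x, v⟫ = fderiv ℝ φ x v := by
  conv_rhs => rw [sum_single v]
  simp [PiLp.inner_apply]

lemma contDiff_gradVec {φ : E3 → ℝ} (h1 : ContDiff ℝ ∞ φ) : ContDiff ℝ ∞ (gradVec φ) :=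
  contDiff_euclidean.2 fun i => contDiff_fderiv_apply h1 (EuclideanSpace.single i 1)

lemma hasCompactSupport_gradVec {φ : E3 → ℝ} (h2 : HasCompactSupport φ) :
    HasCompactSupport (gradVec φ) :=
  (h2.fderiv (𝕜 := ℝ)).comp_left (g := fun L : E3 →L[ℝ] ℝ =>
    (WithLp.toLp 2 fun i => L (EuclideanSpace.single i 1) : E3)) (by ext; simp)

/-- The divergence of a vector field. -/
def divg (ψ : E3 → E3) (x : E3) : ℝ := ∑ i : Fin 3, fderiv ℝ ψ x (EuclideanSpace.single i 1) i

/-- Orthogonality to gradients presents the solenoidal fields as an intersection of kernels of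
continuous functionals, hence as a closed subspace. -/
lemma isSolenoidal_iff (f : L2) : IsSolenoidal f ↔ ∀ (φ : E3 → ℝ) (h1 : ContDiff ℝ ∞ φ)
    (h2 : HasCompactSupport φ),
    ⟪(memLp_test (contDiff_gradVec h1) (hasCompactSupport_gradVec h2) 2).toLp (gradVec φ), f⟫
      = 0 := by
  have : ∀ (φ : E3 → ℝ) (h1 : ContDiff ℝ ∞ φ) (h2 : HasCompactSupport φ),
      ⟪(memLp_test (contDiff_gradVec h1) (hasCompactSupport_gradVec h2) 2).toLp (gradVec φ), f⟫ =
        ∫ x, fderiv ℝ φ x (f x) := by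
    intro φ h1 h2
    rw [L2.inner_def]
    refine integral_congr_ae ?_
    filter_upwards [(memLp_test (contDiff_gradVec h1)
      (hasCompactSupport_gradVec h2) 2).coeFn_toLp] with x hx
    rw [hx, inner_gradVec]
  exact forall_congr' fun φ => ⟨fun h h1 h2 => (this φ h1 h2).trans (h h1 h2),
    fun h h1 h2 => (this φ h1 h2).symm.trans (h h1 h2)⟩

/-- Smooth compactly supported divergence free fields. -/
structure IsSolTest (ψ : E3 → E3) : Prop where
  smooth : ContDiff ℝ ∞ ψ
  compact : HasCompactSupport ψ
  div_eq : ∀ x, divg ψ x = 0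

lemma fderiv_coord {ψ : E3 → E3} (h1 : ContDiff ℝ ∞ ψ) (x v : E3) (i : Fin 3) :
    fderiv ℝ ψ x v i = fderiv ℝ (fun y => ψ y i) x v := by
  have h : HasFDerivAt (fun y => ψ y i) ((EuclideanSpace.proj (𝕜 := ℝ) i).comp (fderiv ℝ ψ x)) x :=
    (EuclideanSpace.proj (𝕜 := ℝ) i).hasFDerivAt.comp x
      ((h1.differentiable (by simp)) x).hasFDerivAt
  rw [h.fderiv]; rfl

lemma integral_fderiv_mul {φ g : E3 → ℝ} (h1 : ContDiff ℝ 1 φ) (h2 : HasCompactSupport φ)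
    (hg : ContDiff ℝ 1 g) (v : E3) :
    ∫ x, fderiv ℝ φ x v * g x = - ∫ x, φ x * fderiv ℝ g x v := by
  have c1 : HasCompactSupport fun x => fderiv ℝ φ x v :=
    (h2.fderiv (𝕜 := ℝ)).comp_left (g := fun L : E3 →L[ℝ] ℝ => L v) rfl
  have d1 : Continuous fun x => fderiv ℝ φ x v :=
    (h1.continuous_fderiv (by simp)).clm_apply continuous_const
  have d2 : Continuous fun x => fderiv ℝ g x v :=
    (hg.continuous_fderiv (by simp)).clm_apply continuous_const
  have := integral_mul_fderiv_eq_neg_fderiv_mul_of_integrable (μ := (volume : Measure E3))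
    (f := φ) (g := g) (v := v)
    ((d1.mul hg.continuous).integrable_of_hasCompactSupport c1.mul_right)
    ((h1.continuous.mul d2).integrable_of_hasCompactSupport h2.mul_right)
    ((h1.continuous.mul hg.continuous).integrable_of_hasCompactSupport h2.mul_right)
    (fun x _ => h1.differentiable (by simp) x) (fun x _ => hg.differentiable (by simp) x)
  rw [this, neg_neg]

/-- Test fields as elements of `L²`. -/
def IsSolTest.toL2 {ψ : E3 → E3} (h : IsSolTest ψ) : L2 :=
  (memLp_test h.smooth h.compact 2).toLp ψ

lemma IsSolTest.coeFn_toL2 {ψ : E3 → E3} (h : IsSolTest ψ) : h.toL2 =ᵐ[volume] ψ :=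
  (memLp_test h.smooth h.compact 2).coeFn_toLp

lemma IsSolTest.isSolenoidal {ψ : E3 → E3} (h : IsSolTest ψ) : IsSolenoidal h.toL2 := by
  intro φ h1 h2
  have e : ∫ x, fderiv ℝ φ x (h.toL2 x) =
      ∫ x, ∑ i, fderiv ℝ φ x (EuclideanSpace.single i 1) * ψ x i := by
    refine integral_congr_ae ?_
    filter_upwards [h.coeFn_toL2] with x hx
    rw [hx, ← inner_gradVec]
    simp [PiLp.inner_apply, mul_comm]
  have hc : ∀ i : Fin 3, ContDiff ℝ 1 fun y => ψ y i := fun i =>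
    (contDiff_coord h.smooth i).of_le (by simp)
  rw [e, integral_finsetSum]
  · have h3 : ∀ i : Fin 3, ∫ x, fderiv ℝ φ x (EuclideanSpace.single i 1) * ψ x i =
        - ∫ x, φ x * fderiv ℝ ψ x (EuclideanSpace.single i 1) i := fun i => by
      rw [integral_fderiv_mul (h1.of_le (by simp)) h2 (hc i)]
      simp_rw [fderiv_coord h.smooth]
    rw [Finset.sum_congr rfl fun i _ => h3 i, Finset.sum_neg_distrib, ← integral_finsetSum]
    · simp_rw [← Finset.mul_sum]
      have : ∀ x, ∑ i : Fin 3, fderiv ℝ ψ x (EuclideanSpace.single i 1) i = 0 := h.div_eq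
      simp [this]
    · intro i _
      simp_rw [fderiv_coord h.smooth]
      refine Continuous.integrable_of_hasCompactSupport (h1.continuous.mul
        ((contDiff_fderiv_apply (contDiff_coord h.smooth i) _).continuous)) h2.mul_right
  · intro i _
    exact ((contDiff_fderiv_apply h1 _).continuous.mul
      (hc i).continuous).integrable_of_hasCompactSupport
        (hasCompactSupport_fderiv_apply h2 _).mul_right

/-- The closed span of the divergence free test fields. -/
def solSpace : Submodule ℝ L2 :=
  (Submodule.span ℝ {f | ∃ (ψ : E3 → E3) (h : IsSolTest ψ), f = h.toL2}).topologicalClosure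

lemma isClosed_solSpace : IsClosed (solSpace : Set L2) := Submodule.isClosed_topologicalClosure _

lemma IsSolTest.mem_solSpace {ψ : E3 → E3} (h : IsSolTest ψ) : h.toL2 ∈ solSpace :=
  Submodule.le_topologicalClosure _ (Submodule.subset_span ⟨ψ, h, rfl⟩)

instance : CompleteSpace solSpace := isClosed_solSpace.completeSpace_coe

/-- The space of solenoidal fields is contained in a closed subspace once the test fields are. -/
lemma solSpace_le {K : Submodule ℝ L2} (hK : IsClosed (K : Set L2))
    (h : ∀ (ψ : E3 → E3) (h : IsSolTest ψ), h.toL2 ∈ K) : solSpace ≤ K :=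
  Submodule.topologicalClosure_minimal _ (Submodule.span_le.2 (by
    rintro f ⟨ψ, hψ, rfl⟩; exact h ψ hψ)) hK

/-- The solenoidal fields as a subspace. -/
def distSol : Submodule ℝ L2 :=
  ⨅ (φ : E3 → ℝ) (h1 : ContDiff ℝ ∞ φ) (h2 : HasCompactSupport φ),
    (innerSL ℝ ((memLp_test (contDiff_gradVec h1)
      (hasCompactSupport_gradVec h2) 2).toLp (gradVec φ))).ker

lemma mem_distSol {f : L2} : f ∈ distSol ↔ IsSolenoidal f := by
  rw [isSolenoidal_iff]
  simp [distSol, Submodule.mem_iInf]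

lemma isClosed_distSol : IsClosed (distSol : Set L2) := by
  simp only [distSol, Submodule.coe_iInf]
  exact isClosed_iInter fun φ => isClosed_iInter fun h1 => isClosed_iInter fun h2 =>
    ContinuousLinearMap.isClosed_ker _

lemma isSolenoidal_of_mem_solSpace {f : L2} (hf : f ∈ solSpace) : IsSolenoidal f :=
  mem_distSol.1 (solSpace_le isClosed_distSol (fun _ h => mem_distSol.2 h.isSolenoidal) hf)

lemma fderiv_fderiv_swap {g : E3 → ℝ} (h1 : ContDiff ℝ ∞ g) (v w x : E3) :
    fderiv ℝ (fun y => fderiv ℝ g y v) x w = fderiv ℝ (fun y => fderiv ℝ g y w) x v := by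
  have hd : DifferentiableAt ℝ (fderiv ℝ g) x :=
    ((h1.fderiv_right (m := ∞) (by simp)).differentiable (by simp)) x
  have e : ∀ v w, fderiv ℝ (fun y => fderiv ℝ g y v) x w = fderiv ℝ (fderiv ℝ g) x w v := by
    intro v w
    rw [fderiv_clm_apply hd (differentiableAt_const v)]
    simp
  rw [e, e]
  exact (h1.contDiffAt.isSymmSndFDerivAt
    (by simp only [minSmoothness_of_isRCLikeNormedField]; exact WithTop.coe_le_coe.2 le_top)) w v

/-- The Laplacian. -/
def lapl (g : E3 → ℝ) (x : E3) : ℝ :=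
  ∑ i : Fin 3, fderiv ℝ (fun y => fderiv ℝ g y (EuclideanSpace.single i 1)) x
    (EuclideanSpace.single i 1)

lemma contDiff_lapl {g : E3 → ℝ} (h1 : ContDiff ℝ ∞ g) : ContDiff ℝ ∞ (lapl g) :=
  ContDiff.sum fun _ _ => contDiff_fderiv_apply (contDiff_fderiv_apply h1 _) _

lemma hasCompactSupport_lapl {g : E3 → ℝ} (h2 : HasCompactSupport g) :
    HasCompactSupport (lapl g) := by
  have : lapl g = ∑ i : Fin 3, fun x => fderiv ℝ (fun y => fderiv ℝ g y
      (EuclideanSpace.single i 1)) x (EuclideanSpace.single i 1) := by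
    ext x; simp [lapl]
  rw [this, Fin.sum_univ_three]
  have h := fun i : Fin 3 => hasCompactSupport_fderiv_apply (hasCompactSupport_fderiv_apply h2
    (EuclideanSpace.single i 1)) (EuclideanSpace.single i 1)
  exact ((h 0).add (h 1)).add (h 2)

/-- The field `curl curl (g eⱼ)`, up to sign. -/
def curlCurl (j : Fin 3) (g : E3 → ℝ) (x : E3) : E3 :=
  gradVec (fun y => fderiv ℝ g y (EuclideanSpace.single j 1)) x -
    EuclideanSpace.single j (lapl g x)

/-- Third derivatives commute, so the divergence is `∂ⱼ Δg - ∂ⱼ Δg`. -/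
lemma isSolTest_curlCurl (j : Fin 3) {g : E3 → ℝ} (h1 : ContDiff ℝ ∞ g)
    (h2 : HasCompactSupport g) : IsSolTest (curlCurl j g) := by
  have hs : (fun x => (EuclideanSpace.single j (lapl g x) : E3)) =
      fun x => lapl g x • (EuclideanSpace.single j (1 : ℝ) : E3) := by
    ext x i; simp
  have c1 : ContDiff ℝ ∞ (curlCurl j g) := by
    refine (contDiff_gradVec (contDiff_fderiv_apply h1 _)).sub ?_
    rw [hs]
    exact (contDiff_lapl h1).smul contDiff_const
  refine ⟨c1, ?_, fun x => ?_⟩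
  · refine (hasCompactSupport_gradVec (hasCompactSupport_fderiv_apply h2 _)).sub ?_
    rw [hs]
    exact (hasCompactSupport_lapl h2).smul_right
  · have d : ∀ i : Fin 3, fderiv ℝ (curlCurl j g) x (EuclideanSpace.single i 1) i =
        fderiv ℝ (fun y => fderiv ℝ (fun z => fderiv ℝ g z (EuclideanSpace.single i 1)) y
          (EuclideanSpace.single i 1)) x (EuclideanSpace.single j 1) -
        if i = j then fderiv ℝ (lapl g) x (EuclideanSpace.single j 1) else 0 := by
      intro i
      rw [fderiv_coord c1]
      have e : (fun y => curlCurl j g y i) = fun y =>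
          fderiv ℝ (fun z => fderiv ℝ g z (EuclideanSpace.single i 1)) y
            (EuclideanSpace.single j 1) - if i = j then lapl g y else 0 := by
        ext y
        rw [← fderiv_fderiv_swap h1]
        simp [curlCurl]
      rw [e]
      have dA : DifferentiableAt ℝ (fun y => fderiv ℝ (fun z => fderiv ℝ g z
          (EuclideanSpace.single i 1)) y (EuclideanSpace.single j 1)) x :=
        ((contDiff_fderiv_apply (contDiff_fderiv_apply h1 _) _).differentiable (by simp)) x
      have dL : DifferentiableAt ℝ (lapl g) x := ((contDiff_lapl h1).differentiable (by simp)) x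
      split_ifs with hij
      · subst hij
        rw [fderiv_fun_sub dA dL]
        simp only [_root_.sub_apply]
      · simp only [sub_zero]
        rw [fderiv_fderiv_swap (contDiff_fderiv_apply h1 _)]
    unfold divg
    simp_rw [d, Finset.sum_sub_distrib]
    simp only [Finset.sum_ite_eq', Finset.mem_univ, if_true]
    have : fderiv ℝ (lapl g) x = ∑ i : Fin 3, fderiv ℝ (fun y => fderiv ℝ (fun z => fderiv ℝ g z
        (EuclideanSpace.single i 1)) y (EuclideanSpace.single i 1)) x := by
      unfold lapl
      exact fderiv_fun_sum fun i _ =>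
        ((contDiff_fderiv_apply (contDiff_fderiv_apply h1 _) _).differentiable (by simp)) x
    rw [this, _root_.sum_apply, sub_self]

/-- A solenoidal field orthogonal to all solenoidal test fields vanishes. -/
lemma eq_zero_of_isSolenoidal {w : L2} (hw : IsSolenoidal w)
    (h : ∀ (ψ : E3 → E3) (h : IsSolTest ψ), ⟪w, h.toL2⟫ = 0) : w = 0 := by
  -- As `Λ² = -Δ`, injectivity of `Λ²` is Liouville's theorem for square integrable harmonic
  -- functions; it remains to see that each component of `w` is harmonic.
  refine eq_zero_of_LamVec zero_le_two fun φ h1 h2 => ?_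
  have hint : ∀ {g : E3 → ℝ} (_ : ContDiff ℝ ∞ g) (_ : HasCompactSupport g) (j : Fin 3),
      Integrable fun x => w x j * g x := fun a b j =>
    (memLp_coord (Lp.memLp w) j).integrable_mul (memLp_test a b 2)
  -- In the pairing with `curlCurl j g` the gradient part drops out because `w` is solenoidal.
  have key : ∀ (g : E3 → ℝ) (j : Fin 3), ContDiff ℝ ∞ g → HasCompactSupport g →
      ∫ x, w x j * lapl g x = 0 := by
    intro g j a b
    have e1 := h _ (isSolTest_curlCurl j a b)
    rw [L2.inner_def] at e1
    have e2 : ∫ x, ⟪w x, (isSolTest_curlCurl j a b).toL2 x⟫ =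
        ∫ x, (fderiv ℝ (fun y => fderiv ℝ g y (EuclideanSpace.single j 1)) x (w x) -
          w x j * lapl g x) := by
      refine integral_congr_ae ?_
      filter_upwards [(isSolTest_curlCurl j a b).coeFn_toL2] with x hx
      rw [hx, curlCurl, inner_sub_right, real_inner_comm, inner_gradVec,
        EuclideanSpace.inner_single_right]
      simp [mul_comm]
    have a' := contDiff_fderiv_apply a (EuclideanSpace.single j 1)
    have b' := hasCompactSupport_fderiv_apply b (EuclideanSpace.single j 1)
    rw [e2, integral_sub, hw _ a' b'] at e1
    · linarith
    · have : Integrable fun x => ⟪gradVec (fun y => fderiv ℝ g y (EuclideanSpace.single j 1)) x,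
          w x⟫ := by
        simp_rw [PiLp.inner_apply]
        refine integrable_finsetSum _ fun i _ => ?_
        exact hint (contDiff_fderiv_apply a' _) (hasCompactSupport_fderiv_apply b' _) i
      simpa only [inner_gradVec] using this
    · exact hint (contDiff_lapl a) (hasCompactSupport_lapl b) j
  simp_rw [inner_LamVec]
  have e : ∀ j x, w x j * Lam 2 (fun y => φ y j) x = -(w x j * lapl (fun y => φ y j) x) := by
    intro j x
    rw [Lam_two _ (contDiff_coord h1 j) (hasCompactSupport_coord h2 j), mul_neg]; rfl
  simp_rw [e]
  have hi : ∀ j, Integrable fun x => -(w x j * lapl (fun y => φ y j) x) := fun j =>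
    (hint (contDiff_lapl (contDiff_coord h1 j))
      (hasCompactSupport_lapl (hasCompactSupport_coord h2 j)) j).neg
  rw [integral_finsetSum _ fun j _ => hi j]
  refine Finset.sum_eq_zero fun j _ => ?_
  rw [integral_neg, key _ j (contDiff_coord h1 j) (hasCompactSupport_coord h2 j), neg_zero]

/-- Density of the solenoidal test fields. -/
lemma IsSolenoidal.mem_solSpace {u : L2} (hu : IsSolenoidal u) : u ∈ solSpace := by
  -- The error of the orthogonal projection is solenoidal and orthogonal to all test fields, hence
  -- zero.
  set P := solSpace.starProjection u with hP
  have hPm : P ∈ solSpace := Submodule.starProjection_apply_mem _ _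
  have h0 : u - P = 0 := by
    refine eq_zero_of_isSolenoidal ?_ fun ψ hψ => ?_
    · exact mem_distSol.1 (distSol.sub_mem (mem_distSol.2 hu)
        (mem_distSol.2 (isSolenoidal_of_mem_solSpace hPm)))
    · exact Submodule.starProjection_inner_eq_zero u _ hψ.mem_solSpace
  rw [sub_eq_zero] at h0
  rw [h0]; exact hPm

/-! ### The multiplier bound -/

/-- The exponents for which the multiplier norm is controlled by `L²`, `L^k` and gradient norms. -/
structure Exponents (s σ r k m : ℝ) : Prop where
  s_nonneg : 0 ≤ s
  s_le : s ≤ σ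
  σ_lt : σ < 1
  r_ge : 2 ≤ r
  r_le : r ≤ k
  m_ge : 1 ≤ m
  -- Hölder duality: the multiplier output is paired with a field in `L^k`.
  conj : m⁻¹ + k⁻¹ = 1
  -- Interpolation of order `σ` between `L^k` and square integrable gradients.
  scale : r⁻¹ = σ / 2 + (1 - σ) / k
  subcritical : s * r < 3

lemma rpow_le_sq_add_rpow {r k : ℝ} (hr : 2 ≤ r) (hrk : r ≤ k) (a : ℝ≥0∞) :
    a ^ r ≤ a ^ (2 : ℝ) + a ^ k := by
  rcases le_total a 1 with h | h
  · exact (ENNReal.rpow_le_rpow_of_exponent_ge h hr).trans le_self_add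
  · exact (ENNReal.rpow_le_rpow_of_exponent_le h hrk).trans le_add_self

/-- Interpolation by Young's inequality. -/
lemma Exponents.young {s σ r k m : ℝ} (h : Exponents s σ r k m) (a b : ℝ≥0∞) :
    (a ^ (1 - s) * b ^ s) ^ r ≤ a ^ (2 : ℝ) + a ^ k + b ^ (2 : ℝ) := by
  have hr0 : 0 ≤ r := by linarith [h.r_ge]
  have hs1 : 0 ≤ 1 - s := by linarith [h.s_le, h.σ_lt]
  have hk : 0 < k := by linarith [h.r_ge, h.r_le]
  have hσ : 0 ≤ σ := h.s_nonneg.trans h.s_le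
  -- If `b ≤ a`, the product is at most `a`, and `a^r` is bounded by `a² + a^k`. If `a ≤ b`, the
  -- exponent `s` may be raised to `σ`; by `scale` the resulting powers of `a^k` and `b²` have
  -- exponents summing to one.
  rcases le_total b a with hba | hab
  · have : a ^ (1 - s) * b ^ s ≤ a := by
      calc a ^ (1 - s) * b ^ s ≤ a ^ (1 - s) * a ^ s := by
            gcongr; exact h.s_nonneg
        _ = a := by
            rw [← ENNReal.rpow_add_of_nonneg _ _ hs1 h.s_nonneg]; simp
    exact (ENNReal.rpow_le_rpow this hr0).trans
      ((rpow_le_sq_add_rpow h.r_ge h.r_le a).trans le_self_add)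
  · have h1 : a ^ (1 - s) * b ^ s ≤ a ^ (1 - σ) * b ^ σ := by
      have e1 : a ^ (1 - s) = a ^ (1 - σ) * a ^ (σ - s) := by
        rw [← ENNReal.rpow_add_of_nonneg _ _ (by linarith [h.σ_lt]) (by linarith [h.s_le])]
        ring_nf
      have e2 : b ^ σ = b ^ (σ - s) * b ^ s := by
        rw [← ENNReal.rpow_add_of_nonneg _ _ (by linarith [h.s_le]) h.s_nonneg]
        ring_nf
      rw [e1, e2, mul_assoc]
      gcongr
      linarith [h.s_le]
    have hrpos : 0 < r := by linarith [h.r_ge]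
    have h2 : (1 - σ) * r / k + σ * r / 2 = 1 := by
      have := h.scale
      field_simp at this ⊢
      linarith
    have hw1 : 0 ≤ (1 - σ) * r / k := by
      have := h.σ_lt; apply div_nonneg (mul_nonneg (by linarith) hr0) hk.le
    have hw2 : 0 ≤ σ * r / 2 := by positivity
    set y := max (a ^ k) (b ^ (2 : ℝ))
    have h3 : (a ^ (1 - σ) * b ^ σ) ^ r = (a ^ k) ^ ((1 - σ) * r / k) *
        (b ^ (2 : ℝ)) ^ (σ * r / 2) := by
      rw [ENNReal.mul_rpow_of_nonneg _ _ hr0, ← ENNReal.rpow_mul, ← ENNReal.rpow_mul,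
        ← ENNReal.rpow_mul, ← ENNReal.rpow_mul]
      congr 2
      · field_simp
      · field_simp
    calc (a ^ (1 - s) * b ^ s) ^ r ≤ (a ^ (1 - σ) * b ^ σ) ^ r := ENNReal.rpow_le_rpow h1 hr0
      _ = _ := h3
      _ ≤ y ^ ((1 - σ) * r / k) * y ^ (σ * r / 2) := by
          gcongr
          · exact le_max_left _ _
          · exact le_max_right _ _
      _ = y := by rw [← ENNReal.rpow_add_of_nonneg _ _ hw1 hw2, h2, ENNReal.rpow_one]
      _ ≤ _ := by
          refine max_le ?_ le_add_self
          exact le_add_self.trans le_self_add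

/-- The representative of `Λ^s f` for nice functions. -/
def lamRep (s : ℝ) (f : E3 → ℝ) : E3 → ℝ :=
  if s = 0 then f else fun x => (lamConst s)⁻¹ * fracDiff s f x

lemma lamRep_zero (f : E3 → ℝ) : lamRep 0 f = f := by simp [lamRep]

lemma lamRep_of_ne {s : ℝ} (hs : s ≠ 0) (f : E3 → ℝ) :
    lamRep s f = fun x => (lamConst s)⁻¹ * fracDiff s f x := by simp [lamRep, hs]

lemma fracDiff_smul (s c : ℝ) (f : E3 → ℝ) (x : E3) :
    fracDiff s (c • f) x = c * fracDiff s f x := by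
  simp only [fracDiff, Pi.smul_apply, smul_eq_mul, ← mul_sub]
  exact integral_const_mul _ _

lemma lamRep_smul (s c : ℝ) (f : E3 → ℝ) : lamRep s (c • f) = c • lamRep s f := by
  by_cases hs : s = 0
  · subst hs; simp [lamRep_zero]
  · rw [lamRep_of_ne hs, lamRep_of_ne hs]
    ext x
    simp only [fracDiff_smul, Pi.smul_apply, smul_eq_mul]
    ring

/-- Hedberg's bound followed by Young's inequality pointwise; the maximal theorem at exponents 2 and
`k` then removes the maximal functions. For `s = 0` no maximal function is needed. The estimate is
additive rather than homogeneous in `f`. -/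
lemma lintegral_lamRep_le {s σ r k m : ℝ} (h : Exponents s σ r k m) :
    ∃ C : ℝ≥0∞, C ≠ ⊤ ∧ ∀ f : E3 → ℝ, ContDiff ℝ 1 f → ∫⁻ x, ‖lamRep s f x‖ₑ ^ r ≤
      C * ((∫⁻ x, ‖f x‖ₑ ^ (2 : ℝ)) + (∫⁻ x, ‖f x‖ₑ ^ k) + ∫⁻ x, ‖fderiv ℝ f x‖ₑ ^ (2 : ℝ)) := by
  have hr0 : 0 ≤ r := by linarith [h.r_ge]
  rcases h.s_nonneg.eq_or_lt with hs | hs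
  · subst hs
    refine ⟨1, ENNReal.one_ne_top, fun f hf => ?_⟩
    have hc := hf.continuous
    rw [lamRep_zero, one_mul]
    calc ∫⁻ x, ‖f x‖ₑ ^ r ≤ ∫⁻ x, (‖f x‖ₑ ^ (2 : ℝ) + ‖f x‖ₑ ^ k) :=
          lintegral_mono fun x => rpow_le_sq_add_rpow h.r_ge h.r_le _
      _ = (∫⁻ x, ‖f x‖ₑ ^ (2 : ℝ)) + ∫⁻ x, ‖f x‖ₑ ^ k :=
          lintegral_add_left (by fun_prop) _
      _ ≤ _ := le_self_add
  have hs1 : s < 1 := h.s_le.trans_lt h.σ_lt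
  have hk2 : 2 ≤ k := h.r_ge.trans h.r_le
  obtain ⟨C2, hC2, H2⟩ := lintegral_hlMax_rpow_le (p := 2) one_lt_two
  obtain ⟨Ck, hCk, Hk⟩ := lintegral_hlMax_rpow_le (p := k) (by linarith)
  set c0 : ℝ≥0∞ := ‖(lamConst s)⁻¹‖ₑ *
    (ENNReal.ofReal (1 / (1 - s) + 1 / s) * volume (Metric.ball (0 : E3) 1)) with hc0
  have hc0t : c0 ≠ ⊤ := ENNReal.mul_ne_top (by simp)
    (ENNReal.mul_ne_top ENNReal.ofReal_ne_top measure_ball_lt_top.ne)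
  set d : ℝ → ℝ≥0∞ := fun p => 2 ^ (p - 1) with hd
  have hdt : ∀ {p : ℝ}, 1 ≤ p → d p ≠ ⊤ := fun hp =>
    ENNReal.rpow_ne_top_of_nonneg (by linarith) (by simp)
  set C : ℝ≥0∞ := d 2 * (1 + C2) + d k * (1 + Ck) + C2 with hC
  have hCt : C ≠ ⊤ := by
    have h2 := hdt (p := 2) one_le_two
    have h3 := hdt (p := k) (by linarith)
    simp [hC, ENNReal.add_eq_top, ENNReal.mul_eq_top, hC2, hCk, h2, h3]
  refine ⟨c0 ^ r * C, ENNReal.mul_ne_top (ENNReal.rpow_ne_top_of_nonneg hr0 hc0t) hCt,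
    fun f hf => ?_⟩
  have hfm : Measurable fun x => ‖f x‖ₑ := hf.continuous.measurable.enorm
  have hdm : Measurable fun x => ‖fderiv ℝ f x‖ₑ :=
    (hf.continuous_fderiv (by simp)).measurable.enorm
  set M := hlMax fun y => ‖f y‖ₑ
  set N := hlMax fun y => ‖fderiv ℝ f y‖ₑ
  have hMm : Measurable M := measurable_hlMax _
  have hNm : Measurable N := measurable_hlMax _
  set I2 := ∫⁻ x, ‖f x‖ₑ ^ (2 : ℝ)
  set Ik := ∫⁻ x, ‖f x‖ₑ ^ k
  set D2 := ∫⁻ x, ‖fderiv ℝ f x‖ₑ ^ (2 : ℝ)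
  have hpt : ∀ x, ‖lamRep s f x‖ₑ ^ r ≤ c0 ^ r * ((‖f x‖ₑ + M x) ^ (2 : ℝ) + (‖f x‖ₑ + M x) ^ k +
      N x ^ (2 : ℝ)) := by
    intro x
    have h1 : ‖lamRep s f x‖ₑ ≤ c0 * ((‖f x‖ₑ + M x) ^ (1 - s) * N x ^ s) := by
      rw [lamRep_of_ne hs.ne', enorm_mul, hc0, mul_assoc]
      gcongr
      exact enorm_fracDiff_le hs hs1 hf x
    calc ‖lamRep s f x‖ₑ ^ r ≤ (c0 * ((‖f x‖ₑ + M x) ^ (1 - s) * N x ^ s)) ^ r :=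
          ENNReal.rpow_le_rpow h1 hr0
      _ = c0 ^ r * ((‖f x‖ₑ + M x) ^ (1 - s) * N x ^ s) ^ r := ENNReal.mul_rpow_of_nonneg _ _ hr0
      _ ≤ _ := by gcongr; exact h.young _ _
  have hA : ∀ {p : ℝ} {Cp : ℝ≥0∞}, 1 ≤ p →
      (∀ f : E3 → ℝ≥0∞, Measurable f → ∫⁻ x, hlMax f x ^ p ≤ Cp * ∫⁻ x, f x ^ p) →
      ∫⁻ x, (‖f x‖ₑ + M x) ^ p ≤ d p * (1 + Cp) * ∫⁻ x, ‖f x‖ₑ ^ p := by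
    intro p Cp hp H
    calc ∫⁻ x, (‖f x‖ₑ + M x) ^ p ≤ ∫⁻ x, d p * (‖f x‖ₑ ^ p + M x ^ p) :=
          lintegral_mono fun x => ENNReal.rpow_add_le_mul_rpow_add_rpow _ _ hp
      _ = d p * ((∫⁻ x, ‖f x‖ₑ ^ p) + ∫⁻ x, M x ^ p) := by
          rw [lintegral_const_mul _ (by fun_prop), lintegral_add_left (by fun_prop)]
      _ ≤ d p * ((∫⁻ x, ‖f x‖ₑ ^ p) + Cp * ∫⁻ x, ‖f x‖ₑ ^ p) := by
          gcongr; exact H _ hfm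
      _ = _ := by ring
  calc ∫⁻ x, ‖lamRep s f x‖ₑ ^ r
      ≤ ∫⁻ x, c0 ^ r * ((‖f x‖ₑ + M x) ^ (2 : ℝ) + (‖f x‖ₑ + M x) ^ k + N x ^ (2 : ℝ)) :=
        lintegral_mono hpt
    _ = c0 ^ r * ((∫⁻ x, (‖f x‖ₑ + M x) ^ (2 : ℝ)) + (∫⁻ x, (‖f x‖ₑ + M x) ^ k) +
        ∫⁻ x, N x ^ (2 : ℝ)) := by
        rw [lintegral_const_mul _ (by fun_prop), lintegral_add_left (by fun_prop),
          lintegral_add_left (by fun_prop)]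
    _ ≤ c0 ^ r * (d 2 * (1 + C2) * I2 + d k * (1 + Ck) * Ik + C2 * D2) := by
        gcongr
        · exact hA one_le_two H2
        · exact hA (by linarith) Hk
        · exact H2 _ hdm
    _ ≤ c0 ^ r * (C * I2 + C * Ik + C * D2) := by
        gcongr
        · exact le_self_add.trans le_self_add
        · exact le_add_self.trans le_self_add
        · exact le_add_self
    _ = _ := by ring

lemma eLpNorm_le_of_lintegral_rpow_le {F : Type*} [NormedAddCommGroup F] {p : ℝ} (hp : 0 < p)
    {f : E3 → F} {c : ℝ≥0∞} (h : ∫⁻ x, ‖f x‖ₑ ^ p ≤ c) :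
    eLpNorm f (ENNReal.ofReal p) volume ≤ c ^ (1 / p) := by
  rw [eLpNorm_eq_lintegral_rpow_enorm_toReal (by simpa using hp) ENNReal.ofReal_ne_top,
    ENNReal.toReal_ofReal hp.le]
  gcongr

/-- The size of a function together with that of its gradient. -/
structure SizeLe (k : ℝ) (f : E3 → ℝ) (lam : ℝ≥0∞) : Prop where
  two : eLpNorm f 2 volume ≤ lam
  exponent : eLpNorm f (ENNReal.ofReal k) volume ≤ lam
  deriv : eLpNorm (fderiv ℝ f) 2 volume ≤ lam

/-- Dividing `f` by `lam` makes all three integrals in `lintegral_lamRep_le` at most one. Since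
`lamRep` is homogeneous of degree one, undoing the normalization yields a bound linear in `lam`. -/
lemma eLpNorm_lamRep_le {s σ r k m : ℝ} (h : Exponents s σ r k m) :
    ∃ C : ℝ≥0∞, C ≠ ⊤ ∧ ∀ (f : E3 → ℝ) (lam : ℝ≥0∞), ContDiff ℝ 1 f → lam ≠ 0 → lam ≠ ⊤ →
      SizeLe k f lam → eLpNorm (lamRep s f) (ENNReal.ofReal r) volume ≤ C * lam := by
  obtain ⟨C, hC, H⟩ := lintegral_lamRep_le h
  have hr0 : 0 < r := by linarith [h.r_ge]
  have hk0 : 0 < k := by linarith [h.r_ge, h.r_le]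
  refine ⟨(C * (1 + 1 + 1)) ^ (1 / r), ENNReal.rpow_ne_top_of_nonneg (by positivity)
    (ENNReal.mul_ne_top hC (by simp)), fun f lam hf h0 ht hs => ?_⟩
  have hl0 : 0 < lam.toReal := ENNReal.toReal_pos h0 ht
  set c := lam.toReal⁻¹ with hc
  have hce : ‖c‖ₑ = lam⁻¹ := by
    rw [Real.enorm_eq_ofReal (by positivity), hc, ENNReal.ofReal_inv_of_pos hl0,
      ENNReal.ofReal_toReal ht]
  have hfd : fderiv ℝ (c • f) = c • fderiv ℝ f := by
    ext1 x; exact fderiv_const_smul ((hf.differentiable (by simp)) x) c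
  have hle : ∀ {F : Type} [NormedAddCommGroup F] [NormedSpace ℝ F] {g : E3 → F} {p : ℝ}, 0 < p →
      eLpNorm g (ENNReal.ofReal p) volume ≤ lam → ∫⁻ x, ‖(c • g) x‖ₑ ^ p ≤ 1 := by
    intro F _ _ g p hp hg
    have e : ∫⁻ x, ‖(c • g) x‖ₑ ^ p = eLpNorm (c • g) (ENNReal.ofReal p) volume ^ p :=
      (lintegral_enorm_rpow_le_of_eLpNorm hp).symm
    rw [e]
    refine ENNReal.rpow_le_one ?_ hp.le
    rw [eLpNorm_const_smul, hce]
    calc lam⁻¹ * eLpNorm g (ENNReal.ofReal p) volume ≤ lam⁻¹ * lam := by gcongr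
      _ = 1 := ENNReal.inv_mul_cancel h0 ht
  have hcf : ContDiff ℝ 1 (c • f) := contDiff_const.smul hf
  have key := H (c • f) hcf
  have b1 := hle (g := f) two_pos (by simpa using hs.two)
  have b2 := hle (g := f) hk0 hs.exponent
  have b3 := hle (g := fderiv ℝ f) two_pos (by simpa using hs.deriv)
  rw [← hfd] at b3
  have key2 : ∫⁻ x, ‖lamRep s (c • f) x‖ₑ ^ r ≤ C * (1 + 1 + 1) := key.trans (by gcongr)
  have key3 := eLpNorm_le_of_lintegral_rpow_le hr0 key2
  rw [lamRep_smul, eLpNorm_const_smul, hce] at key3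
  have e2 : eLpNorm (lamRep s f) (ENNReal.ofReal r) volume =
      lam * (lam⁻¹ * eLpNorm (lamRep s f) (ENNReal.ofReal r) volume) := by
    rw [← mul_assoc, ENNReal.mul_inv_cancel h0 ht, one_mul]
  rw [e2, mul_comm]
  gcongr

/-- Bounded square integrable functions lie in `L^p` for `p ≥ 2`. -/
lemma memLp_of_bounded {f : E3 → ℝ} {A p : ℝ} (hf : MemLp f 2) (hA : ∀ x, ‖f x‖ ≤ A)
    (hp : 2 ≤ p) : MemLp f (ENNReal.ofReal p) := by
  refine ⟨hf.1, ?_⟩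
  have hp0 : 0 < p := by linarith
  rw [eLpNorm_lt_top_iff_lintegral_rpow_enorm_lt_top (by simpa using hp0) ENNReal.ofReal_ne_top,
    ENNReal.toReal_ofReal hp0.le]
  have h2 : ∫⁻ x, ‖f x‖ₑ ^ (2 : ℝ) < ⊤ := by
    have := lintegral_enorm_rpow_le_of_eLpNorm (f := f) two_pos
    rw [ENNReal.ofReal_ofNat] at this
    rw [← this]
    exact ENNReal.rpow_lt_top_of_nonneg zero_le_two hf.2.ne
  calc ∫⁻ x, ‖f x‖ₑ ^ p ≤ ∫⁻ x, ENNReal.ofReal A ^ (p - 2) * ‖f x‖ₑ ^ (2 : ℝ) := by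
        refine lintegral_mono fun x => ?_
        have e : ‖f x‖ₑ ^ p = ‖f x‖ₑ ^ (p - 2) * ‖f x‖ₑ ^ (2 : ℝ) := by
          rw [← ENNReal.rpow_add_of_nonneg _ _ (by linarith) zero_le_two]; ring_nf
        rw [e]
        gcongr
        rw [← ofReal_norm]; exact ENNReal.ofReal_le_ofReal (hA x)
    _ = ENNReal.ofReal A ^ (p - 2) * ∫⁻ x, ‖f x‖ₑ ^ (2 : ℝ) :=
        lintegral_const_mul'' _ (hf.1.enorm.pow_const _)
    _ < ⊤ := ENNReal.mul_lt_top (ENNReal.rpow_lt_top_of_nonneg (by linarith)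
        ENNReal.ofReal_ne_top) h2

lemma Lam_zero (φ : 𝓢(E3, ℝ)) (x : E3) : Lam 0 φ x = φ x := by
  unfold Lam
  simp only [Real.rpow_zero, Complex.ofReal_one, one_mul]
  rw [fourier_ofReal]
  have h := SchwartzMap.fourierInv_coe (𝓕 (toComplex φ) : 𝓢(E3, ℂ))
  rw [FourierTransform.fourierInv_fourier_eq] at h
  have h2 : 𝓕⁻ (fun ξ : E3 => (𝓕 (toComplex φ) : 𝓢(E3, ℂ)) ξ) x = toComplex φ x :=
    (congrFun h x).symm
  rw [h2]; simp

variable {s σ r k m : ℝ}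

lemma integral_mul_Lam_eq_lamRep (hs0 : 0 ≤ s) (hs1 : s < 1) {f : E3 → ℝ} (hf : ContDiff ℝ 1 f)
    {A B : ℝ} (hA : ∀ x, ‖f x‖ ≤ A) (hB : ∀ x, ‖fderiv ℝ f x‖ ≤ B) (φ : 𝓢(E3, ℝ)) :
    ∫ x, f x * Lam s φ x = ∫ x, lamRep s f x * φ x := by
  rcases hs0.eq_or_lt with rfl | hs
  · simp only [lamRep_zero, Lam_zero]
  · have h := integral_mul_Lam hs hs1 hf hA hB φ
    have hc := lamConst_pos hs hs1
    rw [lamRep_of_ne hs.ne']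
    simp_rw [mul_assoc]
    rw [integral_const_mul, ← h, ← mul_assoc, inv_mul_cancel₀ hc.ne', one_mul]

lemma aestronglyMeasurable_lamRep {f : E3 → ℝ} (hf : Continuous f) :
    AEStronglyMeasurable (lamRep s f) := by
  by_cases hs : s = 0
  · subst hs; rw [lamRep_zero]; exact hf.aestronglyMeasurable
  · rw [lamRep_of_ne hs]
    exact ((stronglyMeasurable_fracDiff hf).const_mul _).aestronglyMeasurable

/-- The multiplier estimate for smooth functions. -/
lemma Exponents.eLpNorm_mul_le_of_smooth (h : Exponents s σ r k m) :
    ∃ C : ℝ≥0∞, C ≠ ⊤ ∧ ∀ (G f : E3 → ℝ) (lam : ℝ≥0∞), ContDiff ℝ 1 f → MemLp f 2 →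
      (∃ A, ∀ x, ‖f x‖ ≤ A) → (∃ B, ∀ x, ‖fderiv ℝ f x‖ ≤ B) → lam ≠ 0 → lam ≠ ⊤ →
      SizeLe k f lam →
      eLpNorm (fun x => G x * f x) (ENNReal.ofReal m) volume ≤ C * (multNorm s r m G * lam) := by
  obtain ⟨C, hC, H⟩ := eLpNorm_lamRep_le h
  refine ⟨C, hC, fun G f lam hf hf2 ⟨A, hA⟩ ⟨B, hB⟩ h0 ht hs => ?_⟩
  have hg := H f lam hf h0 ht hs
  have hs1 : s < 1 := h.s_le.trans_lt h.σ_lt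
  have hr := h.r_ge
  have hsr : 0 ≤ s * r := mul_nonneg h.s_nonneg (by linarith)
  -- The Sobolev exponent `3r / (3 - sr)` is at least 2, so boundedness and square integrability of
  -- `f` suffice for membership.
  have hS : IsHomSobolev s r f (lamRep s f) :=
    { memLp_fun := by
        refine memLp_of_bounded hf2 hA ?_
        rw [le_div_iff₀ (by linarith [h.subcritical])]
        nlinarith
      memLp_lam := ⟨aestronglyMeasurable_lamRep hf.continuous,
        hg.trans_lt (ENNReal.mul_lt_top hC.lt_top ht.lt_top)⟩
      weak_lam := integral_mul_Lam_eq_lamRep h.s_nonneg hs1 hf hA hB }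
  -- The supremum defining the multiplier norm omits functions of zero Sobolev norm. Injectivity of
  -- `Λ^s` shows that such an `f` vanishes almost everywhere.
  by_cases hz : eLpNorm (lamRep s f) (ENNReal.ofReal r) volume = 0
  · have hz' : lamRep s f =ᵐ[volume] 0 :=
      (eLpNorm_eq_zero_iff hS.memLp_lam.1 (by simp; linarith)).1 hz
    have hf0 : f =ᵐ[volume] 0 := ae_eq_zero_of_Lam h.s_nonneg hf2 fun φ h1 h2 => by
      have := hS.weak_lam (testS φ h1 h2)
      rw [show ∫ x, f x * Lam s φ x = ∫ x, f x * Lam s (testS φ h1 h2) x from rfl, this]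
      refine integral_eq_zero_of_ae ?_
      filter_upwards [hz'] with x hx
      simp [hx]
    have : (fun x => G x * f x) =ᵐ[volume] 0 := by
      filter_upwards [hf0] with x hx
      simp [hx]
    rw [eLpNorm_congr_ae this]; simp
  · have h1 : eLpNorm (fun x => G x * f x) (ENNReal.ofReal m) volume /
        eLpNorm (lamRep s f) (ENNReal.ofReal r) volume ≤ multNorm s r m G :=
      le_iSup_of_le f (le_iSup_of_le (lamRep s f) (le_iSup_of_le hS (le_iSup_of_le hz le_rfl)))
    rw [ENNReal.div_le_iff hz hS.memLp_lam.2.ne] at h1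
    refine h1.trans ?_
    calc multNorm s r m G * eLpNorm (lamRep s f) (ENNReal.ofReal r) volume
        ≤ multNorm s r m G * (C * lam) := by gcongr
      _ = _ := by ring

/-- A function with weak partial derivatives `D i`, all of controlled size. -/
structure WeakSizeLe (k : ℝ) (f : E3 → ℝ) (D : Fin 3 → E3 → ℝ) (lam : ℝ≥0∞) : Prop where
  memLp : MemLp f 2
  weakDeriv : ∀ i, HasWeakDeriv (EuclideanSpace.single i 1) f (D i)
  two : eLpNorm f 2 volume ≤ lam
  exponent : eLpNorm f (ENNReal.ofReal k) volume ≤ lam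
  deriv : ∀ i, eLpNorm (D i) 2 volume ≤ lam

lemma norm_clm_le_sum (L : E3 →L[ℝ] ℝ) :
    ‖L‖ ≤ ∑ i : Fin 3, ‖L (EuclideanSpace.single i 1)‖ := by
  refine L.opNorm_le_bound (by positivity) fun v => ?_
  conv_lhs => rw [sum_single v]
  rw [map_sum, Finset.sum_mul]
  refine (norm_sum_le _ _).trans (Finset.sum_le_sum fun i _ => ?_)
  rw [map_smul, norm_smul, mul_comm]
  gcongr
  exact PiLp.norm_apply_le v i

lemma WeakSizeLe.smear {f : E3 → ℝ} {D : Fin 3 → E3 → ℝ} {lam : ℝ≥0∞} (hk : 1 ≤ k)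
    (h : WeakSizeLe k f D lam) {ρ : E3 → ℝ} (hρ : IsMollifier ρ) :
    SizeLe k (smear ρ f) (3 * lam) := by
  have h2 : ∀ {g : E3 → ℝ}, AEStronglyMeasurable g →
      eLpNorm (FractionalMHD.smear ρ g) 2 volume ≤ eLpNorm g 2 volume := fun hg => by
    simpa using hρ.eLpNorm_smear_le one_le_two hg
  have h13 : lam ≤ 3 * lam := by
    calc lam = 1 * lam := (one_mul _).symm
      _ ≤ 3 * lam := by gcongr; norm_num
  refine ⟨(h2 h.memLp.1).trans (h.two.trans h13),
    (hρ.eLpNorm_smear_le hk h.memLp.1).trans (h.exponent.trans h13), ?_⟩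
  have hm : ∀ i, AEStronglyMeasurable (FractionalMHD.smear ρ (D i)) := fun i =>
    (hρ.contDiff_smear (h.weakDeriv i).locallyIntegrable_deriv).continuous.aestronglyMeasurable
  calc eLpNorm (fderiv ℝ (FractionalMHD.smear ρ f)) 2 volume
      ≤ eLpNorm (∑ i : Fin 3, fun x => ‖FractionalMHD.smear ρ (D i) x‖) 2 volume := by
        refine eLpNorm_mono_real fun x => ?_
        refine (norm_clm_le_sum _).trans (le_of_eq ?_)
        rw [Finset.sum_apply]
        exact Finset.sum_congr rfl fun i _ => by rw [(h.weakDeriv i).fderiv_smear hρ]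
    _ ≤ ∑ i : Fin 3, eLpNorm (fun x => ‖FractionalMHD.smear ρ (D i) x‖) 2 volume :=
        eLpNorm_sum_le (fun i _ => (hm i).norm) one_le_two
    _ ≤ ∑ _i : Fin 3, lam := Finset.sum_le_sum fun i _ => by
        rw [eLpNorm_norm]
        exact (h2 (h.weakDeriv i).locallyIntegrable_deriv.aestronglyMeasurable).trans (h.deriv i)
    _ = 3 * lam := by simp

/-- The multiplier estimate for functions with weak derivatives. -/
lemma Exponents.eLpNorm_mul_le (h : Exponents s σ r k m) :
    ∃ C : ℝ≥0∞, C ≠ ⊤ ∧ ∀ (G f : E3 → ℝ) (D : Fin 3 → E3 → ℝ) (lam : ℝ≥0∞),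
      AEStronglyMeasurable G → lam ≠ ⊤ → WeakSizeLe k f D lam →
      eLpNorm (fun x => G x * f x) (ENNReal.ofReal m) volume ≤ C * (multNorm s r m G * lam) := by
  obtain ⟨C, hC, H⟩ := h.eLpNorm_mul_le_of_smooth
  refine ⟨C * 3, ENNReal.mul_ne_top hC (by simp), fun G f D lam hG ht hf => ?_⟩
  by_cases h0 : lam = 0
  · have hf0 : f =ᵐ[volume] 0 := by
      refine (eLpNorm_eq_zero_iff hf.memLp.1 two_ne_zero).1 ?_
      simpa [h0] using hf.two
    have : (fun x => G x * f x) =ᵐ[volume] 0 := by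
      filter_upwards [hf0] with x hx
      simp [hx]
    rw [eLpNorm_congr_ae this]; simp
  have hfl := hf.memLp.locallyIntegrable one_le_two
  have hc : ∀ n, ContDiff ℝ ∞ (smear (mol n) f) := fun n => (isMollifier_mol n).contDiff_smear hfl
  -- Fatou along mollifications of `f`, which are smooth and bounded with bounded gradient. The size
  -- `3 * lam` arises from summing the three partial derivatives.
  refine Lp.eLpNorm_le_of_ae_tendsto (u := atTop) (f := fun n x => G x * smear (mol n) f x)
    (Eventually.of_forall fun n => ?_)
    (fun n => hG.mul (hc n).continuous.aestronglyMeasurable) ?_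
  · obtain ⟨B, hB0, hB⟩ := (isMollifier_mol n).norm_fderiv_smear_le (F := ℝ)
    refine (H G (smear (mol n) f) (3 * lam) ((hc n).of_le (by simp))
      ((isMollifier_mol n).memLp_two_smear hf.memLp)
      ⟨_, fun x => norm_smear_le ((isMollifier_mol n).memLp 2) hf.memLp x⟩
      ⟨_, fun x => hB f hf.memLp x⟩ (by simp [h0]) (ENNReal.mul_ne_top (by simp) ht)
      (hf.smear (by linarith [h.r_ge, h.r_le]) (isMollifier_mol n))).trans (le_of_eq (by ring))
  · filter_upwards [ae_tendsto_smear_mol hfl] with x hx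
    exact hx.const_mul _

lemma HasWeakDeriv.translate {v : E3} {f g : E3 → ℝ} (h : HasWeakDeriv v f g) (t : E3) :
    HasWeakDeriv v (fun x => f (x + t)) (fun x => g (x + t)) := by
  have hl : ∀ {u : E3 → ℝ}, LocallyIntegrable u → LocallyIntegrable fun x => u (x + t) := by
    intro u hu
    exact (locallyIntegrable_map_homeomorph (Homeomorph.addRight t) (μ := volume)).1 (by
      rw [show (Homeomorph.addRight t : E3 → E3) = fun x => x + t from rfl,
        map_add_right_eq_self]
      exact hu)
  refine ⟨hl h.locallyIntegrable, hl h.locallyIntegrable_deriv, fun φ h1 h2 => ?_⟩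
  have h1' : ContDiff ℝ ∞ fun x => φ (x - t) := h1.comp (contDiff_id.sub contDiff_const)
  have h2' : HasCompactSupport fun x => φ (x - t) :=
    h2.comp_homeomorph (Homeomorph.subRight t)
  have key := h.integral_eq _ h1' h2'
  rw [← integral_add_right_eq_self _ t, ← integral_add_right_eq_self (fun x => g x * _) t] at key
  have hd : ∀ x, fderiv ℝ (fun y => φ (y - t)) (x + t) v = fderiv ℝ φ x v := by
    intro x
    rw [fderiv_comp_sub]; simp
  simpa [hd] using key

lemma eLpNorm_translate {F : Type*} [NormedAddCommGroup F] {f : E3 → F} {p : ℝ≥0∞}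
    (hf : AEStronglyMeasurable f) (t : E3) :
    eLpNorm (fun x => f (x + t)) p volume = eLpNorm f p volume :=
  eLpNorm_comp_measurePreserving hf (measurePreserving_add_right volume t)

lemma WeakSizeLe.translate {f : E3 → ℝ} {D : Fin 3 → E3 → ℝ} {lam : ℝ≥0∞}
    (h : WeakSizeLe k f D lam) (t : E3) :
    WeakSizeLe k (fun x => f (x + t)) (fun i x => D i (x + t)) lam where
  memLp := h.memLp.comp_measurePreserving (measurePreserving_add_right volume t)
  weakDeriv i := (h.weakDeriv i).translate t
  two := (eLpNorm_translate h.memLp.1 t).trans_le h.two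
  exponent := (eLpNorm_translate h.memLp.1 t).trans_le h.exponent
  deriv i := (eLpNorm_translate
    (h.weakDeriv i).locallyIntegrable_deriv.aestronglyMeasurable t).trans_le (h.deriv i)

/-- The trilinear multiplier estimate, with a smeared multiplier. -/
lemma Exponents.lintegral_mul_smear_le (h : Exponents s σ r k m) :
    ∃ C : ℝ≥0∞, C ≠ ⊤ ∧ ∀ (η a G f : E3 → ℝ) (D : Fin 3 → E3 → ℝ) (lam : ℝ≥0∞),
      IsMollifier η → AEStronglyMeasurable a → LocallyIntegrable G → lam ≠ ⊤ →
      WeakSizeLe k f D lam →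
      ∫⁻ x, ‖smear η G x * a x * f x‖ₑ ≤
        C * (eLpNorm a (ENNReal.ofReal k) volume * (multNorm s r m G * lam)) := by
  obtain ⟨C, hC, H⟩ := h.eLpNorm_mul_le
  refine ⟨C, hC, fun η a G f D lam hη ha hG ht hf => ?_⟩
  have hGm := hG.aestronglyMeasurable
  have hp := hη.isProbabilityMeasure
  have hm0 : 0 < m := by linarith [h.m_ge]
  have hk0 : 0 < k := by linarith [h.r_ge, h.r_le]
  set Z := C * (eLpNorm a (ENNReal.ofReal k) volume * (multNorm s r m G * lam)) with hZ
  have hmeas : AEMeasurable (fun z : E3 × E3 => ‖G (z.1 - z.2)‖ₑ * (‖a z.1‖ₑ * ‖f z.1‖ₑ))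
      (volume.prod (kernelMeasure η)) :=
    (aestronglyMeasurable_sub_prod hGm).enorm.mul
      ((ha.comp_fst.enorm).mul hf.memLp.1.comp_fst.enorm)
  -- The case `m = 1` would force `k⁻¹ = 0`, so Hölder applies with finite exponents above 1.
  have hHC : m.HolderConjugate k := by
    have := h.conj
    refine (Real.holderConjugate_iff).2 ⟨?_, this⟩
    have hk' : 0 < k⁻¹ := by positivity
    by_contra hc
    have hm1 : m = 1 := le_antisymm (not_lt.1 hc) h.m_ge
    rw [hm1] at this; simp at this; linarith
  -- Translating `x` by `t` moves the shift from the multiplier to `a` and `f`, whose norms are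
  -- translation invariant; hence smearing the multiplier does not enlarge the bound.
  have hin : ∀ t, ∫⁻ x, ‖G (x - t)‖ₑ * (‖a x‖ₑ * ‖f x‖ₑ) ≤ Z := by
    intro t
    have e : ∫⁻ x, ‖G (x - t)‖ₑ * (‖a x‖ₑ * ‖f x‖ₑ) =
        ∫⁻ x, ‖G x * f (x + t)‖ₑ * ‖a (x + t)‖ₑ := by
      rw [← lintegral_add_right_eq_self _ t]
      refine lintegral_congr fun x => ?_
      rw [add_sub_cancel_right, enorm_mul]; ring
    have hfm := (hf.translate t).memLp.1
    have ham : AEStronglyMeasurable fun x => a (x + t) :=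
      ha.comp_measurePreserving (measurePreserving_add_right volume t)
    rw [e]
    calc ∫⁻ x, ‖G x * f (x + t)‖ₑ * ‖a (x + t)‖ₑ
        ≤ (∫⁻ x, ‖G x * f (x + t)‖ₑ ^ m) ^ (1 / m) * (∫⁻ x, ‖a (x + t)‖ₑ ^ k) ^ (1 / k) :=
          ENNReal.lintegral_mul_le_Lp_mul_Lq volume hHC (hGm.mul hfm).enorm ham.enorm
      _ = eLpNorm (fun x => G x * f (x + t)) (ENNReal.ofReal m) volume *
            eLpNorm (fun x => a (x + t)) (ENNReal.ofReal k) volume := by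
          rw [eLpNorm_eq_lintegral_rpow_enorm_toReal (by simpa using hm0) ENNReal.ofReal_ne_top,
            eLpNorm_eq_lintegral_rpow_enorm_toReal (by simpa using hk0) ENNReal.ofReal_ne_top,
            ENNReal.toReal_ofReal hm0.le, ENNReal.toReal_ofReal hk0.le]
      _ ≤ C * (multNorm s r m G * lam) * eLpNorm a (ENNReal.ofReal k) volume := by
          rw [eLpNorm_translate ha t]
          gcongr
          exact H G _ _ lam hGm ht (hf.translate t)
      _ = Z := by rw [hZ]; ring
  calc ∫⁻ x, ‖smear η G x * a x * f x‖ₑ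
      ≤ ∫⁻ x, ∫⁻ t, ‖G (x - t)‖ₑ * (‖a x‖ₑ * ‖f x‖ₑ) ∂(kernelMeasure η) := by
        refine lintegral_mono fun x => ?_
        rw [enorm_mul, enorm_mul, mul_assoc]
        by_cases hfin : ‖a x‖ₑ * ‖f x‖ₑ = ⊤
        · exact absurd hfin (ENNReal.mul_ne_top (by simp) (by simp))
        rw [lintegral_mul_const' _ _ hfin]
        gcongr
        exact hη.enorm_smear_le G x
    _ = ∫⁻ t, (∫⁻ x, ‖G (x - t)‖ₑ * (‖a x‖ₑ * ‖f x‖ₑ)) ∂(kernelMeasure η) :=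
        lintegral_lintegral_swap hmeas
    _ ≤ ∫⁻ _t, Z ∂(kernelMeasure η) := lintegral_mono hin
    _ = Z := by simp

/-! ### Time intervals and primitives of time test functions -/

section Time

lemma isOpen_timeIoo (T : EReal) : IsOpen (timeIoo T) :=
  isOpen_Ioi.inter (isOpen_Iio.preimage continuous_coe_real_ereal)

lemma Ioc_subset_timeIoo {T : EReal} {b : ℝ} (hb : (b : EReal) < T) :
    Set.Ioc 0 b ⊆ timeIoo T := fun _ ht =>
  ⟨ht.1, (EReal.coe_le_coe_iff.2 ht.2).trans_lt hb⟩

lemma setIntegral_timeIoo {F : Type*} [NormedAddCommGroup F] [NormedSpace ℝ F] {T : EReal} {b : ℝ}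
    (hb0 : 0 ≤ b) (hb : (b : EReal) < T) {f : ℝ → F} (hf : ∀ t, b < t → f t = 0) :
    ∫ t, f t ∂(timeMeasure T) = ∫ t in (0 : ℝ)..b, f t := by
  rw [intervalIntegral.integral_of_le hb0, timeMeasure]
  refine (setIntegral_eq_of_subset_of_forall_sdiff_eq_zero (isOpen_timeIoo T).measurableSet
    (Ioc_subset_timeIoo hb) fun t ht => hf t ?_)
  by_contra hc
  exact ht.2 ⟨ht.1.1, not_lt.1 hc⟩

instance (T : EReal) : IsLocallyFiniteMeasure (timeMeasure T) := by
  unfold timeMeasure; infer_instance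

lemma intervalIntegrable_of_locallyIntegrable {F : Type*} [NormedAddCommGroup F] {f : ℝ → F}
    (hf : LocallyIntegrable f) (a b : ℝ) : IntervalIntegrable f volume a b :=
  (hf.integrableOn_isCompact isCompact_uIcc).intervalIntegrable

lemma exists_bound_of_memLp_top {F X : Type*} [NormedAddCommGroup F] [MeasurableSpace X]
    {μ : Measure X} {f : X → F} (hf : MemLp f ⊤ μ) : ∃ C : ℝ, 0 ≤ C ∧ ∀ᵐ x ∂μ, ‖f x‖ ≤ C := by
  refine ⟨(eLpNorm f ⊤ μ).toReal, ENNReal.toReal_nonneg, ?_⟩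
  have h2 := hf.2.ne
  rw [eLpNorm_exponent_top] at h2 ⊢
  filter_upwards [ae_le_eLpNormEssSup (f := f) (μ := μ)] with x hx
  rw [← toReal_enorm]
  exact ENNReal.toReal_mono h2 hx

lemma exists_bound_of_tsupport {T : EReal} (hT : 0 < T) {χ : ℝ → ℝ} (hc : HasCompactSupport χ)
    (hs : ∀ t ∈ tsupport χ, (t : EReal) < T) :
    ∃ b : ℝ, 0 < b ∧ (b : EReal) < T ∧ ∀ t, b ≤ t → χ t = 0 := by
  obtain ⟨M, hM, hM'⟩ : ∃ M : ℝ, (M : EReal) < T ∧ ∀ t ∈ tsupport χ, t ≤ M := by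
    rcases (tsupport χ).eq_empty_or_nonempty with h | h
    · exact ⟨0, hT, by simp [h]⟩
    · obtain ⟨M, hM, hm⟩ := hc.isCompact.exists_isGreatest h
      exact ⟨M, hs M hM, hm⟩
  obtain ⟨b, hb1, hb2⟩ := EReal.lt_iff_exists_real_btwn.1
    (max_lt hM (by exact_mod_cast hT : ((0 : ℝ) : EReal) < T))
  rw [max_lt_iff, EReal.coe_lt_coe_iff, EReal.coe_lt_coe_iff] at hb1
  refine ⟨b, hb1.2, hb2, fun t ht => ?_⟩
  by_contra hne
  have := hM' t (subset_tsupport χ hne)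
  linarith [hb1.1]

/-- A primitive of a test function on `(0, T)`, cut off in the past. -/
lemma exists_primitive {T : EReal} (hT : 0 < T) {ζ : ℝ → ℝ} (h1 : ContDiff ℝ ∞ ζ)
    (h2 : HasCompactSupport ζ) (h3 : tsupport ζ ⊆ timeIoo T) :
    ∃ (χ : ℝ → ℝ) (b : ℝ), ContDiff ℝ ∞ χ ∧ HasCompactSupport χ ∧
      (∀ t ∈ tsupport χ, (t : EReal) < T) ∧ 0 < b ∧ (b : EReal) < T ∧
      (∀ t, b ≤ t → χ t = 0) ∧ (∀ t, b ≤ t → ζ t = 0) ∧ (∀ t, 0 < t → deriv χ t = ζ t) ∧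
      χ 0 = -∫ t in (0 : ℝ)..b, ζ t := by
  obtain ⟨b, hb0, hbT, hb⟩ := exists_bound_of_tsupport hT h2 fun t ht => (h3 ht).2
  -- Integrating from the right endpoint `b` makes the primitive vanish after `b`.
  set Z : ℝ → ℝ := fun t => ∫ τ in b..t, ζ τ with hZ
  have hZd : ∀ t, HasDerivAt Z (ζ t) t := fun t =>
    intervalIntegral.integral_hasDerivAt_right (h1.continuous.intervalIntegrable _ _)
      (h1.continuous.stronglyMeasurableAtFilter _ _) h1.continuous.continuousAt
  have hZs : ContDiff ℝ ∞ Z := by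
    rw [contDiff_infty_iff_deriv]
    refine ⟨fun t => (hZd t).differentiableAt, ?_⟩
    rw [show deriv Z = ζ from funext fun t => (hZd t).deriv]
    exact h1
  have hZb : ∀ t, b ≤ t → Z t = 0 := by
    intro t ht
    rw [hZ]
    refine intervalIntegral.integral_zero_ae (ae_of_all _ fun τ hτ => ?_)
    rw [Set.uIoc_of_le ht] at hτ
    exact hb τ hτ.1.le
  -- Before the support of `ζ` the primitive is a possibly nonzero constant. The cutoff acts only
  -- between times -2 and -1, outside the range seen by the equation.
  set θ : ℝ → ℝ := fun t => Real.smoothTransition (t + 2)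
  have hθ : ContDiff ℝ ∞ θ := Real.smoothTransition.contDiff.comp (contDiff_id.add contDiff_const)
  have hsupp : Function.support (fun t => θ t * Z t) ⊆ Set.Icc (-2) b := by
    intro t ht
    rw [Function.mem_support] at ht
    constructor
    · by_contra hc
      apply ht
      rw [show θ t = 0 from Real.smoothTransition.zero_of_nonpos (by linarith [not_le.1 hc]),
        zero_mul]
    · by_contra hc
      apply ht
      rw [hZb t (not_le.1 hc).le, mul_zero]
  have hts : tsupport (fun t => θ t * Z t) ⊆ Set.Icc (-2) b :=
    closure_minimal hsupp isClosed_Icc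
  refine ⟨fun t => θ t * Z t, b, hθ.mul hZs,
    isCompact_Icc.of_isClosed_subset (isClosed_tsupport _) hts, fun t ht => ?_, hb0, hbT,
    fun t ht => by simp only [hZb t ht, mul_zero], hb, fun t ht => ?_, ?_⟩
  · exact (EReal.coe_le_coe_iff.2 (hts ht).2).trans_lt hbT
  · have : (fun t => θ t * Z t) =ᶠ[𝓝 t] Z := by
      filter_upwards [lt_mem_nhds ht] with τ hτ
      rw [show θ τ = 1 from Real.smoothTransition.one_of_one_le (by linarith), one_mul]
    rw [this.deriv_eq, (hZd t).deriv]
  · have : θ 0 = 1 := Real.smoothTransition.one_of_one_le (by norm_num)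
    simp only [this, one_mul, hZ]
    rw [intervalIntegral.integral_symm]

end Time

/-! ### Weak evolution equations in a Hilbert space -/

section Evolution

variable {H : Type*} [NormedAddCommGroup H] [InnerProductSpace ℝ H] [CompleteSpace H]

/-- `v' = F` on `(0, T)` with `v(0) = v₀`, tested against the elements of `𝒟`. -/
def IsWeakEvolution (T : EReal) (𝒟 : Set H) (v₀ : H) (v F : ℝ → H) : Prop :=
  ∀ φ ∈ 𝒟, ∀ χ : ℝ → ℝ, ContDiff ℝ ∞ χ → HasCompactSupport χ →
    (∀ t ∈ tsupport χ, (t : EReal) < T) →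
    ∫ t, (deriv χ t * ⟪v t, φ⟫ + χ t * ⟪F t, φ⟫) ∂(timeMeasure T) = -(χ 0 * ⟪v₀, φ⟫)

lemma integrable_of_memLp_top_mul {T : EReal} {g : ℝ → ℝ} (hg : MemLp g ⊤ (timeMeasure T))
    {χ : ℝ → ℝ} (hc : Continuous χ) (hs : HasCompactSupport χ) :
    Integrable (fun t => χ t * g t) (timeMeasure T) := by
  have h1 : Integrable χ (timeMeasure T) := (hc.integrable_of_hasCompactSupport hs).integrableOn
  exact h1.mul_of_top_left hg

/-- The representative is `v₀ + ∫ P F` with `P` the projection onto `K`. It is Lipschitz, so its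
squared norm is absolutely continuous and can be recovered from its derivative. Because `F` is
bounded in `H`, no mollification in time is needed. -/
theorem IsWeakEvolution.exists_continuous {T : EReal} (hT : 0 < T) {𝒟 : Set H} {v₀ : H}
    {v F : ℝ → H} (h : IsWeakEvolution T 𝒟 v₀ v F) {K : Submodule ℝ H}
    [K.HasOrthogonalProjection] (h𝒟 : 𝒟 ⊆ K)
    (hd : ∀ x ∈ K, (∀ φ ∈ 𝒟, ⟪x, φ⟫ = 0) → x = 0) (hv₀ : v₀ ∈ K)
    (hvK : ∀ᵐ t ∂(timeMeasure T), v t ∈ K) (hv : MemLp v ⊤ (timeMeasure T))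
    (hF : MemLp F ⊤ (timeMeasure T)) :
    ∃ w : ℝ → H, Continuous w ∧ w 0 = v₀ ∧ (∀ᵐ t ∂(timeMeasure T), w t = v t) ∧
      ∀ t ∈ timeIco T, ‖w t‖ ^ 2 = ‖v₀‖ ^ 2 + 2 * ∫ τ in Set.Ioo 0 t, ⟪F τ, v τ⟫ := by
  have hUo := isOpen_timeIoo T
  have hUm := hUo.measurableSet
  -- Elements of `𝒟` see only the `K`-component of the force. After projecting the force, the
  -- candidate `w` stays in `K`.
  set P := K.starProjection
  have hPK : ∀ {x : H}, x ∈ K → P x = x := fun hx => Submodule.starProjection_eq_self_iff.2 hx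
  set F' : ℝ → H := (timeIoo T).indicator F with hF'
  have hF'm : MemLp F' ⊤ (volume : Measure ℝ) := (memLp_indicator_iff_restrict hUm).2 hF
  set G : ℝ → H := fun t => P (F' t) with hG
  have hGm : MemLp G ⊤ (volume : Measure ℝ) := P.comp_memLp' hF'm
  have hGl : LocallyIntegrable G := hGm.locallyIntegrable le_top
  have hGi : ∀ a b, IntervalIntegrable G volume a b := intervalIntegrable_of_locallyIntegrable hGl
  obtain ⟨C, hC0, hC⟩ := exists_bound_of_memLp_top hGm
  set w : ℝ → H := fun t => v₀ + ∫ τ in (0 : ℝ)..t, G τ with hw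
  have hwc : Continuous w := continuous_const.add
    (intervalIntegral.continuous_primitive hGi 0)
  have hw0 : w 0 = v₀ := by simp [hw]
  have hwd : ∀ᵐ t, HasDerivAt w (G t) t := by
    filter_upwards [_root_.LocallyIntegrable.ae_hasDerivAt_integral hGl] with t ht
    exact (ht 0).const_add v₀
  have hwK : ∀ t, P (w t) = w t := by
    intro t
    rw [hw, map_add, hPK hv₀, ← P.intervalIntegral_comp_comm (hGi 0 t)]
    congr 2
    ext τ
    exact hPK (Submodule.starProjection_apply_mem _ _)
  have hwmem : ∀ t, w t ∈ K := fun t => by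
    rw [← hwK t]; exact Submodule.starProjection_apply_mem _ _
  have hGφ : ∀ {φ : H}, φ ∈ K → ∀ t, ⟪G t, φ⟫ = ⟪F' t, φ⟫ := by
    intro φ hφ t
    rw [hG]
    simp only [P]
    rw [Submodule.inner_starProjection_left_eq_right]
    exact congrArg _ (hPK hφ)
  have hwφ : ∀ {φ : H} (t : ℝ), ⟪w t, φ⟫ = ⟪v₀, φ⟫ + ∫ τ in (0 : ℝ)..t, ⟪G τ, φ⟫ := by
    intro φ t
    rw [hw, inner_add_left, real_inner_comm φ (∫ τ in (0 : ℝ)..t, G τ)]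
    congr 1
    have := ((innerSL ℝ φ).intervalIntegral_comp_comm (hGi 0 t)).symm
    simp only [innerSL_apply_apply] at this
    rw [this]
    exact intervalIntegral.integral_congr fun τ _ => real_inner_comm _ _
  have hvl : LocallyIntegrableOn v (timeIoo T) volume :=
    locallyIntegrableOn_of_locallyIntegrable_restrict (hv.locallyIntegrable le_top)
  have hdl : LocallyIntegrableOn (fun t => v t - w t) (timeIoo T) volume :=
    hvl.sub (hwc.locallyIntegrable.locallyIntegrableOn _)
  have hae : ∀ᵐ t, t ∈ timeIoo T → v t - w t = 0 := by
    -- Du Bois-Reymond: for each `ζ` the vector `∫ ζ (v - w)` lies in `K`. Testing the equation with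
    -- a primitive `χ` of `ζ` shows that it is orthogonal to `𝒟`, so it is zero.
    refine hUo.ae_eq_zero_of_integral_contDiff_smul_eq_zero hdl fun ζ h1 h2 h3 => ?_
    obtain ⟨χ, b, c1, c2, c3, hb0, hbT, hχb, hζb, hχd, hχ0⟩ := exists_primitive hT h1 h2 h3
    have hζ0 : ∀ t, t ∉ timeIoo T → ζ t = 0 := fun t ht => by
      by_contra hc; exact ht (h3 (subset_tsupport _ hc))
    have hrest : ∫ t, ζ t • (v t - w t) = ∫ t, ζ t • (v t - w t) ∂(timeMeasure T) := by
      rw [timeMeasure, setIntegral_eq_integral_of_forall_compl_eq_zero]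
      intro t ht; rw [hζ0 t ht, zero_smul]
    have hi : Integrable (fun t => ζ t • (v t - w t)) (timeMeasure T) := by
      have i1 : Integrable (fun t => ζ t • v t) (timeMeasure T) :=
        ((h1.continuous.integrable_of_hasCompactSupport h2).integrableOn : Integrable ζ
          (timeMeasure T)).smul_of_top_left hv
      have i2 : Integrable (fun t => ζ t • w t) (timeMeasure T) :=
        ((h1.continuous.smul hwc).integrable_of_hasCompactSupport h2.smul_right).integrableOn
      refine (i1.sub i2).congr (ae_of_all _ fun t => ?_)
      simp only [Pi.sub_apply, smul_sub]
    rw [hrest]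
    refine hd _ ?_ fun φ hφ => ?_
    · have hmem : P (∫ t, ζ t • (v t - w t) ∂(timeMeasure T)) =
          ∫ t, ζ t • (v t - w t) ∂(timeMeasure T) := by
        rw [← ContinuousLinearMap.integral_comp_comm _ hi]
        refine integral_congr_ae ?_
        filter_upwards [hvK] with t ht
        rw [map_smul, map_sub, hwK, hPK ht]
      rw [← hmem]; exact Submodule.starProjection_apply_mem _ _
    · have hφK := h𝒟 hφ
      have e1 : ⟪∫ t, ζ t • (v t - w t) ∂(timeMeasure T), φ⟫ =
          ∫ t, (ζ t * ⟪v t, φ⟫ - ζ t * ⟪w t, φ⟫) ∂(timeMeasure T) := by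
        rw [real_inner_comm, ← innerSL_apply_apply ℝ,
          ← ContinuousLinearMap.integral_comp_comm _ hi]
        refine integral_congr_ae (ae_of_all _ fun t => ?_)
        simp only [innerSL_apply_apply, inner_smul_right, inner_sub_right, real_inner_comm φ]
        ring
      have hvφ : MemLp (fun t => ⟪v t, φ⟫) ⊤ (timeMeasure T) := hv.inner_const φ
      have hFφ : MemLp (fun t => ⟪F t, φ⟫) ⊤ (timeMeasure T) := hF.inner_const φ
      have j1 : Integrable (fun t => ζ t * ⟪v t, φ⟫) (timeMeasure T) :=
        integrable_of_memLp_top_mul hvφ h1.continuous h2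
      have j2 : Integrable (fun t => ζ t * ⟪w t, φ⟫) (timeMeasure T) :=
        ((h1.continuous.mul (hwc.inner continuous_const)).integrable_of_hasCompactSupport
          h2.mul_right).integrableOn
      have j3 : Integrable (fun t => χ t * ⟪F t, φ⟫) (timeMeasure T) :=
        integrable_of_memLp_top_mul hFφ c1.continuous c2
      have hU : ∀ᵐ t ∂(timeMeasure T), t ∈ timeIoo T := ae_restrict_mem hUm
      have e2 := h φ hφ χ c1 c2 c3
      have e3 : ∫ t, (deriv χ t * ⟪v t, φ⟫ + χ t * ⟪F t, φ⟫) ∂(timeMeasure T) =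
          ∫ t, (ζ t * ⟪v t, φ⟫ + χ t * ⟪F t, φ⟫) ∂(timeMeasure T) := by
        refine integral_congr_ae ?_
        filter_upwards [hU] with t ht
        rw [hχd t ht.1]
      rw [e3, integral_add j1 j3, hχ0] at e2
      have e4 : ∫ t, χ t * ⟪F t, φ⟫ ∂(timeMeasure T) =
          ∫ t in (0 : ℝ)..b, χ t * ⟪G t, φ⟫ := by
        rw [← setIntegral_timeIoo hb0.le hbT fun t ht => by rw [hχb t ht.le, zero_mul]]
        refine integral_congr_ae ?_
        filter_upwards [hU] with t ht
        rw [hGφ hφK, hF', Set.indicator_of_mem ht]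
      have e5 : ∫ t, ζ t * ⟪w t, φ⟫ ∂(timeMeasure T) =
          ∫ t in (0 : ℝ)..b, ζ t * ⟪w t, φ⟫ :=
        setIntegral_timeIoo hb0.le hbT fun t ht => by rw [hζb t ht.le, zero_mul]
      set g0 : ℝ → ℝ := fun t => ⟪G t, φ⟫ with hg0
      have hg0l : LocallyIntegrable g0 := by
        have : MemLp g0 ⊤ (volume : Measure ℝ) := hGm.inner_const φ
        exact this.locallyIntegrable le_top
      set W0 : ℝ → ℝ := fun t => ∫ τ in (0 : ℝ)..t, g0 τ with hW0
      have hW0c : Continuous W0 := intervalIntegral.continuous_primitive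
        (intervalIntegrable_of_locallyIntegrable hg0l) 0
      -- The primitive `W0` need not be differentiable everywhere, so integration by parts is used
      -- in its absolutely continuous form.
      have acW : AbsolutelyContinuousOnInterval W0 0 b :=
        (intervalIntegrable_of_locallyIntegrable hg0l 0 b).absolutelyContinuousOnInterval_intervalIntegral (by simp)
      have acχ : AbsolutelyContinuousOnInterval χ 0 b :=
        (c1.of_le (by simp)).contDiffOn.absolutelyContinuousOnInterval
      have ibp := acχ.integral_deriv_mul_eq_sub acW
      rw [hχb b le_rfl, show W0 0 = 0 by simp [hW0], mul_zero, zero_mul, sub_zero] at ibp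
      have e6 : ∫ t in (0 : ℝ)..b, (deriv χ t * W0 t + χ t * deriv W0 t) =
          ∫ t in (0 : ℝ)..b, (ζ t * W0 t + χ t * g0 t) := by
        refine intervalIntegral.integral_congr_ae ?_
        filter_upwards [_root_.LocallyIntegrable.ae_hasDerivAt_integral hg0l] with t ht htm
        rw [Set.uIoc_of_le hb0.le] at htm
        rw [hχd t htm.1, (ht 0).deriv]
      have k1 : IntervalIntegrable (fun t => ζ t * W0 t) volume 0 b :=
        (h1.continuous.mul hW0c).intervalIntegrable _ _
      have k2 : IntervalIntegrable (fun t => χ t * g0 t) volume 0 b :=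
        (intervalIntegrable_of_locallyIntegrable hg0l 0 b).continuousOn_mul c1.continuous.continuousOn
      have k3 : IntervalIntegrable (fun t => ζ t * ⟪v₀, φ⟫) volume 0 b :=
        (h1.continuous.mul continuous_const).intervalIntegrable _ _
      rw [e6, intervalIntegral.integral_add k1 k2] at ibp
      have e7 : ∫ t in (0 : ℝ)..b, ζ t * ⟪w t, φ⟫ =
          (∫ t in (0 : ℝ)..b, ζ t) * ⟪v₀, φ⟫ + ∫ t in (0 : ℝ)..b, ζ t * W0 t := by
        rw [← intervalIntegral.integral_mul_const, ← intervalIntegral.integral_add k3 k1]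
        refine intervalIntegral.integral_congr fun t _ => ?_
        simp only [hwφ t]
        rw [mul_add]
      rw [e1, integral_sub j1 j2, e5, e7]
      rw [e4] at e2
      linarith
  have hae' : ∀ᵐ t ∂(timeMeasure T), w t = v t := by
    rw [timeMeasure, ae_restrict_iff' hUm]
    filter_upwards [hae] with t ht htm
    exact (sub_eq_zero.1 (ht htm)).symm
  refine ⟨w, hwc, hw0, hae', fun t ht => ?_⟩
  have ht0 : 0 ≤ t := ht.1
  have hlip : ∀ a b : ℝ, ‖w a - w b‖ ≤ C * |a - b| := by
    intro a b
    have e : w a - w b = ∫ τ in b..a, G τ := by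
      rw [hw]
      simp only [add_sub_add_left_eq_sub]
      rw [intervalIntegral.integral_interval_sub_left (hGi 0 a) (hGi 0 b)]
    rw [e]
    exact intervalIntegral.norm_integral_le_of_norm_le_const_ae (by
      filter_upwards [hC] with τ hτ _ using hτ)
  have hbd : ∀ a ∈ Set.uIcc 0 t, ‖w a‖ ≤ ‖v₀‖ + C * t := by
    intro a ha
    rw [Set.uIcc_of_le ht0] at ha
    have h1 := hlip a 0
    rw [hw0, sub_zero, abs_of_nonneg ha.1] at h1
    have h2 : ‖w a‖ ≤ ‖v₀‖ + ‖w a - v₀‖ := by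
      calc ‖w a‖ = ‖v₀ + (w a - v₀)‖ := by congr 1; abel
        _ ≤ _ := norm_add_le _ _
    have h3 : C * a ≤ C * t := mul_le_mul_of_nonneg_left ha.2 hC0
    linarith
  have hac : AbsolutelyContinuousOnInterval (fun a => ‖w a‖ ^ 2) 0 t := by
    refine LipschitzOnWith.absolutelyContinuousOnInterval
      (K := ⟨2 * (‖v₀‖ + C * t) * C, by positivity⟩) (LipschitzOnWith.of_dist_le_mul ?_)
    intro a ha b hb
    rw [Real.dist_eq, Real.dist_eq]
    have e : ‖w a‖ ^ 2 - ‖w b‖ ^ 2 = (‖w a‖ + ‖w b‖) * (‖w a‖ - ‖w b‖) := by ring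
    rw [e, abs_mul, abs_of_nonneg (by positivity)]
    have h1 := (abs_norm_sub_norm_le (w a) (w b)).trans (hlip a b)
    have h2 := hbd a ha
    have h3 := hbd b hb
    calc (‖w a‖ + ‖w b‖) * |‖w a‖ - ‖w b‖| ≤ (2 * (‖v₀‖ + C * t)) * (C * |a - b|) := by
          gcongr; linarith
      _ = _ := by rw [← mul_assoc]; rfl
  have key := hac.integral_deriv_eq_sub
  simp only [hw0] at key
  -- The derivative is `2⟨w, P F⟩`. As `w` lies in `K` the projection can be dropped, and `w` equals
  -- `v` almost everywhere.
  have e : ∫ τ in (0 : ℝ)..t, deriv (fun a => ‖w a‖ ^ 2) τ =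
      ∫ τ in Set.Ioo 0 t, 2 * ⟪F τ, v τ⟫ := by
    rw [intervalIntegral.integral_of_le ht0, integral_Ioc_eq_integral_Ioo]
    refine setIntegral_congr_ae measurableSet_Ioo ?_
    filter_upwards [hwd, hae] with τ h1 h2 hτ
    have hτU : τ ∈ timeIoo T := ⟨hτ.1, (EReal.coe_lt_coe_iff.2 hτ.2).trans ht.2⟩
    rw [h1.norm_sq.deriv, real_inner_comm, hGφ (hwmem τ), hF', Set.indicator_of_mem hτU,
      ← sub_eq_zero.1 (h2 hτU)]
  rw [e, integral_const_mul] at key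
  linarith

end Evolution

/-! ### Weakly continuous representatives -/

/-- A set of full measure meets every short interval to the right of `t`; this also reaches the
initial time. -/
lemma timeIco_subset_closure {T : EReal} {p : ℝ → Prop} (h : ∀ᵐ t ∂(timeMeasure T), p t) :
    timeIco T ⊆ closure {t | t ∈ timeIoo T ∧ p t} := by
  intro t ht
  rw [timeMeasure, ae_restrict_iff' (isOpen_timeIoo T).measurableSet] at h
  rw [Metric.mem_closure_iff]
  intro ε hε
  obtain ⟨b, hb1, hb2⟩ := EReal.lt_iff_exists_real_btwn.1 ht.2
  rw [EReal.coe_lt_coe_iff] at hb1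
  have hlt : t < min b (t + ε) := lt_min hb1 (by linarith)
  have hne : volume (Set.Ioo t (min b (t + ε))) ≠ 0 := by
    rw [Real.volume_Ioo]; simpa using hlt
  obtain ⟨s, hs1, hs2⟩ := Measure.exists_mem_of_measure_ne_zero_of_ae hne (ae_restrict_of_ae h)
  have h1 : s < b := hs1.2.trans_le (min_le_left _ _)
  have h2 : s < t + ε := hs1.2.trans_le (min_le_right _ _)
  have hsU : s ∈ timeIoo T := ⟨ht.1.trans_lt hs1.1, (EReal.coe_lt_coe_iff.2 h1).trans hb2⟩
  refine ⟨s, ⟨hsU, hs2 hsU⟩, ?_⟩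
  rw [Real.dist_eq, abs_sub_lt_iff]
  constructor <;> linarith [hs1.1]

variable {H : Type*} [NormedAddCommGroup H] [InnerProductSpace ℝ H] [CompleteSpace H]

/-- On a dense set of times, `⟨w n t, φ⟩ = ⟨U t, S n φ⟩` with `U` bounded. Hence `⟨w n t, φ⟩ - ⟨w m
t, φ⟩` is at most `C ‖S n φ - S m φ‖` there, and by continuity at all times. The pairings converge
uniformly in `t`, and their limits define a weakly continuous `U'` whose regularizations equal `w n`
at every time, not merely almost everywhere. -/
theorem exists_weaklyContinuous_repr {T : EReal} {S : ℕ → H →L[ℝ] H}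
    (hsym : ∀ n x y, ⟪S n x, y⟫ = ⟪x, S n y⟫)
    (hS : ∀ x, Tendsto (fun n => S n x) atTop (𝓝 x)) {U : ℝ → H} {C : ℝ}
    (hC : ∀ᵐ t ∂(timeMeasure T), ‖U t‖ ≤ C) {w : ℕ → ℝ → H} (hw : ∀ n, Continuous (w n))
    (h : ∀ n, ∀ᵐ t ∂(timeMeasure T), w n t = S n (U t)) :
    ∃ U' : ℝ → H, (∀ᵐ t ∂(timeMeasure T), U' t = U t) ∧
      (∀ n, ∀ t ∈ timeIco T, S n (U' t) = w n t) ∧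
      ∀ φ, ContinuousOn (fun t => ⟪φ, U' t⟫) (timeIco T) := by
  have hg : ∀ᵐ t ∂(timeMeasure T), ‖U t‖ ≤ C ∧ ∀ n, w n t = S n (U t) :=
    hC.and (ae_all_iff.2 h)
  set A : Set ℝ := {t | t ∈ timeIoo T ∧ (‖U t‖ ≤ C ∧ ∀ n, w n t = S n (U t))} with hA
  have hcl : timeIco T ⊆ closure A := timeIco_subset_closure hg
  have hAin : ∀ {t}, t ∈ A → ∀ n φ, ⟪w n t, φ⟫ = ⟪U t, S n φ⟫ := fun ht n φ => by
    rw [ht.2.2 n, hsym]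
  have hdiff : ∀ t ∈ closure A, ∀ n m φ,
      |⟪w n t, φ⟫ - ⟪w m t, φ⟫| ≤ C * ‖S n φ - S m φ‖ := by
    intro t ht n m φ
    have hclosed : IsClosed {t | |⟪w n t, φ⟫ - ⟪w m t, φ⟫| ≤ C * ‖S n φ - S m φ‖} :=
      isClosed_le ((((hw n).inner continuous_const).sub ((hw m).inner continuous_const)).abs)
        continuous_const
    refine closure_minimal (fun τ hτ => ?_) hclosed ht
    rw [Set.mem_ofPred_eq, hAin hτ, hAin hτ, ← inner_sub_right]
    exact (abs_real_inner_le_norm _ _).trans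
      (mul_le_mul_of_nonneg_right hτ.2.1 (norm_nonneg _))
  have hex : ∀ t, ∃ x : H, t ∈ closure A → ∀ φ,
      Tendsto (fun n => ⟪w n t, φ⟫) atTop (𝓝 ⟪x, φ⟫) := by
    intro t
    by_cases ht : t ∈ closure A
    · have hlim : ∀ φ, ∃ l : ℝ, Tendsto (fun n => ⟪w n t, φ⟫) atTop (𝓝 l) := by
        intro φ
        refine cauchySeq_tendsto_of_complete ?_
        have hcs : CauchySeq fun n => S n φ := (hS φ).cauchySeq
        rw [Metric.cauchySeq_iff] at hcs ⊢
        intro ε hε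
        obtain ⟨N, hN⟩ := hcs (ε / (|C| + 1)) (by positivity)
        refine ⟨N, fun m hm n hn => ?_⟩
        have h1 := hN m hm n hn
        rw [dist_eq_norm, lt_div_iff₀ (by positivity)] at h1
        rw [Real.dist_eq]
        have h2 : C * ‖S m φ - S n φ‖ ≤ |C| * ‖S m φ - S n φ‖ :=
          mul_le_mul_of_nonneg_right (le_abs_self C) (norm_nonneg _)
        have h3 := hdiff t ht m n φ
        nlinarith [norm_nonneg (S m φ - S n φ)]
      choose l hl using hlim
      -- The pointwise limit of continuous functionals is continuous by Banach–Steinhaus, and Riesz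
      -- represents it by a vector.
      let L : H →L[ℝ] ℝ := continuousLinearMapOfTendsto (fun n => innerSL ℝ (w n t))
        (f := l) (tendsto_pi_nhds.2 fun φ => by simpa using hl φ)
      refine ⟨(InnerProductSpace.toDual ℝ H).symm L, fun _ φ => ?_⟩
      rw [InnerProductSpace.toDual_symm_apply]
      exact hl φ
    · exact ⟨0, fun h => absurd h ht⟩
  choose U' hU' using hex
  have hUA : ∀ t ∈ A, U' t = U t := by
    intro t ht
    refine ext_inner_right ℝ fun φ => ?_
    refine tendsto_nhds_unique (hU' t (subset_closure ht) φ) ?_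
    simp_rw [hAin ht]
    exact tendsto_const_nhds.inner (hS φ)
  have hunif : ∀ t ∈ closure A, ∀ n φ, |⟪w n t, φ⟫ - ⟪U' t, φ⟫| ≤ C * ‖S n φ - φ‖ := by
    intro t ht n φ
    refine le_of_tendsto_of_tendsto' ((tendsto_const_nhds.sub (hU' t ht φ)).abs)
      (tendsto_const_nhds.mul (tendsto_const_nhds.sub (hS φ)).norm) fun m => hdiff t ht n m φ
  have hcont : ∀ φ, ContinuousOn (fun t => ⟪U' t, φ⟫) (closure A) := by
    intro φ
    have hz : Tendsto (fun n => C * ‖S n φ - φ‖) atTop (𝓝 0) := by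
      simpa using ((tendsto_iff_norm_sub_tendsto_zero.1 (hS φ)).const_mul C)
    refine TendstoUniformlyOn.continuousOn (F := fun n t => ⟪w n t, φ⟫) (p := atTop) ?_
      (Frequently.of_forall fun n => ((hw n).inner continuous_const).continuousOn)
    rw [Metric.tendstoUniformlyOn_iff]
    intro ε hε
    filter_upwards [hz.eventually_lt_const hε] with n hn t ht
    rw [dist_comm, Real.dist_eq]
    exact (hunif t ht n φ).trans_lt hn
  refine ⟨U', ?_, fun n t ht => ?_, fun φ => ?_⟩
  · filter_upwards [hg, ae_restrict_mem (isOpen_timeIoo T).measurableSet] with t h1 h2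
    exact hUA t ⟨h2, h1⟩
  · refine ext_inner_right ℝ fun φ => ?_
    have h1 : Set.EqOn (fun t => ⟪U' t, S n φ⟫) (fun t => ⟪w n t, φ⟫) A := fun τ hτ => by
      simp only [hUA τ hτ, hAin hτ]
    have h2 := h1.of_subset_closure (hcont _) ((hw n).inner continuous_const).continuousOn
      subset_closure subset_rfl
    rw [hsym]
    exact h2 (hcl ht)
  · exact ((hcont φ).mono hcl).congr fun t _ => real_inner_comm _ _

/-! ### The convective trilinear form -/

/-- The trilinear form `∫ ⟨(a·∇)c, b⟩`. -/
def trilin (c a b : E3 → E3) : ℝ := ∫ x, ⟪fderiv ℝ c x (a x), b x⟫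

lemma integrable_trilin {c a b : E3 → E3} {K : ℝ} (hc : ContDiff ℝ 1 c)
    (hK : ∀ x, ‖fderiv ℝ c x‖ ≤ K) (ha : MemLp a 2) (hb : MemLp b 2) :
    Integrable fun x => ⟪fderiv ℝ c x (a x), b x⟫ := by
  have hm : AEStronglyMeasurable fun x => ⟪fderiv ℝ c x (a x), b x⟫ :=
    (isBoundedBilinearMap_apply.continuous.comp_aestronglyMeasurable
      ((hc.continuous_fderiv one_ne_zero).aestronglyMeasurable.prodMk ha.1)).inner hb.1
  refine ((ha.norm.integrable_mul hb.norm).const_mul K).mono' hm (ae_of_all _ fun x => ?_)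
  refine (norm_inner_le_norm _ _).trans ?_
  rw [Pi.mul_apply, ← mul_assoc]
  gcongr
  exact (fderiv ℝ c x).le_of_opNorm_le (hK x) _

lemma abs_trilin_le {c a b : E3 → E3} {K : ℝ} (hK : ∀ x, ‖fderiv ℝ c x‖ ≤ K)
    (ha : MemLp a 2) (hb : MemLp b 2) :
    |trilin c a b| ≤ K * ((eLpNorm a 2 volume).toReal * (eLpNorm b 2 volume).toReal) := by
  have hK0 : 0 ≤ K := (norm_nonneg _).trans (hK 0)
  have h1 : |trilin c a b| ≤ ∫ x, K * (‖a x‖ * ‖b x‖) := by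
    rw [← Real.norm_eq_abs, trilin]
    refine norm_integral_le_of_norm_le ((ha.norm.integrable_mul hb.norm).const_mul K)
      (ae_of_all _ fun x => ?_)
    refine (norm_inner_le_norm _ _).trans ?_
    rw [← mul_assoc]
    gcongr
    exact (fderiv ℝ c x).le_of_opNorm_le (hK x) _
  refine h1.trans ?_
  rw [integral_const_mul]
  refine mul_le_mul_of_nonneg_left ?_ hK0
  have h2 := integral_mul_norm_le_Lp_mul_Lq (μ := (volume : Measure E3)) (f := a) (g := b)
    Real.HolderConjugate.two_two (by simpa using ha) (by simpa using hb)
  refine h2.trans (le_of_eq ?_)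
  have e : ∀ {f : E3 → E3}, MemLp f 2 →
      (∫ x, ‖f x‖ ^ (2 : ℝ)) ^ (1 / (2 : ℝ)) = (eLpNorm f 2 volume).toReal := fun hf => by
    rw [hf.eLpNorm_eq_integral_rpow_norm two_ne_zero ENNReal.ofNat_ne_top,
      ENNReal.toReal_ofReal (by positivity)]
    simp
  rw [e ha, e hb]

section Form

variable {ρ : E3 → ℝ}

lemma IsMollifier.contDiff_smear_coe (hρ : IsMollifier ρ) (f : L2) : ContDiff ℝ 1 (smear ρ f) :=
  (hρ.contDiff_smear ((Lp.memLp f).locallyIntegrable one_le_two)).of_le (by simp)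

/-- A bound for the derivatives of smeared square integrable fields. -/
def IsMollifier.gradBound (hρ : IsMollifier ρ) : ℝ :=
  (hρ.norm_fderiv_smear_le (F := E3)).choose

lemma IsMollifier.gradBound_nonneg (hρ : IsMollifier ρ) : 0 ≤ hρ.gradBound :=
  (hρ.norm_fderiv_smear_le (F := E3)).choose_spec.1

lemma IsMollifier.norm_fderiv_smear_coe_le (hρ : IsMollifier ρ) (f : L2) (x : E3) :
    ‖fderiv ℝ (smear ρ f) x‖ ≤ hρ.gradBound * ‖f‖ :=
  (hρ.norm_fderiv_smear_le (F := E3)).choose_spec.2 f (Lp.memLp f) x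

lemma IsMollifier.integrable_trilin_coe (hρ : IsMollifier ρ) (f a b : L2) :
    Integrable fun x => ⟪fderiv ℝ (smear ρ f) x (a x), b x⟫ :=
  integrable_trilin (hρ.contDiff_smear_coe f) (hρ.norm_fderiv_smear_coe_le f) (Lp.memLp a)
    (Lp.memLp b)

lemma IsMollifier.abs_trilin_coe_le (hρ : IsMollifier ρ) (f a b : L2) :
    |trilin (smear ρ f) a b| ≤ hρ.gradBound * ‖f‖ * (‖a‖ * ‖b‖) :=
  abs_trilin_le (hρ.norm_fderiv_smear_coe_le f) (Lp.memLp a) (Lp.memLp b)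

lemma IsMollifier.trilin_add (hρ : IsMollifier ρ) (f g a b : L2) :
    trilin (smear ρ (f + g : L2)) a b = trilin (smear ρ f) a b + trilin (smear ρ g) a b := by
  have e : smear ρ (f + g : L2) = smear ρ f + smear ρ g := by
    rw [← hρ.smear_add ((Lp.memLp f).locallyIntegrable one_le_two)
      ((Lp.memLp g).locallyIntegrable one_le_two)]
    exact smear_congr_ae (Lp.coeFn_add f g)
  unfold trilin
  rw [← integral_add (hρ.integrable_trilin_coe f a b) (hρ.integrable_trilin_coe g a b), e]
  congr 1; ext1 x
  rw [fderiv_add ((hρ.contDiff_smear_coe f).differentiable one_ne_zero x)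
    ((hρ.contDiff_smear_coe g).differentiable one_ne_zero x), _root_.add_apply, inner_add_left]

lemma IsMollifier.trilin_smul (hρ : IsMollifier ρ) (r : ℝ) (f a b : L2) :
    trilin (smear ρ (r • f : L2)) a b = r * trilin (smear ρ f) a b := by
  have e : smear ρ (r • f : L2) = r • smear ρ f := by
    rw [← smear_smul]
    exact smear_congr_ae (Lp.coeFn_smul r f)
  unfold trilin
  rw [← integral_const_mul, e]
  congr 1; ext1 x
  rw [fderiv_const_smul ((hρ.contDiff_smear_coe f).differentiable one_ne_zero x), _root_.smul_apply,
    real_inner_smul_left]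

/-- The element of `L²` representing `φ ↦ ∫ ⟨(a·∇)(ρ⋆φ), b⟩`. -/
def IsMollifier.convVec (hρ : IsMollifier ρ) (a b : L2) : L2 :=
  (InnerProductSpace.toDual ℝ L2).symm (LinearMap.mkContinuous
    { toFun := fun f => trilin (smear ρ f) a b
      map_add' := fun f g => hρ.trilin_add f g a b
      map_smul' := fun r f => hρ.trilin_smul r f a b } (hρ.gradBound * (‖a‖ * ‖b‖))
    fun f => (hρ.abs_trilin_coe_le f a b).trans (le_of_eq (by ring)))

lemma IsMollifier.inner_convVec (hρ : IsMollifier ρ) (a b f : L2) :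
    ⟪hρ.convVec a b, f⟫ = trilin (smear ρ f) a b := by
  rw [convVec, InnerProductSpace.toDual_symm_apply]; rfl

lemma IsMollifier.norm_convVec_le (hρ : IsMollifier ρ) (a b : L2) :
    ‖hρ.convVec a b‖ ≤ hρ.gradBound * ‖a‖ * ‖b‖ := by
  rw [convVec, LinearIsometryEquiv.norm_map, mul_assoc]
  exact LinearMap.mkContinuous_norm_le _
    (mul_nonneg hρ.gradBound_nonneg (by positivity)) _

/-- `IsMollifier.convVec` as a bounded bilinear map. -/
def IsMollifier.convL (hρ : IsMollifier ρ) : L2 →L[ℝ] L2 →L[ℝ] L2 :=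
  LinearMap.mkContinuous₂ (LinearMap.mk₂ ℝ hρ.convVec
    (fun a a' b => ext_inner_right ℝ fun f => by
      rw [inner_add_left]
      simp only [hρ.inner_convVec]
      unfold trilin
      rw [← integral_add (hρ.integrable_trilin_coe f a b) (hρ.integrable_trilin_coe f a' b)]
      refine integral_congr_ae ?_
      filter_upwards [Lp.coeFn_add a a'] with x hx
      rw [hx, Pi.add_apply, map_add, inner_add_left])
    (fun r a b => ext_inner_right ℝ fun f => by
      rw [real_inner_smul_left]
      simp only [hρ.inner_convVec]
      unfold trilin
      rw [← integral_const_mul]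
      refine integral_congr_ae ?_
      filter_upwards [Lp.coeFn_smul r a] with x hx
      rw [hx, Pi.smul_apply, map_smul, real_inner_smul_left])
    (fun a b b' => ext_inner_right ℝ fun f => by
      rw [inner_add_left]
      simp only [hρ.inner_convVec]
      unfold trilin
      rw [← integral_add (hρ.integrable_trilin_coe f a b) (hρ.integrable_trilin_coe f a b')]
      refine integral_congr_ae ?_
      filter_upwards [Lp.coeFn_add b b'] with x hx
      rw [hx, Pi.add_apply, inner_add_right])
    (fun r a b => ext_inner_right ℝ fun f => by
      rw [real_inner_smul_left]
      simp only [hρ.inner_convVec]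
      unfold trilin
      rw [← integral_const_mul]
      refine integral_congr_ae ?_
      filter_upwards [Lp.coeFn_smul r b] with x hx
      rw [hx, Pi.smul_apply, real_inner_smul_right])) hρ.gradBound hρ.norm_convVec_le

lemma IsMollifier.inner_convL (hρ : IsMollifier ρ) (a b f : L2) :
    ⟪hρ.convL a b, f⟫ = trilin (smear ρ f) a b := hρ.inner_convVec a b f

lemma IsMollifier.memLp_convL (hρ : IsMollifier ρ) {X : Type*} [MeasurableSpace X] {μ : Measure X}
    {a b : X → L2} (ha : MemLp a ⊤ μ) (hb : MemLp b ⊤ μ) :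
    MemLp (fun t => hρ.convL (a t) (b t)) ⊤ μ := by
  obtain ⟨A, hA0, hA⟩ := exists_bound_of_memLp_top ha
  obtain ⟨B, hB0, hB⟩ := exists_bound_of_memLp_top hb
  refine memLp_top_of_bound (hρ.convL.aestronglyMeasurable_comp₂ ha.1 hb.1)
    (hρ.gradBound * A * B) ?_
  filter_upwards [hA, hB] with t h1 h2
  refine (hρ.norm_convVec_le _ _).trans ?_
  have := hρ.gradBound_nonneg
  gcongr

/-- Pairing the smeared force with the smeared solution averages the first argument twice, which is
why `smear ρ ρ` and `mol2` appear. -/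
lemma IsMollifier.trilin_smearL (hρ : IsMollifier ρ) (f a b : L2) :
    trilin (smear ρ (hρ.smearL f)) a b = trilin (smear (smear ρ ρ) f) a b := by
  rw [hρ.smear_smear hρ ((Lp.memLp f).locallyIntegrable one_le_two),
    smear_congr_ae (hρ.coeFn_smearL f)]

end Form

/-! ### The weak formulation with smeared test fields -/

section WeakForm

lemma fourier_const_mul_ofReal (c : ℝ) (φ : E3 → ℝ) (ξ : E3) :
    𝓕 (fun y : E3 => ((c * φ y : ℝ) : ℂ)) ξ = (c : ℂ) * 𝓕 (fun y : E3 => (φ y : ℂ)) ξ := by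
  simp only [Real.fourier_eq]
  rw [← integral_const_mul]
  congr 1; ext1 y
  rw [Complex.ofReal_mul, ← smul_eq_mul (c : ℂ), smul_comm]
  simp

lemma Lam_const_mul (σ c : ℝ) (φ : E3 → ℝ) (x : E3) :
    Lam σ (fun y => c * φ y) x = c * Lam σ φ x := by
  unfold Lam
  rw [← Complex.re_ofReal_mul]
  congr 1
  simp only [Real.fourierInv_eq, fourier_const_mul_ofReal]
  rw [← integral_const_mul]
  congr 1; ext1 y
  simp only [Circle.smul_def, smul_eq_mul]
  ring

lemma LamVec_const_smul (σ c : ℝ) (φ : E3 → E3) (x : E3) :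
    LamVec σ (c • φ) x = c • LamVec σ φ x := by
  ext j
  simp only [LamVec, Pi.smul_apply, PiLp.smul_apply, smul_eq_mul]
  exact Lam_const_mul σ c _ x

lemma IsSolTest.smeared {ψ : E3 → E3} (h : IsSolTest ψ) {ρ : E3 → ℝ} (hρ : IsMollifier ρ) :
    IsSolTest (smear ρ ψ) where
  smooth := hρ.contDiff_smear h.smooth.continuous.locallyIntegrable
  compact := hρ.hasCompactSupport_smear h.compact
  div_eq x := by
    have h1 : ContDiff ℝ 1 ψ := h.smooth.of_le (by simp)
    have hl : ∀ i : Fin 3, LocallyIntegrable fun y => fderiv ℝ ψ y (EuclideanSpace.single i 1) :=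
      fun i => ((h1.continuous_fderiv one_ne_zero).clm_apply continuous_const).locallyIntegrable
    unfold divg
    simp_rw [hρ.fderiv_smear_comm h1 h.compact, smear_apply]
    have e : ∀ i : Fin 3, (∫ t, ρ t • fderiv ℝ ψ (x - t) (EuclideanSpace.single i 1)) i =
        ∫ t, ρ t * fderiv ℝ ψ (x - t) (EuclideanSpace.single i 1) i := fun i =>
      ((EuclideanSpace.proj (𝕜 := ℝ) i).integral_comp_comm (hρ.integrable_shift (hl i) x)).symm
    have hi : ∀ i : Fin 3, Integrable fun t =>
        ρ t * fderiv ℝ ψ (x - t) (EuclideanSpace.single i 1) i := fun i =>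
      (EuclideanSpace.proj (𝕜 := ℝ) i).integrable_comp (hρ.integrable_shift (hl i) x)
    simp_rw [e]
    rw [← integral_finsetSum _ fun i _ => hi i]
    refine integral_eq_zero_of_ae (ae_of_all _ fun t => ?_)
    have := h.div_eq (x - t)
    unfold divg at this
    simp only [← Finset.mul_sum, this, mul_zero, Pi.zero_apply]

lemma IsSolTest.isTestField {T : EReal} {ψ : E3 → E3} (h : IsSolTest ψ) {χ : ℝ → ℝ}
    (h1 : ContDiff ℝ ∞ χ) (h2 : HasCompactSupport χ) (h3 : ∀ t ∈ tsupport χ, (t : EReal) < T) :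
    IsTestField T fun t => χ t • ψ := by
  have hs : tsupport (fun z : ℝ × E3 => (χ z.1 • ψ) z.2) ⊆ tsupport χ ×ˢ tsupport ψ := by
    refine closure_minimal (fun z hz => ?_) ((isClosed_tsupport _).prod (isClosed_tsupport _))
    simp only [Pi.smul_apply, Function.mem_support, ne_eq, smul_eq_zero, not_or] at hz
    exact ⟨subset_tsupport _ hz.1, subset_tsupport _ hz.2⟩
  exact
    { smooth := (h1.comp contDiff_fst).smul (h.smooth.comp contDiff_snd)
      compact := (h2.isCompact.prod h.compact.isCompact).of_isClosed_subset
        (isClosed_tsupport _) hs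
      support := fun z hz => h3 _ (hs hz).1
      divFree := fun t x => by
        have := h.div_eq x
        unfold divg at this
        rw [fderiv_const_smul (h.smooth.differentiable (by simp) x)]
        simp [← Finset.mul_sum, this] }

lemma IsSolTest.inner_toL2 {ψ : E3 → E3} (h : IsSolTest ψ) (a : L2) :
    ⟪h.toL2, a⟫ = ∫ x, ⟪ψ x, a x⟫ := by
  rw [L2.inner_def]
  refine integral_congr_ae ?_
  filter_upwards [h.coeFn_toL2] with x hx
  rw [hx]

lemma IsSolTest.inner_smearL {ψ : E3 → E3} (h : IsSolTest ψ) {ρ : E3 → ℝ} (hρ : IsMollifier ρ)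
    (a : L2) : ⟪hρ.smearL a, h.toL2⟫ = ∫ x, ⟪smear ρ ψ x, a x⟫ := by
  rw [hρ.inner_smearL, real_inner_comm, IsSolTest.toL2, hρ.smearL_toLp]
  exact (h.smeared hρ).inner_toL2 a

/-- The space integral in the weak formulation, tested with a smeared product field. -/
lemma IsSolTest.integral_weak_form {ψ : E3 → E3} (h : IsSolTest ψ) {ρ : E3 → ℝ}
    (hρ : IsMollifier ρ) {σ : ℝ} (hσ : 0 ≤ σ) {χ : ℝ → ℝ} (h1 : ContDiff ℝ ∞ χ) (t : ℝ)
    (a b c d e : L2) :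
    ∫ x, (⟪deriv (fun s => (χ s • smear ρ ψ) x) t, a x⟫
      + ⟪fderiv ℝ (χ t • smear ρ ψ) x (b x), c x⟫ - ⟪a x, LamVec σ (χ t • smear ρ ψ) x⟫
      - ⟪fderiv ℝ (χ t • smear ρ ψ) x (d x), e x⟫) =
    deriv χ t * ⟪hρ.smearL a, h.toL2⟫ +
      χ t * ⟪hρ.convL b c - hρ.convL d e - hρ.diffOp hσ a, h.toL2⟫ := by
  have hs := h.smeared hρ
  have e1 : smear ρ h.toL2 = smear ρ ψ := smear_congr_ae h.coeFn_toL2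
  have i1 : Integrable fun x => ⟪smear ρ ψ x, a x⟫ :=
    (L2.integrable_inner (𝕜 := ℝ) hs.toL2 a).congr (by
      filter_upwards [hs.coeFn_toL2] with x hx
      rw [hx])
  have i2 : ∀ b c : L2, Integrable fun x => ⟪fderiv ℝ (smear ρ ψ) x (b x), c x⟫ := fun b c => by
    have := hρ.integrable_trilin_coe h.toL2 b c
    rwa [e1] at this
  have i3 := integrable_inner_LamVec hσ a hs.smooth hs.compact
  rw [inner_sub_left, inner_sub_left, hρ.inner_convL, hρ.inner_convL, e1, IsSolTest.toL2,
    hρ.inner_diffOp_test hσ a h.smooth h.compact]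
  rw [show ⟪hρ.smearL a, (memLp_test h.smooth h.compact 2).toLp ψ⟫ = ∫ x, ⟪smear ρ ψ x, a x⟫ from
    h.inner_smearL hρ a]
  unfold trilin
  have i4 : Integrable fun x => ⟪fderiv ℝ (smear ρ ψ) x (b x), c x⟫ -
      ⟪fderiv ℝ (smear ρ ψ) x (d x), e x⟫ := (i2 b c).sub (i2 d e)
  have i5 : Integrable fun x => χ t * (⟪fderiv ℝ (smear ρ ψ) x (b x), c x⟫ -
      ⟪fderiv ℝ (smear ρ ψ) x (d x), e x⟫ - ⟪a x, LamVec σ (smear ρ ψ) x⟫) :=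
    (i4.sub i3).const_mul _
  rw [← integral_sub (i2 b c) (i2 d e), ← integral_sub i4 i3,
    ← integral_const_mul, ← integral_const_mul, ← integral_add (i1.const_mul _) i5]
  congr 1; ext1 x
  have d1 : deriv (fun s => (χ s • smear ρ ψ) x) t = deriv χ t • smear ρ ψ x := by
    simp only [Pi.smul_apply]
    exact deriv_smul_const (h1.differentiable (by simp) t) _
  rw [d1, fderiv_const_smul (hs.smooth.differentiable (by simp) x), LamVec_const_smul]
  simp only [_root_.smul_apply, real_inner_smul_left, real_inner_smul_right]
  ring

/-- The divergence free test fields in `L²`. -/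
def solTests : Set L2 := {f | ∃ (ψ : E3 → E3) (h : IsSolTest ψ), f = h.toL2}

lemma solTests_subset : solTests ⊆ solSpace := by
  rintro f ⟨ψ, h, rfl⟩; exact h.mem_solSpace

lemma eq_zero_of_inner_solTests {x : L2} (hx : x ∈ solSpace)
    (h : ∀ φ ∈ solTests, ⟪x, φ⟫ = 0) : x = 0 := by
  have hle : solSpace ≤ (innerSL ℝ x).ker := solSpace_le (ContinuousLinearMap.isClosed_ker _)
    fun ψ hψ => by simpa using h _ ⟨ψ, hψ, rfl⟩
  have := hle hx
  simpa using this

/-- Smearing is continuous and preserves test fields, so it preserves their closed span. -/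
lemma smearL_mem_solSpace {ρ : E3 → ℝ} (hρ : IsMollifier ρ) {f : L2} (hf : f ∈ solSpace) :
    hρ.smearL f ∈ solSpace := by
  have hle : solSpace ≤ solSpace.comap (hρ.smearL (F := E3)).toLinearMap :=
    solSpace_le (isClosed_solSpace.preimage (hρ.smearL (F := E3)).continuous) fun ψ hψ => by
      rw [Submodule.mem_comap]
      have := (hψ.smeared hρ).mem_solSpace
      rwa [IsSolTest.toL2, ← hρ.smearL_toLp (memLp_test hψ.smooth hψ.compact 2)] at this
  exact hle hf

end WeakForm

/-! ### Cancellation in the nonlinearity -/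

section Cancellation

/-- A fixed cutoff function. -/
def cutoff : ContDiffBump (0 : E3) := ⟨1, 2, one_pos, one_lt_two⟩

/-- The dilated cutoff functions. -/
def cutoffAt (n : ℕ) (x : E3) : ℝ := cutoff ((1 / ((n : ℝ) + 1)) • x)

lemma contDiff_cutoffAt (n : ℕ) : ContDiff ℝ ∞ (cutoffAt n) :=
  cutoff.contDiff.comp (contDiff_const_smul _)

lemma hasCompactSupport_cutoffAt (n : ℕ) : HasCompactSupport (cutoffAt n) :=
  cutoff.hasCompactSupport.comp_smul (by positivity)

lemma norm_cutoffAt_le (n : ℕ) (x : E3) : ‖cutoffAt n x‖ ≤ 1 := by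
  rw [cutoffAt, Real.norm_of_nonneg cutoff.nonneg]; exact cutoff.le_one

lemma tendsto_cutoffAt (x : E3) : Tendsto (fun n => cutoffAt n x) atTop (𝓝 1) := by
  have h := (tendsto_one_div_add_atTop_nhds_zero_nat (𝕜 := ℝ)).smul_const x
  rw [zero_smul] at h
  have h2 := (cutoff.continuous.tendsto (0 : E3)).comp h
  rwa [cutoff.one_of_mem_closedBall (by simp [cutoff])] at h2

lemma exists_fderiv_cutoffAt_le : ∃ C : ℝ, 0 ≤ C ∧ ∀ n x,
    ‖fderiv ℝ (cutoffAt n) x‖ ≤ (1 / ((n : ℝ) + 1)) * C := by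
  have hc : Continuous (fderiv ℝ (cutoff : E3 → ℝ)) :=
    (cutoff.contDiff (n := 1)).continuous_fderiv one_ne_zero
  obtain ⟨C, hC⟩ := hc.bounded_above_of_compact_support
    (cutoff.hasCompactSupport.fderiv (𝕜 := ℝ))
  refine ⟨C, (norm_nonneg _).trans (hC 0), fun n x => ?_⟩
  unfold cutoffAt
  rw [fderiv_comp_smul, norm_smul, Real.norm_of_nonneg (by positivity)]
  gcongr
  exact hC _

/-- Solenoidal fields are orthogonal to gradients. -/
lemma IsSolenoidal.integral_fderiv_eq_zero {a : L2} (ha : IsSolenoidal a) {g : E3 → ℝ}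
    (hg : ContDiff ℝ ∞ g) (hg2 : MemLp g 2) (hi : Integrable fun x => fderiv ℝ g x (a x)) :
    ∫ x, fderiv ℝ g x (a x) = 0 := by
  obtain ⟨C, hC0, hC⟩ := exists_fderiv_cutoffAt_le
  have ha2 := Lp.memLp a
  have hd : ∀ n x v, fderiv ℝ (fun y => cutoffAt n y * g y) x v =
      cutoffAt n x * fderiv ℝ g x v + g x * fderiv ℝ (cutoffAt n) x v := fun n x v => by
    rw [fderiv_fun_mul ((contDiff_cutoffAt n).differentiable (by simp) x)
      (hg.differentiable (by simp) x)]
    simp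
  have hz : ∀ n, ∫ x, (cutoffAt n x * fderiv ℝ g x (a x) +
      g x * fderiv ℝ (cutoffAt n) x (a x)) = 0 := fun n => by
    have := ha _ ((contDiff_cutoffAt n).mul hg) ((hasCompactSupport_cutoffAt n).mul_right)
    simpa only [hd] using this
  have hm : ∀ n, AEStronglyMeasurable fun x => fderiv ℝ (cutoffAt n) x (a x) := fun n =>
    isBoundedBilinearMap_apply.continuous.comp_aestronglyMeasurable
      (((contDiff_cutoffAt n).continuous_fderiv (by simp)).aestronglyMeasurable.prodMk ha2.1)
  -- The cutoff error is of size `(C / (n + 1)) ‖g‖ ‖a‖` pointwise, with `‖g‖ ‖a‖` integrable, so it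
  -- disappears in the limit.
  have hlim : Tendsto (fun n => ∫ x, (cutoffAt n x * fderiv ℝ g x (a x) +
      g x * fderiv ℝ (cutoffAt n) x (a x))) atTop (𝓝 (∫ x, fderiv ℝ g x (a x))) := by
    refine tendsto_integral_of_dominated_convergence
      (fun x => ‖fderiv ℝ g x (a x)‖ + C * (‖g x‖ * ‖a x‖))
      (fun n => (((contDiff_cutoffAt n).continuous.aestronglyMeasurable.mul hi.1).add
        (hg2.1.mul (hm n))))
      (hi.norm.add ((hg2.norm.integrable_mul ha2.norm).const_mul C))
      (fun n => ae_of_all _ fun x => ?_) (ae_of_all _ fun x => ?_)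
    · have h1 : ‖fderiv ℝ (cutoffAt n) x (a x)‖ ≤ C * ‖a x‖ := by
        refine (fderiv ℝ (cutoffAt n) x).le_of_opNorm_le ((hC n x).trans ?_) _
        refine mul_le_of_le_one_left hC0 ?_
        rw [div_le_one (by positivity)]; linarith [(n.cast_nonneg : (0 : ℝ) ≤ n)]
      refine (norm_add_le _ _).trans (add_le_add ?_ ?_)
      · rw [norm_mul]
        exact mul_le_of_le_one_left (norm_nonneg _) (norm_cutoffAt_le n x)
      · rw [norm_mul]
        calc ‖g x‖ * ‖fderiv ℝ (cutoffAt n) x (a x)‖ ≤ ‖g x‖ * (C * ‖a x‖) := by gcongr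
          _ = _ := by ring
    · have h0 : Tendsto (fun n => fderiv ℝ (cutoffAt n) x (a x)) atTop (𝓝 0) := by
        refine squeeze_zero_norm (fun n => (fderiv ℝ (cutoffAt n) x).le_of_opNorm_le (hC n x) _) ?_
        simpa using ((tendsto_one_div_add_atTop_nhds_zero_nat (𝕜 := ℝ)).mul_const C).mul_const
          ‖a x‖
      simpa using ((tendsto_cutoffAt x).mul_const (fderiv ℝ g x (a x))).add
        (h0.const_mul (g x))
  simp_rw [hz] at hlim
  exact (tendsto_nhds_unique hlim tendsto_const_nhds)

/-- By the product rule the sum is the integral of `(a·∇)⟨ηc, ηd⟩`, which vanishes since `a` is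
solenoidal. The scalar product is in `L²` because one smeared factor is bounded. -/
lemma IsSolenoidal.trilin_add_trilin {a : L2} (ha : IsSolenoidal a) {η : E3 → ℝ}
    (hη : IsMollifier η) (c d : L2) :
    trilin (smear η c) a (smear η d) + trilin (smear η d) a (smear η c) = 0 := by
  have hs : ∀ f : L2, ContDiff ℝ ∞ (smear η f) := fun f =>
    hη.contDiff_smear ((Lp.memLp f).locallyIntegrable one_le_two)
  have hm : ∀ f : L2, MemLp (smear η f) 2 := fun f => hη.memLp_two_smear (Lp.memLp f)
  have hi : ∀ c d : L2, Integrable fun x => ⟪fderiv ℝ (smear η c) x (a x), smear η d x⟫ :=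
    fun c d => integrable_trilin (hη.contDiff_smear_coe c) (hη.norm_fderiv_smear_coe_le c)
      (Lp.memLp a) (hm d)
  have hd : ∀ x, fderiv ℝ (fun y => ⟪smear η c y, smear η d y⟫) x (a x) =
      ⟪fderiv ℝ (smear η c) x (a x), smear η d x⟫ +
        ⟪fderiv ℝ (smear η d) x (a x), smear η c x⟫ := fun x => by
    rw [fderiv_inner_apply ℝ ((hs c).differentiable (by simp) x)
      ((hs d).differentiable (by simp) x), real_inner_comm (fderiv ℝ (smear η d) x (a x))]
    ring
  have hg2 : MemLp (fun y => ⟪smear η c y, smear η d y⟫) 2 := by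
    refine ((hm d).norm.const_mul ((eLpNorm η 2 volume).toReal * (eLpNorm c 2 volume).toReal)).mono'
      ((hm c).1.inner (hm d).1) (ae_of_all _ fun x => ?_)
    refine (norm_inner_le_norm _ _).trans ?_
    gcongr
    exact norm_smear_le (hη.memLp 2) (Lp.memLp c) x
  have := ha.integral_fderiv_eq_zero ((hs c).inner ℝ (hs d)) hg2 (by
    simp_rw [hd]; exact (hi c d).add (hi d c))
  simp_rw [hd] at this
  rwa [integral_add (hi c d) (hi d c)] at this

lemma trilin_sub_right {η : E3 → ℝ} (hη : IsMollifier η) (c a b : L2) :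
    trilin (smear η c) a (fun x => b x - smear η b x) =
      trilin (smear η c) a b - trilin (smear η c) a (smear η b) := by
  unfold trilin
  rw [← integral_sub (hη.integrable_trilin_coe c a b) (integrable_trilin
    (hη.contDiff_smear_coe c) (hη.norm_fderiv_smear_coe_le c) (Lp.memLp a)
      (hη.memLp_two_smear (Lp.memLp b)))]
  simp_rw [inner_sub_right]

/-- The smeared nonlinearity is a commutator. -/
lemma trilin_eq_residual {u B : L2} (hu : IsSolenoidal u) (hB : IsSolenoidal B) {η : E3 → ℝ}
    (hη : IsMollifier η) :
    trilin (smear η u) u u - trilin (smear η u) B B + trilin (smear η B) u B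
        - trilin (smear η B) B u =
      trilin (smear η u) u (fun x => u x - smear η u x)
        - trilin (smear η u) B (fun x => B x - smear η B x)
        + trilin (smear η B) u (fun x => B x - smear η B x)
        - trilin (smear η B) B (fun x => u x - smear η u x) := by
  -- The terms transported by `u` with equal smeared arguments vanish, and the two mixed terms
  -- transported by `B` cancel each other.
  have h1 := hu.trilin_add_trilin hη u u
  have h2 := hB.trilin_add_trilin hη u B
  have h3 := hu.trilin_add_trilin hη B B
  simp only [trilin_sub_right hη]
  linarith

end Cancellation

/-! ### Size and convergence of the residuals -/

section Residual

variable {s σ r k m : ℝ}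

lemma HasWeakDeriv.sub {v : E3} {f g f' g' : E3 → ℝ} (h : HasWeakDeriv v f g)
    (h' : HasWeakDeriv v f' g') :
    HasWeakDeriv v (fun x => f x - f' x) (fun x => g x - g' x) where
  locallyIntegrable := h.locallyIntegrable.sub h'.locallyIntegrable
  locallyIntegrable_deriv := h.locallyIntegrable_deriv.sub h'.locallyIntegrable_deriv
  integral_eq φ h1 h2 := by
    have i1 : ∀ {w : E3 → ℝ}, LocallyIntegrable w → Integrable fun x => w x * fderiv ℝ φ x v :=
      fun hw => by
        have := hw.integrable_smul_right_of_hasCompactSupport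
          (contDiff_fderiv_apply h1 v).continuous (hasCompactSupport_fderiv_apply h2 v)
        exact this
    have i2 : ∀ {w : E3 → ℝ}, LocallyIntegrable w → Integrable fun x => w x * φ x :=
      fun hw => hw.integrable_smul_right_of_hasCompactSupport h1.continuous h2
    simp_rw [sub_mul]
    rw [integral_sub (i1 h.locallyIntegrable) (i1 h'.locallyIntegrable),
      integral_sub (i2 h.locallyIntegrable_deriv) (i2 h'.locallyIntegrable_deriv),
      h.integral_eq φ h1 h2, h'.integral_eq φ h1 h2]
    ring

lemma HasWeakDeriv.smeared {v : E3} {f g : E3 → ℝ} (h : HasWeakDeriv v f g) {η : E3 → ℝ}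
    (hη : IsMollifier η) : HasWeakDeriv v (smear η f) (smear η g) where
  locallyIntegrable := (hη.contDiff_smear h.locallyIntegrable).continuous.locallyIntegrable
  locallyIntegrable_deriv :=
    (hη.contDiff_smear h.locallyIntegrable_deriv).continuous.locallyIntegrable
  integral_eq φ h1 h2 := by
    have := integral_fderiv_mul (h1.of_le (by simp)) h2
      ((hη.contDiff_smear h.locallyIntegrable).of_le (by simp) : ContDiff ℝ 1 (smear η f)) v
    simp_rw [h.fderiv_smear hη] at this
    simp_rw [mul_comm _ (fderiv ℝ φ _ v), mul_comm _ (φ _)]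
    exact this

lemma IsWeakGrad.hasWeakDeriv {f : L2} {G : Fin 3 → Fin 3 → E3 → ℝ} (h : IsWeakGrad f G)
    (i j : Fin 3) : HasWeakDeriv (EuclideanSpace.single i 1) (fun x => f x j) (G i j) :=
  ⟨(memLp_coord (Lp.memLp f) j).locallyIntegrable one_le_two, (h i j).1, (h i j).2⟩

/-- The size of a field with gradient `G`. -/
def fieldSize (k : ℝ) (f : E3 → E3) (G : Fin 3 → Fin 3 → E3 → ℝ) : ℝ≥0∞ :=
  eLpNorm f 2 volume + eLpNorm f (ENNReal.ofReal k) volume + ∑ i, ∑ j, eLpNorm (G i j) 2 volume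

/-- The size of the difference of a field and its smeared version. -/
def residual (k : ℝ) (η : E3 → ℝ) (f : E3 → E3) (G : Fin 3 → Fin 3 → E3 → ℝ) : ℝ≥0∞ :=
  fieldSize k (fun x => f x - smear η f x) fun i j x => G i j x - smear η (G i j) x

lemma smear_coord {η : E3 → ℝ} (hη : IsMollifier η) (f : L2) (j : Fin 3) (x : E3) :
    smear η f x j = smear η (fun y => f y j) x := by
  rw [smear_apply, smear_apply]
  exact ((EuclideanSpace.proj (𝕜 := ℝ) j).integral_comp_comm
    (hη.integrable_shift ((Lp.memLp f).locallyIntegrable one_le_two) x)).symm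

lemma eLpNorm_coord_le (f : E3 → E3) (p : ℝ≥0∞) (j : Fin 3) :
    eLpNorm (fun x => f x j) p volume ≤ eLpNorm f p volume :=
  eLpNorm_mono fun x => PiLp.norm_apply_le (f x) j

/-- Smearing commutes with weak differentiation, so the derivatives of the residual are the
residuals of the derivatives. -/
lemma weakSizeLe_residual {η : E3 → ℝ} (hη : IsMollifier η) {f : L2}
    {G : Fin 3 → Fin 3 → E3 → ℝ} (h : IsWeakGrad f G) (j : Fin 3) :
    WeakSizeLe k (fun x => (f x - smear η f x) j) (fun i x => G i j x - smear η (G i j) x)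
      (residual k η f G) where
  memLp := memLp_coord ((Lp.memLp f).sub (hη.memLp_two_smear (Lp.memLp f))) j
  weakDeriv i := by
    simp only [PiLp.sub_apply, smear_coord hη]
    exact (h.hasWeakDeriv i j).sub ((h.hasWeakDeriv i j).smeared hη)
  two := (eLpNorm_coord_le _ _ j).trans (le_self_add.trans le_self_add)
  exponent := (eLpNorm_coord_le _ _ j).trans (le_add_self.trans le_self_add)
  deriv i := by
    refine le_trans ?_ (le_add_self : _ ≤ residual k η f G)
    refine le_trans ?_ (Finset.single_le_sum (f := fun i => ∑ j, eLpNorm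
      (fun x => G i j x - smear η (G i j) x) 2 volume) (fun _ _ => zero_le) (Finset.mem_univ i))
    exact Finset.single_le_sum (f := fun j => eLpNorm
      (fun x => G i j x - smear η (G i j) x) 2 volume) (fun _ _ => zero_le) (Finset.mem_univ j)

lemma eLpNorm_sub_smear_le {F : Type*} [NormedAddCommGroup F] [NormedSpace ℝ F]
    [CompleteSpace F] {η : E3 → ℝ} (hη : IsMollifier η) {p : ℝ} (hp : 1 ≤ p) {f : E3 → F} (hf : LocallyIntegrable f) :
    eLpNorm (fun x => f x - smear η f x) (ENNReal.ofReal p) volume ≤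
      2 * eLpNorm f (ENNReal.ofReal p) volume := by
  refine (eLpNorm_sub_le hf.aestronglyMeasurable
    (hη.contDiff_smear hf).continuous.aestronglyMeasurable (by simpa using hp)).trans ?_
  rw [two_mul]
  gcongr
  exact hη.eLpNorm_smear_le hp hf.aestronglyMeasurable

/-- One copy of the size bounds the field and one its average. The bound does not depend on the
kernel and provides the majorant in time. -/
lemma residual_le (hk : 1 ≤ k) {η : E3 → ℝ} (hη : IsMollifier η) {f : L2}
    {G : Fin 3 → Fin 3 → E3 → ℝ} (h : IsWeakGrad f G) :
    residual k η f G ≤ 2 * fieldSize k f G := by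
  have hl := (Lp.memLp f).locallyIntegrable one_le_two
  have h2 : ENNReal.ofReal 2 = 2 := ENNReal.ofReal_ofNat 2
  unfold residual fieldSize
  rw [mul_add, mul_add, Finset.mul_sum]
  simp_rw [Finset.mul_sum]
  refine add_le_add (add_le_add ?_ (eLpNorm_sub_smear_le hη hk hl))
    (Finset.sum_le_sum fun i _ => Finset.sum_le_sum fun j _ => ?_)
  · simpa only [h2] using eLpNorm_sub_smear_le hη one_le_two hl
  · simpa only [h2] using eLpNorm_sub_smear_le hη one_le_two (h i j).1

lemma tendsto_residual (hk : 1 ≤ k) {f : L2} {G : Fin 3 → Fin 3 → E3 → ℝ} (h : IsWeakGrad f G)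
    (hf : fieldSize k f G ≠ ⊤) :
    Tendsto (fun n => residual k (mol2 n) f G) atTop (𝓝 0) := by
  have key : ∀ {F : Type} [NormedAddCommGroup F] [NormedSpace ℝ F] [CompleteSpace F] {p : ℝ}
      {f : E3 → F}, 1 ≤ p → AEStronglyMeasurable f → eLpNorm f (ENNReal.ofReal p) volume ≠ ⊤ →
      Tendsto (fun n => eLpNorm (fun x => f x - smear (mol2 n) f x) (ENNReal.ofReal p) volume)
        atTop (𝓝 0) := by
    intro F _ _ _ p f hp hm hfin
    refine (tendsto_eLpNorm_smear_sub hp ⟨hm, hfin.lt_top⟩ isMollifier_mol2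
      tendsto_support_mol2).congr fun n => ?_
    exact eLpNorm_sub_comm _ _ _ _
  have h2 : ENNReal.ofReal 2 = 2 := ENNReal.ofReal_ofNat 2
  unfold fieldSize at hf
  rw [ENNReal.add_ne_top, ENNReal.add_ne_top, ENNReal.sum_ne_top] at hf
  obtain ⟨⟨hf1, hf2⟩, hf3⟩ := hf
  have hG : ∀ i j, eLpNorm (G i j) 2 volume ≠ ⊤ := fun i j =>
    ENNReal.sum_ne_top.1 (hf3 i (Finset.mem_univ i)) j (Finset.mem_univ j)
  have t1 := key one_le_two (Lp.aestronglyMeasurable f) (by rwa [h2])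
  have t2 := key hk (Lp.aestronglyMeasurable f) hf2
  have t3 : ∀ i j, Tendsto (fun n => eLpNorm (fun x => G i j x - smear (mol2 n) (G i j) x)
      (ENNReal.ofReal 2) volume) atTop (𝓝 0) := fun i j =>
    key one_le_two (h i j).1.aestronglyMeasurable (by rw [h2]; exact hG i j)
  have := (t1.add t2).add (tendsto_finsetSum Finset.univ fun i _ =>
    tendsto_finsetSum Finset.univ fun j _ => t3 i j)
  simpa only [residual, fieldSize, h2, add_zero, Finset.sum_const_zero] using this

lemma multNorm_le_multNormMat (G : Fin 3 → Fin 3 → E3 → ℝ) (i j : Fin 3) :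
    multNorm s r m (G i j) ≤ multNormMat s r m G := by
  have h : multNorm s r m (G i j) ^ 2 ≤ ∑ i, ∑ j, multNorm s r m (G i j) ^ 2 :=
    (Finset.single_le_sum (f := fun j => multNorm s r m (G i j) ^ 2) (fun _ _ => zero_le)
      (Finset.mem_univ j)).trans (Finset.single_le_sum
        (f := fun i => ∑ j, multNorm s r m (G i j) ^ 2) (fun _ _ => zero_le) (Finset.mem_univ i))
  have := ENNReal.rpow_le_rpow h (by norm_num : (0 : ℝ) ≤ 1 / 2)
  rwa [← ENNReal.rpow_natCast, ← ENNReal.rpow_mul, show ((2 : ℕ) : ℝ) * (1 / 2) = 1 by norm_num,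
    ENNReal.rpow_one] at this

/-- The trilinear estimate for fields. -/
lemma Exponents.enorm_trilin_le (h : Exponents s σ r k m) :
    ∃ C : ℝ≥0∞, C ≠ ⊤ ∧ ∀ (η : E3 → ℝ) (c a d : L2) (Gc Gd : Fin 3 → Fin 3 → E3 → ℝ),
      IsMollifier η → IsWeakGrad c Gc → IsWeakGrad d Gd → residual k η d Gd ≠ ⊤ →
      ‖trilin (smear η c) a (fun x => d x - smear η d x)‖ₑ ≤
        C * (eLpNorm a (ENNReal.ofReal k) volume *
          (multNormMat s r m Gc * residual k η d Gd)) := by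
  obtain ⟨C, hC, H⟩ := h.lintegral_mul_smear_le
  -- The integrand expands into nine scalar products, each covered by the multiplier estimate.
  refine ⟨9 * C, ENNReal.mul_ne_top (by simp) hC, fun η c a d Gc Gd hη hc hd hfin => ?_⟩
  have hcs := hη.contDiff_smear ((Lp.memLp c).locallyIntegrable one_le_two)
  have hexp : ∀ x, ⟪fderiv ℝ (smear η c) x (a x), d x - smear η d x⟫ =
      ∑ i, ∑ j, smear η (Gc i j) x * a x i * (d x - smear η d x) j := by
    intro x
    conv_lhs => rw [sum_single (a x)]
    rw [map_sum, sum_inner]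
    refine Finset.sum_congr rfl fun i _ => ?_
    rw [map_smul, real_inner_smul_left, PiLp.inner_apply, Finset.mul_sum]
    refine Finset.sum_congr rfl fun j _ => ?_
    rw [fderiv_coord hcs, show (fun y => smear η c y j) = smear η (fun y => c y j) from
      funext fun y => smear_coord hη c j y, (hc.hasWeakDeriv i j).fderiv_smear hη]
    simp only [RCLike.inner_apply, conj_trivial]
    ring
  have hmeas : ∀ i j, AEMeasurable fun x =>
      ‖smear η (Gc i j) x * a x i * (d x - smear η d x) j‖ₑ := fun i j =>
    (((hη.contDiff_smear (hc i j).1).continuous.aestronglyMeasurable.mul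
      (memLp_coord (Lp.memLp a) i).1).mul (weakSizeLe_residual (k := k) hη hd j).memLp.1).enorm
  calc ‖trilin (smear η c) a (fun x => d x - smear η d x)‖ₑ
      ≤ ∫⁻ x, ‖⟪fderiv ℝ (smear η c) x (a x), d x - smear η d x⟫‖ₑ :=
        enorm_integral_le_lintegral_enorm _
    _ ≤ ∫⁻ x, ∑ i, ∑ j, ‖smear η (Gc i j) x * a x i * (d x - smear η d x) j‖ₑ := by
        refine lintegral_mono fun x => ?_
        rw [hexp]
        exact (enorm_sum_le _ _).trans (Finset.sum_le_sum fun i _ => enorm_sum_le _ _)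
    _ = ∑ i, ∑ j, ∫⁻ x, ‖smear η (Gc i j) x * a x i * (d x - smear η d x) j‖ₑ := by
        rw [lintegral_finsetSum' _ fun i _ => Finset.aemeasurable_fun_sum _ fun j _ => hmeas i j]
        exact Finset.sum_congr rfl fun i _ => lintegral_finsetSum' _ fun j _ => hmeas i j
    _ ≤ ∑ _i : Fin 3, ∑ _j : Fin 3, C * (eLpNorm a (ENNReal.ofReal k) volume *
          (multNormMat s r m Gc * residual k η d Gd)) := by
        refine Finset.sum_le_sum fun i _ => Finset.sum_le_sum fun j _ => ?_
        refine (H η _ (Gc i j) _ _ _ hη (memLp_coord (Lp.memLp a) i).1 (hc i j).1 hfin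
          (weakSizeLe_residual hη hd j)).trans ?_
        gcongr
        · exact eLpNorm_coord_le _ _ i
        · exact multNorm_le_multNormMat Gc i j
    _ = _ := by
        simp only [Finset.sum_const, Finset.card_univ, Fintype.card_fin, nsmul_eq_mul]
        push_cast
        ring

/-- The size of a field of `H^α`, `α ≥ 1`. -/
lemma fieldSize_le {α : ℝ} (hα : 1 ≤ α) {f : L2} (hf : lamSq α f ≠ ⊤)
    {G : Fin 3 → Fin 3 → E3 → ℝ} (h : IsWeakGrad f G) :
    fieldSize k f G ≤ eLpNorm f (ENNReal.ofReal k) volume +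
      10 * (‖f‖ₑ ^ 2 + lamSq α f) ^ (1 / 2 : ℝ) := by
  have hh : (0 : ℝ) ≤ 1 / 2 := by norm_num
  have hsq : ∀ {x y : ℝ≥0∞}, x ^ 2 ≤ y → x ≤ y ^ (1 / 2 : ℝ) := fun {x y} hxy => by
    have := ENNReal.rpow_le_rpow hxy hh
    rwa [← ENNReal.rpow_natCast, ← ENNReal.rpow_mul, show ((2 : ℕ) : ℝ) * (1 / 2) = 1 by norm_num,
      ENNReal.rpow_one] at this
  have h1 : eLpNorm f 2 volume ≤ (‖f‖ₑ ^ 2 + lamSq α f) ^ (1 / 2 : ℝ) := by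
    rw [← Lp.enorm_def]; exact hsq le_self_add
  have h2 : ∀ i j, eLpNorm (G i j) 2 volume ≤ (‖f‖ₑ ^ 2 + lamSq α f) ^ (1 / 2 : ℝ) := fun i j => by
    refine hsq ?_
    have e := lintegral_enorm_rpow_le_of_eLpNorm (f := G i j) two_pos
    rw [ENNReal.ofReal_ofNat, ENNReal.rpow_two] at e
    simp only [ENNReal.rpow_two] at e
    rw [e]
    exact lintegral_sq_weakDeriv_le hα hf (h.hasWeakDeriv i j)
  calc fieldSize k f G ≤ (‖f‖ₑ ^ 2 + lamSq α f) ^ (1 / 2 : ℝ) +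
        eLpNorm f (ENNReal.ofReal k) volume +
        ∑ _i : Fin 3, ∑ _j : Fin 3, (‖f‖ₑ ^ 2 + lamSq α f) ^ (1 / 2 : ℝ) := by
        unfold fieldSize
        gcongr with i _ j _
        exact h2 i j
    _ = _ := by
        simp only [Finset.sum_const, Finset.card_univ, Fintype.card_fin, nsmul_eq_mul]
        push_cast
        ring

end Residual

/-! ### Measurability of the dissipation in time -/

section Dissipation

lemma ofReal_inner_diffOp {ρ : E3 → ℝ} (hρ : IsMollifier ρ) {α : ℝ} (hα : 0 ≤ 2 * α) (f : L2) :
    ENNReal.ofReal ⟪hρ.diffOp hα f, hρ.smearL f⟫ =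
      ∫⁻ ξ, ∑ j, ENNReal.ofReal (kerHat ρ ξ ^ 2 * (sym (2 * α) ξ * ‖hatL j f ξ‖ ^ 2)) := by
  have h0 : ∀ j ξ, 0 ≤ kerHat ρ ξ ^ 2 * (sym (2 * α) ξ * ‖hatL j f ξ‖ ^ 2) := fun j ξ =>
    mul_nonneg (sq_nonneg _) (mul_nonneg (sym_nonneg _ _) (sq_nonneg _))
  have hm : ∀ j, AEStronglyMeasurable fun ξ =>
      kerHat ρ ξ ^ 2 * (sym (2 * α) ξ * ‖hatL j f ξ‖ ^ 2) := fun j =>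
    (hρ.continuous_kerHat.pow 2).aestronglyMeasurable.mul (aestronglyMeasurable_sym_sq _ f j)
  have hi : ∀ j, Integrable fun ξ =>
      kerHat ρ ξ ^ 2 * (sym (2 * α) ξ * ‖hatL j f ξ‖ ^ 2) := fun j => by
    obtain ⟨C, hC, hb⟩ := bounded_sym_mul_schwartz hα (𝓕 (toComplex hρ.schwartz) : 𝓢(E3, ℂ))
    refine ((integrable_sq_hatL j f).const_mul C).mono' (hm j) (ae_of_all _ fun ξ => ?_)
    have h1 := hb ξ
    rw [hρ.fourier_schwartz, Complex.norm_real, Real.norm_eq_abs] at h1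
    rw [Real.norm_of_nonneg (h0 j ξ)]
    have h2 : kerHat ρ ξ ^ 2 ≤ |kerHat ρ ξ| := by
      rw [← sq_abs, sq]
      exact mul_le_of_le_one_left (abs_nonneg _) (hρ.abs_kerHat_le ξ)
    calc kerHat ρ ξ ^ 2 * (sym (2 * α) ξ * ‖hatL j f ξ‖ ^ 2)
        ≤ |kerHat ρ ξ| * (sym (2 * α) ξ * ‖hatL j f ξ‖ ^ 2) :=
          mul_le_mul_of_nonneg_right h2 (mul_nonneg (sym_nonneg _ _) (sq_nonneg _))
      _ = sym (2 * α) ξ * |kerHat ρ ξ| * ‖hatL j f ξ‖ ^ 2 := by ring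
      _ ≤ _ := by gcongr
  rw [hρ.inner_diffOp_smearL, ENNReal.ofReal_sum_of_nonneg fun j _ => integral_nonneg (h0 j),
    lintegral_finsetSum' _ fun j _ => (hm j).aemeasurable.ennreal_ofReal]
  exact Finset.sum_congr rfl fun j _ => ofReal_integral_eq_lintegral_ofReal (hi j)
    (ae_of_all _ (h0 j))

/-- Fatou gives one inequality and the weights being at most one give the other, including when the
dissipation is infinite. The right side is a liminf of continuous functions of `f`, whence
measurability along a path in `L²`. -/
lemma lamSq_eq_liminf {α : ℝ} (hα : 0 ≤ 2 * α) (f : L2) :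
    lamSq α f = liminf (fun n => ENNReal.ofReal
      ⟪(isMollifier_mol n).diffOp hα f, (isMollifier_mol n).smearL f⟫) atTop := by
  refine le_antisymm ?_ ?_
  · simp_rw [ofReal_inner_diffOp]
    rw [lamSq_eq, ← lintegral_finsetSum' _ fun j _ =>
      (aestronglyMeasurable_sym_sq (2 * α) f j).aemeasurable.ennreal_ofReal]
    refine le_trans (le_of_eq (lintegral_congr fun ξ => ?_)) (lintegral_liminf_le' fun n => ?_)
    · symm
      refine Tendsto.liminf_eq (tendsto_finsetSum _ fun j _ => ENNReal.tendsto_ofReal ?_)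
      simpa using ((tendsto_kerHat_mol ξ).pow 2).mul_const (sym (2 * α) ξ * ‖hatL j f ξ‖ ^ 2)
    · exact Finset.aemeasurable_fun_sum _ fun j _ =>
        (((isMollifier_mol n).continuous_kerHat.pow 2).aestronglyMeasurable.mul
          (aestronglyMeasurable_sym_sq _ f j)).aemeasurable.ennreal_ofReal
  · by_cases h : lamSq α f = ⊤
    · rw [h]; exact le_top
    · refine liminf_le_of_le (by isBoundedDefault) fun b hb => ?_
      obtain ⟨n, hn⟩ := hb.exists
      refine hn.trans ?_
      rw [← ENNReal.ofReal_toReal h]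
      exact ENNReal.ofReal_le_ofReal ((isMollifier_mol n).inner_diffOp_le hα h)

lemma aemeasurable_lamSq {α : ℝ} (hα : 0 ≤ 2 * α) {X : Type*} [MeasurableSpace X] {μ : Measure X}
    {u : X → L2} (hu : AEStronglyMeasurable u μ) : AEMeasurable (fun t => lamSq α (u t)) μ := by
  simp_rw [lamSq_eq_liminf hα]
  refine ⟨fun t => liminf (fun n => ENNReal.ofReal
    ⟪(isMollifier_mol n).diffOp hα (hu.mk u t), (isMollifier_mol n).smearL (hu.mk u t)⟫) atTop,
    Measurable.liminf fun n => ?_, ?_⟩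
  · have hm := hu.stronglyMeasurable_mk
    exact ((((isMollifier_mol n).diffOp hα).continuous.comp_stronglyMeasurable hm).inner
      ((isMollifier_mol n).smearL.continuous.comp_stronglyMeasurable hm)).measurable.ennreal_ofReal
  · filter_upwards [hu.ae_eq_mk] with t ht
    rw [← ht]

end Dissipation

/-! ### Arithmetic of the exponents -/

section Parameters

/-- The interpolation order is `σ = 1 + θ`, below 1 because `θ < 0`, and `s = σ / (1 + β)` is at
most `σ`. The bound `r ≤ k` reduces to `(1 + θ)(3 - 2θ) ≥ 0`, and subcriticality for `σ` itself to
`θ < 1`. -/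
lemma exponents_of_params {β θ : ℝ} (hβ : 0 ≤ β) (hθ : -1 ≤ θ) (hθ' : θ < 0) :
    Exponents ((1 + θ) / (1 + β)) (1 + θ) ((6 - 3 * θ) / (3 - θ ^ 2)) ((12 - 6 * θ) / (3 - θ))
      ((12 - 6 * θ) / (9 - 5 * θ)) := by
  have h1 : 0 ≤ 1 + θ := by linarith
  have h3 : 0 < 3 - θ ^ 2 := by nlinarith
  have h4 : 0 < 6 - 3 * θ := by linarith
  have hs : (1 + θ) / (1 + β) ≤ 1 + θ := div_le_self h1 (by linarith)
  constructor
  · positivity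
  · exact hs
  · linarith
  · rw [le_div_iff₀ h3]; nlinarith
  · rw [div_le_div_iff₀ h3 (by linarith)]
    nlinarith [mul_nonneg h4.le (mul_nonneg h1 (by linarith : 0 ≤ 3 - 2 * θ))]
  · rw [le_div_iff₀ (by linarith)]; linarith
  · have a1 : 12 - 6 * θ ≠ 0 := by linarith
    rw [inv_div, inv_div, ← add_div, div_eq_one_iff_eq a1]
    ring
  · have a1 : 12 - 6 * θ ≠ 0 := by linarith
    have a3 : 3 - θ ≠ 0 := by linarith
    have a4 : 2 - θ ≠ 0 := by linarith
    rw [inv_div, show (6 - 3 * θ) = 3 * (2 - θ) by ring, show (12 - 6 * θ) = 6 * (2 - θ) by ring]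
    field_simp
    ring
  · have : (1 + θ) * ((6 - 3 * θ) / (3 - θ ^ 2)) < 3 := by
      rw [← mul_div_assoc, div_lt_iff₀ h3]; nlinarith
    refine lt_of_le_of_lt ?_ this
    exact mul_le_mul_of_nonneg_right hs (by positivity)

end Parameters

/-! ### Extended nonnegative functions in `L^p` -/

section ENNRealValued

variable {X : Type*} [MeasurableSpace X] {ν : Measure X} {p q : ℝ≥0∞}

lemma memLp_toReal {f : X → ℝ≥0∞} (hf : MemLp f p ν) : MemLp (fun t => (f t).toReal) p ν := by
  refine ⟨hf.1.aemeasurable.ennreal_toReal.aestronglyMeasurable,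
    (eLpNorm_mono_enorm fun t => ?_).trans_lt hf.2⟩
  rw [Real.enorm_of_nonneg ENNReal.toReal_nonneg, enorm_eq_self]
  exact ENNReal.ofReal_toReal_le

lemma ae_ne_top_of_memLp {f : X → ℝ≥0∞} (hp : p ≠ 0) (hf : MemLp f p ν) :
    ∀ᵐ t ∂ν, f t ≠ ⊤ := by
  have h := hf.2
  by_cases hp' : p = ⊤
  · rw [hp', eLpNorm_exponent_top] at h
    filter_upwards [ae_le_eLpNormEssSup (f := f) (μ := ν)] with t ht
    rw [enorm_eq_self] at ht
    exact (ht.trans_lt h).ne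
  · have hp0 : 0 < p.toReal := ENNReal.toReal_pos hp hp'
    rw [eLpNorm_lt_top_iff_lintegral_rpow_enorm_lt_top hp hp'] at h
    filter_upwards [ae_lt_top' (hf.1.aemeasurable.enorm.pow_const _) h.ne] with t ht
    rw [enorm_eq_self] at ht
    exact fun hc => by simp [hc, ENNReal.top_rpow_of_pos hp0] at ht

lemma memLp_rpow_half {L : X → ℝ≥0∞} (hm : AEMeasurable L ν) (h : ∫⁻ t, L t ∂ν ≠ ⊤) :
    MemLp (fun t => L t ^ (1 / 2 : ℝ)) 2 ν := by
  refine ⟨(hm.pow_const _).aestronglyMeasurable, ?_⟩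
  rw [eLpNorm_lt_top_iff_lintegral_rpow_enorm_lt_top two_ne_zero ENNReal.ofNat_ne_top]
  simp only [enorm_eq_self, ENNReal.toReal_ofNat, ← ENNReal.rpow_mul]
  norm_num
  exact h.lt_top

end ENNRealValued

/-! ### Energy balance of the smeared solution -/

section Smoothed

variable {ρ : E3 → ℝ}

/-- The smeared right hand side of the velocity equation. -/
def IsMollifier.velocityForce (hρ : IsMollifier ρ) {σ : ℝ} (hσ : 0 ≤ σ) (u B : L2) : L2 :=
  hρ.convL u u - hρ.convL B B - hρ.diffOp hσ u

/-- The smeared right hand side of the induction equation. -/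
def IsMollifier.magneticForce (hρ : IsMollifier ρ) {σ : ℝ} (hσ : 0 ≤ σ) (u B : L2) : L2 :=
  hρ.convL u B - hρ.convL B u - hρ.diffOp hσ B

/-- The rate of change of half the smeared energy. -/
def IsMollifier.power (hρ : IsMollifier ρ) {σ : ℝ} (hσ : 0 ≤ σ) (u B : L2) : ℝ :=
  ⟪hρ.velocityForce hσ u B, hρ.smearL u⟫ + ⟪hρ.magneticForce hσ u B, hρ.smearL B⟫

/-- Separates the commutator terms, which should vanish in the limit, from the regularized
dissipation. -/
lemma IsMollifier.power_eq (hρ : IsMollifier ρ) {σ : ℝ} (hσ : 0 ≤ σ) {u B : L2}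
    (hu : IsSolenoidal u) (hB : IsSolenoidal B) :
    hρ.power hσ u B =
      (trilin (smear (smear ρ ρ) u) u (fun x => u x - smear (smear ρ ρ) u x)
        - trilin (smear (smear ρ ρ) u) B (fun x => B x - smear (smear ρ ρ) B x)
        + trilin (smear (smear ρ ρ) B) u (fun x => B x - smear (smear ρ ρ) B x)
        - trilin (smear (smear ρ ρ) B) B (fun x => u x - smear (smear ρ ρ) u x))
      - (⟪hρ.diffOp hσ u, hρ.smearL u⟫ + ⟪hρ.diffOp hσ B, hρ.smearL B⟫) := by
  rw [← trilin_eq_residual hu hB (hρ.comp hρ)]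
  simp only [power, velocityForce, magneticForce, inner_sub_left, hρ.inner_convL,
    hρ.trilin_smearL]
  ring

lemma IsMollifier.memLp_velocityForce (hρ : IsMollifier ρ) {σ : ℝ} (hσ : 0 ≤ σ) {T : EReal}
    {u B : ℝ → L2} (hu : MemLp u ⊤ (timeMeasure T)) (hB : MemLp B ⊤ (timeMeasure T)) :
    MemLp (fun t => hρ.velocityForce hσ (u t) (B t)) ⊤ (timeMeasure T) :=
  ((hρ.memLp_convL hu hu).sub (hρ.memLp_convL hB hB)).sub ((hρ.diffOp hσ).comp_memLp' hu)

lemma IsMollifier.memLp_magneticForce (hρ : IsMollifier ρ) {σ : ℝ} (hσ : 0 ≤ σ) {T : EReal}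
    {u B : ℝ → L2} (hu : MemLp u ⊤ (timeMeasure T)) (hB : MemLp B ⊤ (timeMeasure T)) :
    MemLp (fun t => hρ.magneticForce hσ (u t) (B t)) ⊤ (timeMeasure T) :=
  ((hρ.memLp_convL hu hB).sub (hρ.memLp_convL hB hu)).sub ((hρ.diffOp hσ).comp_memLp' hB)

lemma restrict_Ioo_le_timeMeasure {T : EReal} {t : ℝ} (ht : t ∈ timeIco T) :
    volume.restrict (Set.Ioo 0 t) ≤ timeMeasure T := by
  have hsub : Set.Ioo 0 t ⊆ timeIoo T := fun τ hτ =>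
    ⟨hτ.1, (EReal.coe_lt_coe_iff.2 hτ.2).trans ht.2⟩
  exact Measure.restrict_mono hsub le_rfl

lemma integrable_inner_of_memLp_top {T : EReal} {t : ℝ} (ht : t ∈ timeIco T) {f g : ℝ → L2}
    (hf : MemLp f ⊤ (timeMeasure T)) (hg : MemLp g ⊤ (timeMeasure T)) :
    Integrable (fun τ => ⟪f τ, g τ⟫) (volume.restrict (Set.Ioo 0 t)) := by
  have hle := restrict_Ioo_le_timeMeasure ht
  have hf' := hf.mono_measure hle
  have hg' := hg.mono_measure hle
  obtain ⟨A, hA0, hA⟩ := exists_bound_of_memLp_top hf'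
  obtain ⟨B, hB0, hB⟩ := exists_bound_of_memLp_top hg'
  refine Integrable.of_bound (hf'.1.inner hg'.1) (A * B) ?_
  filter_upwards [hA, hB] with τ h1 h2
  refine (norm_inner_le_norm _ _).trans ?_
  gcongr

variable {α : ℝ} {T : EReal} {u₀ B₀ : L2} {u B : ℝ → L2}

/-- The weak formulation is tested with `χ(t) (ρ ⋆ ψ)(x)`, and self-adjointness moves `ρ` onto the
solution. -/
lemma IsLerayHopf.isWeakEvolution_velocity (h : IsLerayHopf α T u₀ B₀ u B)
    (hρ : IsMollifier ρ) (hα : 0 ≤ 2 * α) :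
    IsWeakEvolution T solTests (hρ.smearL u₀) (fun t => hρ.smearL (u t))
      fun t => hρ.velocityForce hα (u t) (B t) := by
  rintro φ ⟨ψ, hψ, rfl⟩ χ h1 h2 h3
  have key := h.eq_u _ ((hψ.smeared hρ).isTestField h1 h2 h3)
  simp_rw [hψ.integral_weak_form hρ hα h1] at key
  refine key.trans ?_
  rw [hψ.inner_smearL hρ, ← integral_const_mul]
  refine congrArg _ (integral_congr_ae (ae_of_all _ fun x => ?_))
  simp only [Pi.smul_apply, real_inner_smul_right]
  rw [real_inner_comm]

lemma IsLerayHopf.isWeakEvolution_magnetic (h : IsLerayHopf α T u₀ B₀ u B)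
    (hρ : IsMollifier ρ) (hα : 0 ≤ 2 * α) :
    IsWeakEvolution T solTests (hρ.smearL B₀) (fun t => hρ.smearL (B t))
      fun t => hρ.magneticForce hα (u t) (B t) := by
  rintro φ ⟨ψ, hψ, rfl⟩ χ h1 h2 h3
  have key := h.eq_B _ ((hψ.smeared hρ).isTestField h1 h2 h3)
  simp_rw [hψ.integral_weak_form hρ hα h1] at key
  refine key.trans ?_
  rw [hψ.inner_smearL hρ, ← integral_const_mul]
  refine congrArg _ (integral_congr_ae (ae_of_all _ fun x => ?_))
  simp only [Pi.smul_apply, real_inner_smul_right]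
  rw [real_inner_comm]

/-- The energy balance of the smeared solution. -/
lemma IsLerayHopf.exists_smeared (h : IsLerayHopf α T u₀ B₀ u B) (hT : 0 < T)
    (hu₀ : IsSolenoidal u₀) (hB₀ : IsSolenoidal B₀) (hρ : IsMollifier ρ) (hα : 0 ≤ 2 * α) :
    ∃ v b : ℝ → L2, Continuous v ∧ Continuous b ∧
      (∀ᵐ t ∂(timeMeasure T), v t = hρ.smearL (u t)) ∧
      (∀ᵐ t ∂(timeMeasure T), b t = hρ.smearL (B t)) ∧
      v 0 = hρ.smearL u₀ ∧ b 0 = hρ.smearL B₀ ∧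
      ∀ t ∈ timeIco T, ‖v t‖ ^ 2 + ‖b t‖ ^ 2 = ‖hρ.smearL u₀‖ ^ 2 + ‖hρ.smearL B₀‖ ^ 2 +
        2 * ∫ τ in Set.Ioo 0 t, hρ.power hα (u τ) (B τ) := by
  have hu := h.class_u.bounded
  have hB := h.class_B.bounded
  have hF := hρ.memLp_velocityForce hα hu hB
  have hM := hρ.memLp_magneticForce hα hu hB
  have hSu : MemLp (fun t => hρ.smearL (u t)) ⊤ (timeMeasure T) :=
    (hρ.smearL (F := E3)).comp_memLp' hu
  have hSB : MemLp (fun t => hρ.smearL (B t)) ⊤ (timeMeasure T) :=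
    (hρ.smearL (F := E3)).comp_memLp' hB
  obtain ⟨v, v1, v2, v3, v4⟩ := (h.isWeakEvolution_velocity hρ hα).exists_continuous hT
    solTests_subset (fun x => eq_zero_of_inner_solTests) (smearL_mem_solSpace hρ hu₀.mem_solSpace)
    (h.class_u.solenoidal.mono fun t ht => smearL_mem_solSpace hρ ht.mem_solSpace) hSu hF
  obtain ⟨b, b1, b2, b3, b4⟩ := (h.isWeakEvolution_magnetic hρ hα).exists_continuous hT
    solTests_subset (fun x => eq_zero_of_inner_solTests) (smearL_mem_solSpace hρ hB₀.mem_solSpace)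
    (h.class_B.solenoidal.mono fun t ht => smearL_mem_solSpace hρ ht.mem_solSpace) hSB hM
  refine ⟨v, b, v1, b1, v3, b3, v2, b2, fun t ht => ?_⟩
  unfold IsMollifier.power
  rw [v4 t ht, b4 t ht, integral_add (integrable_inner_of_memLp_top ht hF hSu)
    (integrable_inner_of_memLp_top ht hM hSB)]
  ring

end Smoothed

/-! ### The limit at a fixed time -/

section Limit

variable {α s σ r k m : ℝ} {T : EReal} {p q : ℝ≥0∞}

lemma enorm_add_four_le {a b c d : ℝ} {e f g h : ℝ≥0∞} (ha : ‖a‖ₑ ≤ e) (hb : ‖b‖ₑ ≤ f)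
    (hc : ‖c‖ₑ ≤ g) (hd : ‖d‖ₑ ≤ h) : ‖a - b + c - d‖ₑ ≤ e + f + g + h := by
  refine (enorm_sub_le).trans (add_le_add ((enorm_add_le _ _).trans
    (add_le_add ((enorm_sub_le).trans (add_le_add ha hb)) hc)) hd)

/-- The nonlinear part of the smeared power at a fixed time. -/
lemma Exponents.enorm_power_add_le (h : Exponents s σ r k m) :
    ∃ C : ℝ≥0∞, C ≠ ⊤ ∧ ∀ (ρ : E3 → ℝ) (hρ : IsMollifier ρ) (σ' : ℝ) (hσ' : 0 ≤ σ') (u B : L2)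
      (Gu GB : Fin 3 → Fin 3 → E3 → ℝ), IsSolenoidal u → IsSolenoidal B →
      IsWeakGrad u Gu → IsWeakGrad B GB → residual k (smear ρ ρ) u Gu ≠ ⊤ →
      residual k (smear ρ ρ) B GB ≠ ⊤ →
      ‖hρ.power hσ' u B + (⟪hρ.diffOp hσ' u, hρ.smearL u⟫ + ⟪hρ.diffOp hσ' B, hρ.smearL B⟫)‖ₑ ≤
        C * ((eLpNorm u (ENNReal.ofReal k) volume + eLpNorm B (ENNReal.ofReal k) volume) *
          ((multNormMat s r m Gu + multNormMat s r m GB) *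
          (residual k (smear ρ ρ) u Gu + residual k (smear ρ ρ) B GB))) := by
  obtain ⟨C, hC, H⟩ := h.enorm_trilin_le
  refine ⟨4 * C, ENNReal.mul_ne_top (by simp) hC,
    fun ρ hρ σ' hσ' u B Gu GB hu hB hGu hGB h1 h2 => ?_⟩
  rw [hρ.power_eq hσ' hu hB, sub_add_cancel]
  have hη := hρ.comp hρ
  set K := eLpNorm u (ENNReal.ofReal k) volume + eLpNorm B (ENNReal.ofReal k) volume
  set M := multNormMat s r m Gu + multNormMat s r m GB
  set R := residual k (smear ρ ρ) u Gu + residual k (smear ρ ρ) B GB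
  have e1 := H (smear ρ ρ) u u u Gu Gu hη hGu hGu h1
  have e2 := H (smear ρ ρ) u B B Gu GB hη hGu hGB h2
  have e3 := H (smear ρ ρ) B u B GB GB hη hGB hGB h2
  have e4 := H (smear ρ ρ) B B u GB Gu hη hGB hGu h1
  have ku : eLpNorm u (ENNReal.ofReal k) volume ≤ K := le_self_add
  have kB : eLpNorm B (ENNReal.ofReal k) volume ≤ K := le_add_self
  have mu : multNormMat s r m Gu ≤ M := le_self_add
  have mB : multNormMat s r m GB ≤ M := le_add_self
  have ru : residual k (smear ρ ρ) u Gu ≤ R := le_self_add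
  have rB : residual k (smear ρ ρ) B GB ≤ R := le_add_self
  have up : ∀ {a b c : ℝ≥0∞}, a ≤ K → b ≤ M → c ≤ R → C * (a * (b * c)) ≤ C * (K * (M * R)) :=
    fun ha hb hc => by gcongr
  refine (enorm_add_four_le (e1.trans (up ku mu ru)) (e2.trans (up kB mu rB))
    (e3.trans (up ku mB rB)) (e4.trans (up kB mB ru))).trans (le_of_eq ?_)
  ring

/-- Multiplier norms and `L^k` norms are finite at the given time while the residuals tend to zero;
only the dissipation survives. -/
lemma tendsto_power (h : Exponents s σ r k m) (hα : 1 ≤ α) (hα' : 0 ≤ 2 * α) {u B : L2}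
    (hu : IsSolenoidal u) (hB : IsSolenoidal B) (hlu : lamSq α u ≠ ⊤) (hlB : lamSq α B ≠ ⊤)
    {Gu GB : Fin 3 → Fin 3 → E3 → ℝ} (hGu : IsWeakGrad u Gu) (hGB : IsWeakGrad B GB)
    (hku : eLpNorm u (ENNReal.ofReal k) volume ≠ ⊤)
    (hkB : eLpNorm B (ENNReal.ofReal k) volume ≠ ⊤)
    (hmu : multNormMat s r m Gu ≠ ⊤) (hmB : multNormMat s r m GB ≠ ⊤) :
    Tendsto (fun n => (isMollifier_mol n).power hα' u B) atTop
      (𝓝 (-((lamSq α u).toReal + (lamSq α B).toReal))) := by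
  obtain ⟨C, hC, H⟩ := h.enorm_power_add_le
  have hk : 1 ≤ k := by linarith [h.r_ge, h.r_le]
  have hfin : ∀ {f : L2} {G : Fin 3 → Fin 3 → E3 → ℝ}, IsWeakGrad f G → lamSq α f ≠ ⊤ →
      eLpNorm f (ENNReal.ofReal k) volume ≠ ⊤ → fieldSize k f G ≠ ⊤ := fun hG hl hk =>
    ne_top_of_le_ne_top (ENNReal.add_ne_top.2 ⟨hk, ENNReal.mul_ne_top (by simp)
      (ENNReal.rpow_ne_top_of_nonneg (by norm_num)
        (ENNReal.add_ne_top.2 ⟨by simp, hl⟩))⟩) (fieldSize_le hα hl hG)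
  have fu := hfin hGu hlu hku
  have fB := hfin hGB hlB hkB
  have hr : ∀ n {f : L2} {G : Fin 3 → Fin 3 → E3 → ℝ}, IsWeakGrad f G → fieldSize k f G ≠ ⊤ →
      residual k (mol2 n) f G ≠ ⊤ := fun n {f G} hG hf =>
    ne_top_of_le_ne_top (ENNReal.mul_ne_top (by simp) hf) (residual_le hk (isMollifier_mol2 n) hG)
  have hres := (tendsto_residual hk hGu fu).add (tendsto_residual hk hGB fB)
  have hbd : Tendsto (fun n => C * ((eLpNorm u (ENNReal.ofReal k) volume +
      eLpNorm B (ENNReal.ofReal k) volume) * ((multNormMat s r m Gu + multNormMat s r m GB) *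
      (residual k (mol2 n) u Gu + residual k (mol2 n) B GB)))) atTop (𝓝 0) := by
    have h1 := ENNReal.Tendsto.const_mul (a := C) (ENNReal.Tendsto.const_mul
      (a := eLpNorm u (ENNReal.ofReal k) volume + eLpNorm B (ENNReal.ofReal k) volume)
      (ENNReal.Tendsto.const_mul (a := multNormMat s r m Gu + multNormMat s r m GB) hres
        (Or.inr (ENNReal.add_ne_top.2 ⟨hmu, hmB⟩))) (Or.inr (ENNReal.add_ne_top.2 ⟨hku, hkB⟩)))
        (Or.inr hC)
    simpa using h1
  have hz : Tendsto (fun n => (isMollifier_mol n).power hα' u B +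
      (⟪(isMollifier_mol n).diffOp hα' u, (isMollifier_mol n).smearL u⟫ +
        ⟪(isMollifier_mol n).diffOp hα' B, (isMollifier_mol n).smearL B⟫)) atTop (𝓝 0) := by
    rw [tendsto_zero_iff_enorm_tendsto_zero]
    exact tendsto_of_tendsto_of_tendsto_of_le_of_le tendsto_const_nhds hbd (fun _ => zero_le)
      fun n => H _ (isMollifier_mol n) _ hα' u B Gu GB hu hB hGu hGB (hr n hGu fu) (hr n hGB fB)
  have := hz.sub ((tendsto_inner_diffOp hα' hlu).add (tendsto_inner_diffOp hα' hlB))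
  simpa using this

end Limit

/-! ### The limit in time and the energy equality -/

section Energy

variable {α s σ r k m : ℝ} {T : EReal} {p q : ℝ≥0∞} {u₀ B₀ : L2} {u B : ℝ → L2}

/-- `‖f‖² + ‖Λ^α f‖²`. -/
def sobolevSq (α : ℝ) (f : L2) : ℝ≥0∞ := ‖f‖ₑ ^ 2 + lamSq α f

lemma InEnergyClass.aemeasurable_sobolevSq {f : ℝ → L2} (h : InEnergyClass α T f)
    (hα : 0 ≤ 2 * α) : AEMeasurable (fun t => sobolevSq α (f t)) (timeMeasure T) :=
  (h.bounded.1.enorm.pow_const 2).add (aemeasurable_lamSq hα h.bounded.1)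

lemma InEnergyClass.lintegral_sobolevSq_ne_top {f : ℝ → L2} (h : InEnergyClass α T f) :
    ∫⁻ t, sobolevSq α (f t) ∂(timeMeasure T) ≠ ⊤ := h.dissipation.ne

lemma InEnergyClass.ae_lamSq_ne_top {f : ℝ → L2} (h : InEnergyClass α T f) (hα : 0 ≤ 2 * α) :
    ∀ᵐ t ∂(timeMeasure T), lamSq α (f t) ≠ ⊤ := by
  filter_upwards [ae_lt_top' (h.aemeasurable_sobolevSq hα) h.lintegral_sobolevSq_ne_top]
    with t ht
  exact (lt_of_le_of_lt le_add_self ht).ne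

lemma InEnergyClass.integrable_lamSq {f : ℝ → L2} (h : InEnergyClass α T f) (hα : 0 ≤ 2 * α) :
    Integrable (fun t => (lamSq α (f t)).toReal) (timeMeasure T) :=
  integrable_toReal_of_lintegral_ne_top (aemeasurable_lamSq hα h.bounded.1)
    (ne_top_of_le_ne_top h.lintegral_sobolevSq_ne_top (lintegral_mono fun _ => le_add_self))

lemma fieldSize_le_rpow (hα : 1 ≤ α) {f : L2} (hf : lamSq α f ≠ ⊤)
    {G : Fin 3 → Fin 3 → E3 → ℝ} (h : IsWeakGrad f G) :
    fieldSize k f G ≤ eLpNorm f (ENNReal.ofReal k) volume +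
      (100 * sobolevSq α f) ^ (1 / 2 : ℝ) := by
  refine (fieldSize_le hα hf h).trans (le_of_eq ?_)
  rw [ENNReal.mul_rpow_of_nonneg _ _ (by norm_num : (0 : ℝ) ≤ 1 / 2),
    show (100 : ℝ≥0∞) = 10 ^ (2 : ℝ) by rw [ENNReal.rpow_two]; norm_num, ← ENNReal.rpow_mul]
  norm_num [sobolevSq]

/-- A factor `L^p`, a factor `L^q` and a square integrable factor. -/
lemma integrable_toReal_mul {X : Type*} [MeasurableSpace X] {ν : Measure X}
    (hpq : p⁻¹ + q⁻¹ = 2⁻¹) {K M Z : X → ℝ≥0∞} (hK : MemLp K q ν) (hM : MemLp M p ν)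
    (hZ : MemLp Z 2 ν) (C : ℝ≥0∞) :
    Integrable (fun t => (C * (K t * (M t * Z t))).toReal) ν := by
  have : ENNReal.HolderTriple p q 2 := ⟨hpq⟩
  have h1 : MemLp (fun t => (M t).toReal * (K t).toReal) 2 ν :=
    (memLp_toReal hK).mul (memLp_toReal hM)
  have h2 := (h1.integrable_mul (memLp_toReal hZ)).const_mul C.toReal
  refine h2.congr (ae_of_all _ fun t => ?_)
  simp only [ENNReal.toReal_mul, Pi.mul_apply]
  ring

/-- Dominated convergence. The majorant is an `L^q` function `K` (the `L^k` norms) times an `L^p`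
function `M` (the multiplier norms) times an `L²` function `Z` (the sizes bounding the residuals),
plus the dissipation, which dominates its regularized version. -/
lemma tendsto_integral_power (h : Exponents s σ r k m) (hα : 1 ≤ α) (hα' : 0 ≤ 2 * α)
    (hp : 2 ≤ p) (hpq : p⁻¹ + q⁻¹ = 2⁻¹) (hu : InEnergyClass α T u) (hB : InEnergyClass α T B)
    (hgu : GradInLpMult T p s r m u) (hgB : GradInLpMult T p s r m B)
    (hqu : InLqLk T q k u) (hqB : InLqLk T q k B) {t : ℝ} (ht : t ∈ timeIco T) :
    Tendsto (fun n => ∫ τ in Set.Ioo 0 t, (isMollifier_mol n).power hα' (u τ) (B τ)) atTop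
      (𝓝 (∫ τ in Set.Ioo 0 t, -((lamSq α (u τ)).toReal + (lamSq α (B τ)).toReal))) := by
  obtain ⟨Gu, hGu, hMu⟩ := hgu
  obtain ⟨GB, hGB, hMB⟩ := hgB
  obtain ⟨C, hC, H⟩ := h.enorm_power_add_le
  have hk : 1 ≤ k := by linarith [h.r_ge, h.r_le]
  -- The residual also contains the `L^k` norm. On the bounded interval `(0, t)`, `q ≥ 2` puts that
  -- norm in `L²` in time.
  have hq : 2 ≤ q := by
    rw [← ENNReal.inv_le_inv, ← hpq]; exact le_add_self
  have hp0 : p ≠ 0 := (lt_of_lt_of_le two_pos hp).ne'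
  have hq0 : q ≠ 0 := (lt_of_lt_of_le two_pos hq).ne'
  set ν : Measure ℝ := volume.restrict (Set.Ioo 0 t) with hν
  have hle : ν ≤ timeMeasure T := restrict_Ioo_le_timeMeasure ht
  have hfinν : IsFiniteMeasure ν := ⟨by simp [hν]⟩
  set K : ℝ → ℝ≥0∞ := fun τ => eLpNorm (u τ) (ENNReal.ofReal k) volume +
    eLpNorm (B τ) (ENNReal.ofReal k) volume with hK
  set M : ℝ → ℝ≥0∞ := fun τ => multNormMat s r m (Gu τ) + multNormMat s r m (GB τ) with hM
  set Z : ℝ → ℝ≥0∞ := fun τ => K τ + ((100 * sobolevSq α (u τ)) ^ (1 / 2 : ℝ) +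
    (100 * sobolevSq α (B τ)) ^ (1 / 2 : ℝ)) with hZ
  have hKm : MemLp K q ν := (MemLp.add hqu hqB).mono_measure hle
  have hMm : MemLp M p ν := (hMu.add hMB).mono_measure hle
  have hL : ∀ {f : ℝ → L2}, InEnergyClass α T f →
      MemLp (fun τ => (100 * sobolevSq α (f τ)) ^ (1 / 2 : ℝ)) 2 ν := fun hf => by
    refine (memLp_rpow_half ((hf.aemeasurable_sobolevSq hα').const_mul _) ?_).mono_measure hle
    rw [lintegral_const_mul'' _ (hf.aemeasurable_sobolevSq hα')]
    exact ENNReal.mul_ne_top (by simp) hf.lintegral_sobolevSq_ne_top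
  have hZm : MemLp Z 2 ν := (hKm.mono_exponent hq).add ((hL hu).add (hL hB))
  have hsum : Integrable (fun τ => (lamSq α (u τ)).toReal + (lamSq α (B τ)).toReal) ν :=
    ((hu.integrable_lamSq hα').add (hB.integrable_lamSq hα')).mono_measure hle
  have hmeas : ∀ n, AEStronglyMeasurable
      (fun τ => (isMollifier_mol n).power hα' (u τ) (B τ)) ν := fun n =>
    (integrable_inner_of_memLp_top ht
      ((isMollifier_mol n).memLp_velocityForce hα' hu.bounded hB.bounded)
      (((isMollifier_mol n).smearL (F := E3)).comp_memLp' hu.bounded)).1.add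
    (integrable_inner_of_memLp_top ht
      ((isMollifier_mol n).memLp_magneticForce hα' hu.bounded hB.bounded)
      (((isMollifier_mol n).smearL (F := E3)).comp_memLp' hB.bounded)).1
  have hgood : ∀ᵐ τ ∂ν, (IsSolenoidal (u τ) ∧ IsSolenoidal (B τ)) ∧
      (lamSq α (u τ) ≠ ⊤ ∧ lamSq α (B τ) ≠ ⊤) ∧
      (IsWeakGrad (u τ) (Gu τ) ∧ IsWeakGrad (B τ) (GB τ)) ∧ K τ ≠ ⊤ ∧ M τ ≠ ⊤ ∧ Z τ ≠ ⊤ := by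
    filter_upwards [ae_mono hle hu.solenoidal, ae_mono hle hB.solenoidal,
      ae_mono hle (hu.ae_lamSq_ne_top hα'), ae_mono hle (hB.ae_lamSq_ne_top hα'),
      ae_mono hle hGu, ae_mono hle hGB, ae_ne_top_of_memLp hq0 hKm, ae_ne_top_of_memLp hp0 hMm,
      ae_ne_top_of_memLp two_ne_zero hZm] with τ a1 a2 a3 a4 a5 a6 a7 a8 a9
    exact ⟨⟨a1, a2⟩, ⟨a3, a4⟩, ⟨a5, a6⟩, a7, a8, a9⟩
  refine tendsto_integral_of_dominated_convergence
    (fun τ => (C * 2 * (K τ * (M τ * Z τ))).toReal +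
      ((lamSq α (u τ)).toReal + (lamSq α (B τ)).toReal)) hmeas
    ((integrable_toReal_mul hpq hKm hMm hZm (C * 2)).add hsum) (fun n => ?_) ?_
  · filter_upwards [hgood] with τ ⟨⟨a1, a2⟩, ⟨a3, a4⟩, ⟨a5, a6⟩, a7, a8, a9⟩
    have hs : residual k (mol2 n) (u τ) (Gu τ) + residual k (mol2 n) (B τ) (GB τ) ≤ 2 * Z τ := by
      refine (add_le_add (residual_le hk (isMollifier_mol2 n) a5)
        (residual_le hk (isMollifier_mol2 n) a6)).trans ?_
      rw [← mul_add]
      gcongr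
      refine (add_le_add (fieldSize_le_rpow hα a3 a5) (fieldSize_le_rpow hα a4 a6)).trans
        (le_of_eq ?_)
      simp only [hZ, hK]
      ring
    have hne : 2 * Z τ ≠ ⊤ := ENNReal.mul_ne_top (by simp) a9
    have h1 := H (mol n) (isMollifier_mol n) (2 * α) hα' (u τ) (B τ) (Gu τ) (GB τ) a1 a2 a5 a6
      (ne_top_of_le_ne_top hne (le_self_add.trans hs))
      (ne_top_of_le_ne_top hne (le_add_self.trans hs))
    have hne2 : C * 2 * (K τ * (M τ * Z τ)) ≠ ⊤ := ENNReal.mul_ne_top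
      (ENNReal.mul_ne_top hC (by simp)) (ENNReal.mul_ne_top a7 (ENNReal.mul_ne_top a8 a9))
    have h2 := h1.trans (calc
      _ ≤ C * (K τ * (M τ * (2 * Z τ))) := by
        gcongr
        exact hs
      _ = C * 2 * (K τ * (M τ * Z τ)) := by ring)
    have h3 := ENNReal.toReal_mono hne2 h2
    rw [toReal_enorm] at h3
    set D := ⟪(isMollifier_mol n).diffOp hα' (u τ), (isMollifier_mol n).smearL (u τ)⟫ +
      ⟪(isMollifier_mol n).diffOp hα' (B τ), (isMollifier_mol n).smearL (B τ)⟫ with hD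
    have hD0 : 0 ≤ D := add_nonneg ((isMollifier_mol n).inner_diffOp_nonneg hα' _)
      ((isMollifier_mol n).inner_diffOp_nonneg hα' _)
    have hD1 : D ≤ (lamSq α (u τ)).toReal + (lamSq α (B τ)).toReal :=
      add_le_add ((isMollifier_mol n).inner_diffOp_le hα' a3)
        ((isMollifier_mol n).inner_diffOp_le hα' a4)
    calc ‖(isMollifier_mol n).power hα' (u τ) (B τ)‖
        = ‖((isMollifier_mol n).power hα' (u τ) (B τ) + D) - D‖ := by rw [add_sub_cancel_right]
      _ ≤ ‖(isMollifier_mol n).power hα' (u τ) (B τ) + D‖ + ‖D‖ := norm_sub_le _ _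
      _ ≤ _ := by
          rw [Real.norm_of_nonneg hD0]
          exact add_le_add h3 hD1
  · filter_upwards [hgood] with τ ⟨⟨a1, a2⟩, ⟨a3, a4⟩, ⟨a5, a6⟩, a7, a8, a9⟩
    rw [ENNReal.add_ne_top] at a7 a8
    exact tendsto_power h hα hα' a1 a2 a3 a4 a5 a6 a7.1 a7.2 a8.1 a8.2

lemma kinetic_eq (u B : L2) : kinetic u B = ENNReal.ofReal ((‖u‖ ^ 2 + ‖B‖ ^ 2) / 2) := by
  rw [kinetic, ENNReal.ofReal_div_of_pos two_pos, ENNReal.ofReal_add (by positivity)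
    (by positivity), ENNReal.ofReal_pow (norm_nonneg _), ENNReal.ofReal_pow (norm_nonneg _),
    ofReal_norm, ofReal_norm, ENNReal.ofReal_ofNat]

/-- The smeared balances hold at every time for the averages of the weakly continuous
representative. Those averages converge strongly at each fixed time, so both the initial values and
the energy equality follow by uniqueness of limits. -/
theorem IsLerayHopf.exists_energy_eq (h : IsLerayHopf α T u₀ B₀ u B)
    (hE : Exponents s σ r k m) (hα : 1 ≤ α) (hp : 2 ≤ p) (hpq : p⁻¹ + q⁻¹ = 2⁻¹) (hT : 0 < T)
    (hu₀ : IsSolenoidal u₀) (hB₀ : IsSolenoidal B₀)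
    (hgu : GradInLpMult T p s r m u) (hgB : GradInLpMult T p s r m B)
    (hqu : InLqLk T q k u) (hqB : InLqLk T q k B) :
    ∃ u' B' : ℝ → L2, (∀ᵐ t ∂(timeMeasure T), u' t = u t ∧ B' t = B t) ∧
      u' 0 = u₀ ∧ B' 0 = B₀ ∧ WeaklyContinuous T u' ∧ WeaklyContinuous T B' ∧
      ∀ t ∈ timeIco T, totalEnergy α u' B' t = kinetic u₀ B₀ := by
  have hα' : 0 ≤ 2 * α := by linarith
  choose v b hv hb hvu hbB hv0 hb0 he using fun n =>
    h.exists_smeared hT hu₀ hB₀ (isMollifier_mol n) hα'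
  obtain ⟨Cu, -, hCu⟩ := exists_bound_of_memLp_top h.class_u.bounded
  obtain ⟨CB, -, hCB⟩ := exists_bound_of_memLp_top h.class_B.bounded
  have hS : ∀ x : L2, Tendsto (fun n => (isMollifier_mol n).smearL x) atTop (𝓝 x) :=
    tendsto_smearL_mol
  have hsym : ∀ n (x y : L2), ⟪(isMollifier_mol n).smearL x, y⟫ =
      ⟪x, (isMollifier_mol n).smearL y⟫ := fun n x y => (isMollifier_mol n).inner_smearL x y
  obtain ⟨u', hu1, hu2, hu3⟩ := exists_weaklyContinuous_repr (H := L2)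
    (S := fun n => (isMollifier_mol n).smearL) hsym hS hCu hv hvu
  obtain ⟨B', hB1, hB2, hB3⟩ := exists_weaklyContinuous_repr (H := L2)
    (S := fun n => (isMollifier_mol n).smearL) hsym hS hCB hb hbB
  have h0 : (0 : ℝ) ∈ timeIco T := ⟨le_rfl, by exact_mod_cast hT⟩
  refine ⟨u', B', hu1.and hB1, ?_, ?_, hu3, hB3, fun t ht => ?_⟩
  · refine tendsto_nhds_unique (hS (u' 0)) ((hS u₀).congr fun n => ?_)
    rw [hu2 n 0 h0, hv0]
  · refine tendsto_nhds_unique (hS (B' 0)) ((hS B₀).congr fun n => ?_)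
    rw [hB2 n 0 h0, hb0]
  have hle := restrict_Ioo_le_timeMeasure ht
  have hsq : ∀ x : L2, Tendsto (fun n => ‖(isMollifier_mol n).smearL x‖ ^ 2) atTop
      (𝓝 (‖x‖ ^ 2)) := fun x => ((hS x).norm).pow 2
  have l1 := (hsq (u' t)).add (hsq (B' t))
  have l2 := ((hsq u₀).add (hsq B₀)).add ((tendsto_integral_power hE hα hα' hp hpq h.class_u
    h.class_B hgu hgB hqu hqB ht).const_mul 2)
  have hen := tendsto_nhds_unique l1 (l2.congr fun n => by rw [hu2 n t ht, hB2 n t ht, he n t ht])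
  set ν : Measure ℝ := volume.restrict (Set.Ioo 0 t)
  have hsum : Integrable (fun τ => (lamSq α (u τ)).toReal + (lamSq α (B τ)).toReal) ν :=
    ((h.class_u.integrable_lamSq hα').add (h.class_B.integrable_lamSq hα')).mono_measure hle
  rw [integral_neg] at hen
  have hdis : ∫⁻ τ, (lamSq α (u' τ) + lamSq α (B' τ)) ∂ν =
      ENNReal.ofReal (∫ τ, ((lamSq α (u τ)).toReal + (lamSq α (B τ)).toReal) ∂ν) := by
    rw [ofReal_integral_eq_lintegral_ofReal hsum (ae_of_all _ fun τ => by positivity)]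
    refine lintegral_congr_ae ?_
    filter_upwards [ae_mono hle hu1, ae_mono hle hB1,
      ae_mono hle (h.class_u.ae_lamSq_ne_top hα'), ae_mono hle (h.class_B.ae_lamSq_ne_top hα')]
      with τ a1 a2 a3 a4
    rw [a1, a2, ENNReal.ofReal_add ENNReal.toReal_nonneg ENNReal.toReal_nonneg,
      ENNReal.ofReal_toReal a3, ENNReal.ofReal_toReal a4]
  rw [totalEnergy, hdis, kinetic_eq, kinetic_eq, ← ENNReal.ofReal_add (by positivity)
    (integral_nonneg fun τ => by positivity)]
  congr 1
  linarith

end Energy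

end FractionalMHD

end

theorem theorem1p5 (α β θ : ℝ) (hα : 1 ≤ α) (hβ : 0 ≤ β) (hθ : -1 ≤ θ) (hθ' : θ < 0)
    (p q : ℝ≥0∞) (hp : 2 ≤ p) (hp' : p < ⊤) (hpq : p⁻¹ + q⁻¹ = 2⁻¹)
    (T : EReal) (hT : 0 < T)
    (u₀ B₀ : FractionalMHD.L2)
    (hu₀ : FractionalMHD.IsSolenoidal u₀) (hB₀ : FractionalMHD.IsSolenoidal B₀)
    (u B : ℝ → FractionalMHD.L2)
    (hsol : FractionalMHD.IsLerayHopf α T u₀ B₀ u B)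
    (hgu : FractionalMHD.GradInLpMult T p ((1 + θ) / (1 + β)) ((6 - 3 * θ) / (3 - θ ^ 2))
      ((12 - 6 * θ) / (9 - 5 * θ)) u)
    (hgB : FractionalMHD.GradInLpMult T p ((1 + θ) / (1 + β)) ((6 - 3 * θ) / (3 - θ ^ 2))
      ((12 - 6 * θ) / (9 - 5 * θ)) B)
    (hqu : FractionalMHD.InLqLk T q ((12 - 6 * θ) / (3 - θ)) u)
    (hqB : FractionalMHD.InLqLk T q ((12 - 6 * θ) / (3 - θ)) B) :
    ∃ u' B' : ℝ → FractionalMHD.L2,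
      (∀ᵐ t ∂(FractionalMHD.timeMeasure T), u' t = u t ∧ B' t = B t) ∧
      u' 0 = u₀ ∧ B' 0 = B₀ ∧
      FractionalMHD.WeaklyContinuous T u' ∧ FractionalMHD.WeaklyContinuous T B' ∧
      ∀ t ∈ FractionalMHD.timeIco T,
        FractionalMHD.totalEnergy α u' B' t = FractionalMHD.kinetic u₀ B₀ :=
  hsol.exists_energy_eq (FractionalMHD.exponents_of_params hβ hθ hθ') hα hp hpq hT hu₀ hB₀
    hgu hgB hqu hqB
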